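/- Let $1<p\le\infty$ and $1/p+1/q=1$, let $C_0,C_1>0$ and let $H<\pi/2$. Then there is a constant $C>0$, depending only on $p,C_0,C_1,H$, such that the following holds. Let $x_1,\dots,x_N$ ($N\ge 1$) be distinct points of the unit sphere $\mathbb S^2\subset\mathbb R^3$, and let $d(x,y)=\arccos\langle x,y\rangle$. Let $V_i=\{x\in\mathbb S^2: d(x,x_i)<d(x,x_j)\ \forall j\ne i\}$ be the Voronoï cells, $\Gamma_{ij}=\overline{V_i}\cap\overline{V_j}$ and $\Lambda_i=\{j\ne i:\Gamma_{ij}\neq\emptyset\}$. Let $h=\max_i\sup_{x\in V_i}d(x_i,x)$ be the mesh size, and assume $h\le H$. Assume that the decomposition is almost uniform: with $m_l$ and $m_a$ denoting length and surface area, for all $i$ and all $j\in\Lambda_i$, $$\tfrac1{C_0}h\le m_l(\Gamma_{ij})\le C_0h,\qquad \tfrac1{C_1}h^2\le m_a(V_i)\le C_1h^2 .$$ Assume also that every Voronoï edge crosses its dual Delaunay edge: for all $i$ and $j\in\Lambda_i$, the midpoint of the minor geodesic arc from $x_i$ to $x_j$ belongs to $\Gamma_{ij}$. Let $T_{ijk}$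 be the planar triangle with vertices $x_i,x_j,x_k$, for all distinct $i,j,k$ with $\overline{V_i}\cap\overline{V_j}\cap\overline{V_k}\ne\emptyset$. Let $\mathbf S_h$ be the union of these triangles, let $\mathcal P(y)=y/\|y\|$, and let the lifted $\mathbb P_1$ space consist of the continuous functions $u_h$ on $\mathbb S^2$ for which $u_h\circ\mathcal P$ is, on $\mathbf S_h$, continuous and affine on each triangle $T_{ijk}$. Let $\nabla_s$ be the tangential gradient on $\mathbb S^2$ and put $$\mathcal A(u,v)=\int_{\mathbb S^2}\nabla_su\cdot\nabla_sv\,ds,\qquad \widetilde{\mathcal A}_h(u,w)=\sum_{i=1}^N w(x_i)\sum_{j\in\Lambda_i}\Big(-\int_{\Gamma_{ij}}\nabla_su\cdot \vec n_{ij}\,d\gamma\Big),\qquad \widetilde I_hv=\sum_{i=1}^N v(x_i)\chi_{V_i},$$ where $\vec n_{ij}=(x_j-x_i)/\|x_j-x_i\|$ is the unit co-normal on $\Gamma_{ij}$ pointing out of $V_i$, $d\gamma$ is arc length and $\chi_{V_i}$ is the characteristic function of $V_i$. Then for all $u_h,v_h$ in the lifted $\mathbb P_1$ space, $$\big|\mathcal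 A(u_h,v_h)-\widetilde{\mathcal A}_h(u_h,\widetilde I_hv_h)\big|\le C\,h^2\,\|\nabla_su_h\|_{L^p(\mathbb S^2)}\,\|\nabla_sv_h\|_{L^q(\mathbb S^2)} .$$ -/

import Mathlib

open scoped ENNReal

noncomputable section

namespace SphereFV

open MeasureTheory Classical

/-- Three-dimensional Euclidean space. -/
abbrev E3 : Type := EuclideanSpace ℝ (Fin 3)

/-- The unit sphere `𝕊²` of `ℝ³`. -/
def S2 : Set E3 := Metric.sphere 0 1

/-- The surface area measure `ds` of `𝕊²`, seen as a measure on `ℝ³` carried by `𝕊²`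
(total mass `4π`). -/
def surf : Measure E3 :=
  ((volume : Measure E3).toSphere).map (fun x : Metric.sphere (0 : E3) 1 => (x : E3))

/-- The geodesic distance `d(x,y) = arccos ⟨x,y⟩` of two points of `𝕊²`. -/
def geoDist (x y : E3) : ℝ := Real.arccos (inner ℝ x y)

/-- The length measure `dγ` on curves: one-dimensional Hausdorff measure. -/
def len : Measure E3 := Measure.hausdorffMeasure 1

/-- The radial projection `P(y) = y / ‖y‖`. -/
def radialProj (y : E3) : E3 := ‖y‖⁻¹ • y

/-! ### Tangential gradient

A function on `𝕊²` is represented by a function `ℝ³ → ℝ`, of which only the values on `𝕊²` are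
ever used. -/

/-- The radially constant extension of (the restriction to `𝕊²` of) `u`. -/
def radialExt (u : E3 → ℝ) : E3 → ℝ := fun y => u (radialProj y)

/-- The tangential gradient `∇ₛ u (x) = ∇u (x) - (∇u (x) · n) n`, `n = x` being the outer unit
normal of `𝕊²` at `x`; `u` is differentiated through its radially constant extension. -/
def tgrad (u : E3 → ℝ) (x : E3) : E3 :=
  gradient (radialExt u) x - (inner ℝ (gradient (radialExt u) x) x) • x

/-- The norm `‖∇ₛ u‖_{L^p(𝕊²)}`. -/
def tgradNorm (p : ℝ≥0∞) (u : E3 → ℝ) : ℝ := (eLpNorm (tgrad u) p surf).toReal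

/-- The bilinear form `𝒜(u,v) = ∫_{𝕊²} ∇ₛ u · ∇ₛ v ds`. -/
def formA (u v : E3 → ℝ) : ℝ := ∫ x, inner ℝ (tgrad u x) (tgrad v x) ∂surf

/-! ### The Voronoi–Delaunay decomposition generated by sites `x₁, …, x_N` -/

variable {N : ℕ}

/-- The open Voronoi cell `V_i`. -/
def cell (x : Fin N → E3) (i : Fin N) : Set E3 :=
  {y | y ∈ S2 ∧ ∀ j, j ≠ i → geoDist y (x i) < geoDist y (x j)}

/-- The Voronoi edge `Γ_ij = cl V_i ∩ cl V_j`. -/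
def vedge (x : Fin N → E3) (i j : Fin N) : Set E3 :=
  closure (cell x i) ∩ closure (cell x j)

/-- The indices of the neighbours of the site `x_i`. -/
def nbrs (x : Fin N → E3) (i : Fin N) : Finset (Fin N) :=
  Finset.univ.filter (fun j => j ≠ i ∧ (vedge x i j).Nonempty)

/-- `h_i`, the largest geodesic distance between `x_i` and the points of its cell. -/
def cellRadius (x : Fin N → E3) (i : Fin N) : ℝ :=
  sSup ((fun y => geoDist (x i) y) '' cell x i)

/-- The mesh size `h = max_i h_i`. -/
def meshSize (x : Fin N → E3) : ℝ := ⨆ i, cellRadius x i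

/-- Almost uniform decomposition, with constants `C₀` and `C₁`. -/
def AlmostUniform (x : Fin N → E3) (C₀ C₁ : ℝ) : Prop :=
  ∀ i,
    (∀ j ∈ nbrs x i,
      1 / C₀ * meshSize x ≤ len.real (vedge x i j) ∧
        len.real (vedge x i j) ≤ C₀ * meshSize x) ∧
    1 / C₁ * meshSize x ^ 2 ≤ surf.real (cell x i) ∧
      surf.real (cell x i) ≤ C₁ * meshSize x ^ 2

/-- The Voronoi edge `Γ_ij` crosses its dual Delaunay edge, the minor geodesic arc from `x_i` to
`x_j`, necessarily at the midpoint `x_ij = P((x_i + x_j)/2)` of that arc. -/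
def EdgesCross (x : Fin N → E3) : Prop :=
  ∀ i, ∀ j ∈ nbrs x i, radialProj (midpoint ℝ (x i) (x j)) ∈ vedge x i j

/-- `x_i, x_j, x_k` are the vertices of a Delaunay triangle: the three closed Voronoi cells have a
common point (a Voronoi vertex). -/
def IsDelaunay (x : Fin N → E3) (i j k : Fin N) : Prop :=
  i ≠ j ∧ j ≠ k ∧ i ≠ k ∧
    (closure (cell x i) ∩ closure (cell x j) ∩ closure (cell x k)).Nonempty

/-- The planar triangle `T_ijk`. -/
def tri (x : Fin N → E3) (i j k : Fin N) : Set E3 := convexHull ℝ {x i, x j, x k}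

/-- The polyhedral surface `S_h`, the union of the planar Delaunay triangles. -/
def polySurface (x : Fin N → E3) : Set E3 :=
  {y | ∃ i j k, IsDelaunay x i j k ∧ y ∈ tri x i j k}

/-- Membership in `ℙ₁(S_h)`: continuous on `S_h` and affine on each planar triangle. -/
def IsP1 (x : Fin N → E3) (w : E3 → ℝ) : Prop :=
  ContinuousOn w (polySurface x) ∧
    ∀ i j k, IsDelaunay x i j k → ∃ l : E3 →ᵃ[ℝ] ℝ, Set.EqOn w l (tri x i j k)

/-- Membership in the lifted space `ℙ₁(𝕊²)`: `u` is continuous on `𝕊²` and `u ∘ P = w` on `S_h`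
for some `w` in `ℙ₁(S_h)`. -/
def IsLiftedP1 (x : Fin N → E3) (u : E3 → ℝ) : Prop :=
  ContinuousOn u S2 ∧
    ∃ w, IsP1 x w ∧ ∀ y ∈ polySurface x, u (radialProj y) = w y

/-! ### The finite volume form -/

/-- The transfer operator `Ĩ_h`, `Ĩ_h v = ∑ i, v(x_i) χ_{V_i}`. -/
def transfer (x : Fin N → E3) (v : E3 → ℝ) : E3 → ℝ :=
  fun y => ∑ i, (cell x i).indicator (fun _ => v (x i)) y

/-- The co-normal unit vector on `Γ_ij`, pointing out of `V_i`; it is parallel to `x_j - x_i`, and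
so it is the same at all points of `Γ_ij`. -/
def conormal (x : Fin N → E3) (i j : Fin N) : E3 := ‖x j - x i‖⁻¹ • (x j - x i)

/-- The exact flux `F_ij(u) = - ∫_{Γ_ij} ∇ₛ u · n dγ`. -/
def flux (x : Fin N → E3) (u : E3 → ℝ) (i j : Fin N) : ℝ :=
  -∫ y in vedge x i j, inner ℝ (tgrad u y) (conormal x i j) ∂len

/-- The exact-flux bilinear form `Ã_h(u,w) = ∑ i, w(x_i) ∑ j ∈ Λ_i, F_ij(u)`, for `w` piecewise
constant on the Voronoi cells. -/
def formFV (x : Fin N → E3) (u w : E3 → ℝ) : ℝ :=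
  ∑ i, w (x i) * ∑ j ∈ nbrs x i, flux x u i j

end SphereFV

end

noncomputable section

namespace SphereFV

open MeasureTheory Classical
open scoped RealInnerProductSpace Pointwise

variable {N : ℕ}

/-! ### Euclidean geometry of a triangle inscribed in the unit sphere -/

/-! On a flat triangle whose circumcentre lies in the triangle, the finite volume scheme with
perpendicular bisectors as cell boundaries has the same stiffness as P1 finite elements
(`Tri.box_identity`). The sphere differs from its inscribed triangles only to second order, so the
proof transports this identity to the sphere and bounds the relative error.

The sphere is cut into flags, the spherical triangles with vertices a site, the midpoint direction
of a Delaunay edge and the circumcentre direction `c` of an adjacent triangle. Each flag carries one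
half of a Voronoi edge. If the plane of the triangle is at distance `ρ` from the origin, a lifted
affine function of slope `a` is `const + ρ ⟪a, w⟫ / ⟪c, w⟫` there. Hence its tangential gradient is
explicit (`liftGrad`), and its flux through the half edge is `⟪a, n⟫` times the integral of `ρ / ⟪c,
w⟫`. Since `ρ ≤ ⟪c, w⟫ ≤ 1` on the flag, gradient products, areas and lengths agree with the planar
ones up to a relative error of order `1 - ρ ^ 2`, with powers of `1 / ρ` as constants
(`Tri.local_error`). The planar terms cancel over the three rotations of a triangle
(`Tri.planarDefect_sum`). What remains is at most a multiple of the integral of `‖∇u‖ ‖∇v‖`, to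
which Hölder's inequality applies. Finally `ρ ≥ cos h`, so `1 - ρ ^ 2 ≤ sin² h ≤ h²`.

The geometric hypotheses make the flags a genuine decomposition. Edge crossing makes the triangles
non-obtuse (`Mesh.ang_nonneg`), so flags stay inside their triangles. The lower bound on edge
lengths excludes edges reduced to a point, hence four cells with a common point (`Mesh.not_four`).
Flags then cover almost all of the sphere (`Mesh.exists_flag`) and overlap in null sets
(`Mesh.flag_inter_null`). The finite volume sum becomes a sum over the same flags because fluxes are
antisymmetric (`Mesh.formFV_eq`). -/

lemma inner_E3 (a b : E3) : ⟪a, b⟫ = a 0 * b 0 + a 1 * b 1 + a 2 * b 2 := by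
  simp [PiLp.inner_apply, Fin.sum_univ_three]; ring

/-- The determinant of three vectors of `ℝ³`. -/
def det3 (a b c : E3) : ℝ :=
  a 0 * (b 1 * c 2 - b 2 * c 1) - a 1 * (b 0 * c 2 - b 2 * c 0) + a 2 * (b 0 * c 1 - b 1 * c 0)

/-- The squared determinant is the Gram determinant. -/
lemma det3_sq (a b c : E3) : det3 a b c ^ 2 =
    ⟪a, a⟫ * (⟪b, b⟫ * ⟪c, c⟫ - ⟪b, c⟫ ^ 2)
      - ⟪a, b⟫ * (⟪a, b⟫ * ⟪c, c⟫ - ⟪b, c⟫ * ⟪a, c⟫)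
      + ⟪a, c⟫ * (⟪a, b⟫ * ⟪b, c⟫ - ⟪b, b⟫ * ⟪a, c⟫) := by
  simp only [inner_E3, det3]; ring

lemma eq_zero_of_det3_ne_zero {a b c z : E3} (h : det3 a b c ≠ 0) (ha : ⟪a, z⟫ = 0)
    (hb : ⟪b, z⟫ = 0) (hc : ⟪c, z⟫ = 0) : z = 0 := by
  rw [inner_E3] at ha hb hc
  ext i
  apply mul_left_cancel₀ h
  fin_cases i <;> simp only [det3, Fin.zero_eta, Fin.mk_one, Fin.reduceFinMk, PiLp.zero_apply]
  -- Coordinates of `det3 a b c • z = ⟪a, z⟫ b × c + ⟪b, z⟫ c × a + ⟪c, z⟫ a × b`.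
  · linear_combination (b 1 * c 2 - b 2 * c 1) * ha + (c 1 * a 2 - c 2 * a 1) * hb
      + (a 1 * b 2 - a 2 * b 1) * hc
  · linear_combination (b 2 * c 0 - b 0 * c 2) * ha + (c 2 * a 0 - c 0 * a 2) * hb
      + (a 2 * b 0 - a 0 * b 2) * hc
  · linear_combination (b 0 * c 1 - b 1 * c 0) * ha + (c 0 * a 1 - c 1 * a 0) * hb
      + (a 0 * b 1 - a 1 * b 0) * hc

/-- `ang x y z = ⟪x - z, y - z⟫`, of the sign of the cosine of the angle at `z`. -/
def ang (x y z : E3) : ℝ := ⟪x - z, y - z⟫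

/-- Four times the squared area of the planar triangle `x y z`. -/
def gram (x y z : E3) : ℝ := ‖x - z‖ ^ 2 * ‖y - z‖ ^ 2 - ⟪x - z, y - z⟫ ^ 2

/-- The vertices `x, y, z` of a non-obtuse triangle on the unit sphere; the unit vector `c` is the
direction of the circumcentre, and `ρ` the distance from the origin to the plane of the triangle. -/
structure Tri (x y z c : E3) (ρ : ℝ) : Prop where
  nx : ‖x‖ = 1
  ny : ‖y‖ = 1
  nz : ‖z‖ = 1
  nc : ‖c‖ = 1
  hxy : x ≠ y
  hyz : y ≠ z
  hzx : z ≠ x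
  pos : 0 < ρ
  cx : ⟪c, x⟫ = ρ
  cy : ⟪c, y⟫ = ρ
  cz : ⟪c, z⟫ = ρ
  ax : 0 ≤ ang y z x
  ay : 0 ≤ ang z x y
  az : 0 ≤ ang x y z

lemma inner_self_one {x : E3} (h : ‖x‖ = 1) : ⟪x, x⟫ = 1 := by
  rw [real_inner_self_eq_norm_sq, h]; norm_num

lemma norm_sub_sq_unit {x y : E3} (hx : ‖x‖ = 1) (hy : ‖y‖ = 1) :
    ‖x - y‖ ^ 2 = 2 - 2 * ⟪x, y⟫ := by
  rw [norm_sub_sq_real, hx, hy]; ring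

lemma ang_unit {x y z : E3} (hz : ‖z‖ = 1) :
    ang x y z = ⟪x, y⟫ - ⟪x, z⟫ - ⟪y, z⟫ + 1 := by
  rw [ang, inner_sub_left, inner_sub_right, inner_sub_right, inner_self_one hz,
    real_inner_comm y z]; ring

lemma gram_unit {x y z : E3} (hx : ‖x‖ = 1) (hy : ‖y‖ = 1) (hz : ‖z‖ = 1) :
    gram x y z = (2 - 2 * ⟪x, z⟫) * (2 - 2 * ⟪y, z⟫)
      - (⟪x, y⟫ - ⟪x, z⟫ - ⟪y, z⟫ + 1) ^ 2 := by
  rw [gram, norm_sub_sq_unit hx hz, norm_sub_sq_unit hy hz, ← ang_unit hz, ang]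

lemma inner_lt_one_of_ne {x y : E3} (hx : ‖x‖ = 1) (hy : ‖y‖ = 1) (h : x ≠ y) :
    ⟪x, y⟫ < 1 := by
  have := norm_sub_sq_unit hx hy
  have h2 : 0 < ‖x - y‖ := norm_pos_iff.2 (sub_ne_zero.2 h)
  nlinarith [pow_pos h2 2]

/-- Equality in Cauchy–Schwarz would make the three points collinear, but a line meets the sphere at
most twice. -/
lemma gram_pos {x y z : E3} (hx : ‖x‖ = 1) (hy : ‖y‖ = 1) (hz : ‖z‖ = 1) (hxy : x ≠ y)
    (hyz : y ≠ z) (hzx : z ≠ x) : 0 < gram x y z := by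
  have h0 : 0 ≤ gram x y z := by
    have := abs_real_inner_le_norm (x - z) (y - z)
    have h2 := sq_le_sq' (by linarith [neg_abs_le ⟪x - z, y - z⟫, abs_nonneg ⟪x - z, y - z⟫])
      ((le_abs_self _).trans this)
    rw [gram]; nlinarith
  refine lt_of_le_of_ne h0 fun h => ?_
  have hp : 0 < 2 - 2 * ⟪x, z⟫ := by linarith [inner_lt_one_of_ne hx hz hzx.symm]
  have hq : 0 < 2 - 2 * ⟪y, z⟫ := by linarith [inner_lt_one_of_ne hy hz hyz]
  have hr := inner_lt_one_of_ne hx hy hxy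
  rw [gram_unit hx hy hz] at h
  set p := ⟪x, z⟫ with hpd
  set q := ⟪y, z⟫ with hqd
  set r := ⟪x, y⟫ with hrd
  -- The squared norm of the difference of the two sides is `(2 - 2 * q)` times the Gram
  -- determinant, hence zero.
  have hv : (2 - 2 * q) • (x - z) = (r - p - q + 1) • (y - z) := by
    rw [← sub_eq_zero, ← inner_self_eq_zero (𝕜 := ℝ)]
    simp only [inner_sub_left, inner_sub_right, real_inner_smul_left, real_inner_smul_right,
      inner_self_one hx, inner_self_one hy, inner_self_one hz, real_inner_comm y x,
      real_inner_comm z x, real_inner_comm z y]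
    rw [real_inner_comm x z, real_inner_comm y z, real_inner_comm x y, ← hpd, ← hqd, ← hrd]
    linear_combination (-(2 - 2 * q)) * h
  have h1 := congrArg (fun w => ⟪w, z⟫) hv
  simp only [real_inner_smul_left, inner_sub_left, inner_self_one hz, ← hpd, ← hqd] at h1
  have h2 : 2 - 2 * p = r - p - q + 1 := by
    apply mul_left_cancel₀ hq.ne'; linear_combination -2 * h1
  have h3 : 2 - 2 * q = r - p - q + 1 := by
    apply mul_left_cancel₀ hp.ne'
    linear_combination -h + (r - p - q + 1) * (-h2)
  linarith

lemma det3_ne_zero_of_gram {x y z c : E3} (hg : 0 < gram x y z) (hc : ‖c‖ = 1)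
    (hx : ⟪x - z, c⟫ = 0) (hy : ⟪y - z, c⟫ = 0) : det3 (x - z) (y - z) c ≠ 0 := by
  intro h
  have := det3_sq (x - z) (y - z) c
  rw [h, hx, hy, inner_self_one hc, real_inner_self_eq_norm_sq, real_inner_self_eq_norm_sq] at this
  rw [gram] at hg; nlinarith

/-! ### Circumcentre, apothems and the box-method identity of one triangle -/

namespace Tri
variable {x y z c : E3} {ρ : ℝ}

lemma rot (h : Tri x y z c ρ) : Tri y z x c ρ :=
  ⟨h.ny, h.nz, h.nx, h.nc, h.hyz, h.hzx, h.hxy, h.pos, h.cy, h.cz, h.cx, h.ay, h.az, h.ax⟩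

lemma gram_pos (h : Tri x y z c ρ) : 0 < gram x y z :=
  SphereFV.gram_pos h.nx h.ny h.nz h.hxy h.hyz h.hzx

lemma gram_rot (h : Tri x y z c ρ) : gram y z x = gram x y z := by
  rw [gram_unit h.nx h.ny h.nz, gram_unit h.ny h.nz h.nx, real_inner_comm y x,
    real_inner_comm z x]
  rw [real_inner_comm x y, real_inner_comm x z]; ring

lemma sub_xz (h : Tri x y z c ρ) : ⟪x - z, c⟫ = 0 := by
  rw [inner_sub_left, real_inner_comm, h.cx, real_inner_comm, h.cz, sub_self]

lemma sub_yz (h : Tri x y z c ρ) : ⟪y - z, c⟫ = 0 := by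
  rw [inner_sub_left, real_inner_comm, h.cy, real_inner_comm, h.cz, sub_self]

lemma eq_zero (h : Tri x y z c ρ) {v : E3} (h1 : ⟪x - z, v⟫ = 0) (h2 : ⟪y - z, v⟫ = 0)
    (h3 : ⟪c, v⟫ = 0) : v = 0 :=
  eq_zero_of_det3_ne_zero (det3_ne_zero_of_gram h.gram_pos h.nc h.sub_xz h.sub_yz) h1 h2 h3

/-- Barycentric coordinate, with respect to `z`, of the circumcentre. -/
def wt (x y z : E3) : ℝ := ‖x - y‖ ^ 2 * ang x y z / (2 * gram x y z)

lemma wt_nonneg (h : Tri x y z c ρ) : 0 ≤ wt x y z :=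
  div_nonneg (mul_nonneg (sq_nonneg _) h.az) (by linarith [h.gram_pos])

lemma wt_unit (h : Tri x y z c ρ) : wt x y z =
    (1 - ⟪x, y⟫) * (⟪x, y⟫ - ⟪z, x⟫ - ⟪y, z⟫ + 1) / gram x y z := by
  have hg := h.gram_pos
  rw [wt, norm_sub_sq_unit h.nx h.ny, ang_unit h.nz, real_inner_comm z x]
  field_simp

lemma wt_sum (h : Tri x y z c ρ) : wt y z x + wt z x y + wt x y z = 1 := by
  have hg := h.gram_pos
  rw [h.wt_unit, h.rot.wt_unit, h.rot.rot.wt_unit, h.rot.gram_rot, h.gram_rot, ← add_div,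
    ← add_div, div_eq_one_iff_eq hg.ne', gram_unit h.nx h.ny h.nz, real_inner_comm z x]
  ring

/-- `ρ • c` is the foot of the perpendicular from the origin, hence the circumcentre. The identity
is checked against the basis `x - z`, `y - z`, `c`. -/
lemma center_eq (h : Tri x y z c ρ) :
    ρ • c = wt y z x • x + wt z x y • y + wt x y z • z := by
  have hg := h.gram_pos
  have hs := h.wt_sum
  rw [← sub_eq_zero]
  apply h.eq_zero
  · rw [inner_sub_right, real_inner_smul_right, h.sub_xz, h.wt_unit, h.rot.wt_unit,
      h.rot.rot.wt_unit, h.rot.gram_rot, h.gram_rot]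
    simp only [inner_add_right, real_inner_smul_right, inner_sub_left, inner_self_one h.nx,
      inner_self_one h.nz, real_inner_comm y z, real_inner_comm z x]
    field_simp
    ring
  · rw [inner_sub_right, real_inner_smul_right, h.sub_yz, h.wt_unit, h.rot.wt_unit,
      h.rot.rot.wt_unit, h.rot.gram_rot, h.gram_rot]
    simp only [inner_add_right, real_inner_smul_right, inner_sub_left, inner_self_one h.ny,
      inner_self_one h.nz, real_inner_comm x y, real_inner_comm y z]
    field_simp
    ring
  · simp only [inner_sub_right, inner_add_right, real_inner_smul_right, h.cx, h.cy, h.cz,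
      inner_self_one h.nc]
    linear_combination -ρ * hs

/-- The distance from the circumcentre to the side `x y`. -/
def apothem (x y c : E3) (ρ : ℝ) : ℝ := ‖ρ • c - midpoint ℝ x y‖

lemma sub_mid_orth (h : Tri x y z c ρ) : ⟪ρ • c - midpoint ℝ x y, x - y⟫ = 0 := by
  rw [midpoint_eq_smul_add]
  simp only [inner_sub_left, inner_sub_right, real_inner_smul_left, inner_add_left, h.cx, h.cy,
    inner_self_one h.nx, inner_self_one h.ny, real_inner_comm x y]
  ring

lemma sub_mid_orth_c (h : Tri x y z c ρ) : ⟪ρ • c - midpoint ℝ x y, c⟫ = 0 := by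
  rw [midpoint_eq_smul_add, real_inner_comm]
  simp only [inner_sub_right, real_inner_smul_right, inner_add_right, h.cx, h.cy,
    inner_self_one h.nc, invOf_eq_inv]
  ring

/-- Pythagoras gives `1 - ρ ^ 2 = R ^ 2`, and the circumradius `R` is the product of the sides over
four times the area. -/
lemma rho_sq (h : Tri x y z c ρ) : ρ ^ 2 =
    1 - (2 * (1 - ⟪x, y⟫) * (1 - ⟪y, z⟫) * (1 - ⟪z, x⟫)) / gram x y z := by
  have hg := h.gram_pos
  have h1 := congrArg (fun v => ⟪x, v⟫) h.center_eq
  simp only [inner_add_right, real_inner_smul_right, inner_self_one h.nx, real_inner_comm c x,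
    real_inner_comm z x, h.cx] at h1
  rw [ h.wt_unit, h.rot.wt_unit,
      h.rot.rot.wt_unit, h.rot.gram_rot, h.gram_rot] at h1
  rw [sq, h1]
  have hG := gram_unit h.nx h.ny h.nz
  rw [real_inner_comm z x] at hG
  field_simp
  rw [hG]; ring

/-- The apothem is `R` times the cosine of the angle at `z`. As it is a norm, this needs that angle
to be non-obtuse. -/
lemma apothem_eq (h : Tri x y z c ρ) :
    apothem x y c ρ = ‖x - y‖ * ang x y z / (2 * √(gram x y z)) := by
  have hg := h.gram_pos
  have hr := h.rho_sq
  apply (sq_eq_sq₀ (norm_nonneg _) (div_nonneg (mul_nonneg (norm_nonneg _) h.az)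
    (by positivity))).1
  rw [div_pow, mul_pow, mul_pow, Real.sq_sqrt hg.le, norm_sub_sq_unit h.nx h.ny, ang_unit h.nz,
    ← real_inner_self_eq_norm_sq, inner_sub_right, real_inner_smul_right, h.sub_mid_orth_c,
    midpoint_eq_smul_add]
  simp only [inner_sub_left, inner_add_left, inner_add_right, real_inner_smul_left,
    real_inner_smul_right, h.cx, h.cy, inner_self_one h.nx, inner_self_one h.ny,
    real_inner_comm x y, real_inner_comm z x]
  have hG := gram_unit h.nx h.ny h.nz
  rw [real_inner_comm z x] at hG
  rw [invOf_eq_inv]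
  field_simp at hr ⊢
  linear_combination -4 * hr + (2 * ⟪x, y⟫ - 2) * hG

/-- The box-method identity: the stiffness of affine functions on a triangle equals the flux across
the segments joining the circumcentre to the midpoints of the sides. -/
lemma box_identity (h : Tri x y z c ρ) {a b : E3} (ha : ⟪c, a⟫ = 0) :
    ang x y z * (‖x - y‖ ^ 2 * ⟪a, b⟫ - 2 * (⟪a, x - y⟫ * ⟪b, x - y⟫)) +
    ang y z x * (‖y - z‖ ^ 2 * ⟪a, b⟫ - 2 * (⟪a, y - z⟫ * ⟪b, y - z⟫)) +
    ang z x y * (‖z - x‖ ^ 2 * ⟪a, b⟫ - 2 * (⟪a, z - x⟫ * ⟪b, z - x⟫)) = 0 := by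
  obtain ⟨A, hA⟩ : ∃ A, A = x - z := ⟨_, rfl⟩
  obtain ⟨B, hB⟩ : ∃ B, B = y - z := ⟨_, rfl⟩
  have hAc : ⟪A, c⟫ = 0 := hA ▸ h.sub_xz
  have hBc : ⟪B, c⟫ = 0 := hB ▸ h.sub_yz
  have s1 : ang x y z = ⟪A, B⟫ := by rw [hA, hB, ang]
  have hg : gram x y z = ‖A‖ ^ 2 * ‖B‖ ^ 2 - ⟪A, B⟫ ^ 2 := by rw [hA, hB, gram]
  -- Since `a` is orthogonal to `c`, it expands in the two sides `A` and `B`, with coefficients from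
  -- the inverse Gram matrix.
  have hv : gram x y z • a - (‖B‖ ^ 2 * ⟪A, a⟫ - ⟪A, B⟫ * ⟪B, a⟫) • A
      - (‖A‖ ^ 2 * ⟪B, a⟫ - ⟪A, B⟫ * ⟪A, a⟫) • B = 0 := by
    apply h.eq_zero
    · rw [← hA]
      simp only [inner_sub_right, real_inner_smul_right, hg, real_inner_self_eq_norm_sq]
      ring
    · rw [← hB]
      simp only [inner_sub_right, real_inner_smul_right, hg, real_inner_self_eq_norm_sq, real_inner_comm A B]
      ring
    · simp only [inner_sub_right, real_inner_smul_right, ha, real_inner_comm A c,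
        real_inner_comm B c, hAc, hBc]
      ring
  have hab := congrArg (fun v => ⟪v, b⟫) hv
  simp only [inner_sub_left, real_inner_smul_left, inner_zero_left] at hab
  have e1 : x - y = A - B := by rw [hA, hB]; abel
  have e2 : z - x = -A := by rw [hA]; abel
  have s2 : ang y z x = ‖A‖ ^ 2 - ⟪A, B⟫ := by
    rw [ang, e2, show y - x = B - A by rw [hA, hB]; abel, inner_neg_right, inner_sub_left,
      real_inner_self_eq_norm_sq, real_inner_comm]; ring
  have s3 : ang z x y = ‖B‖ ^ 2 - ⟪A, B⟫ := by
    rw [ang, e1, show z - y = -B by rw [hB]; abel, inner_neg_left, inner_sub_right,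
      real_inner_self_eq_norm_sq, real_inner_comm]; ring
  rw [s1, s2, s3, e1, e2, ← hB, norm_sub_sq_real, norm_neg, inner_neg_right, inner_neg_right,
    inner_sub_right a, inner_sub_right b, real_inner_comm A a, real_inner_comm A b,
    real_inner_comm B a, real_inner_comm B b]
  rw [hg] at hab
  linear_combination 2 * hab

/-- Six times the volume of the pyramid with apex the origin, height `ρ` and base the planar flag, a
right triangle with legs `‖x - y‖ / 2` and the apothem. -/
lemma det3_eq (h : Tri x y z c ρ) :
    |det3 x (midpoint ℝ x y) (ρ • c)| = ρ * apothem x y c ρ * ‖x - y‖ / 2 := by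
  have hp := h.pos
  have e : det3 x (midpoint ℝ x y) (ρ • c) =
      -(ρ / 2) * det3 (x - y) (ρ • c - midpoint ℝ x y) c := by
    rw [midpoint_eq_smul_add, invOf_eq_inv]
    simp only [det3, PiLp.sub_apply, PiLp.smul_apply, PiLp.add_apply, smul_eq_mul]
    ring
  have hxc : ⟪x - y, c⟫ = 0 := by
    rw [inner_sub_left, real_inner_comm, h.cx, real_inner_comm, h.cy, sub_self]
  have hd : |det3 (x - y) (ρ • c - midpoint ℝ x y) c| = apothem x y c ρ * ‖x - y‖ := by
    rw [← abs_of_nonneg (show 0 ≤ apothem x y c ρ * ‖x - y‖ from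
      mul_nonneg (norm_nonneg _) (norm_nonneg _)), ← sq_eq_sq_iff_abs_eq_abs, det3_sq,
      h.sub_mid_orth_c, hxc, real_inner_comm (ρ • c - midpoint ℝ x y) (x - y), h.sub_mid_orth, inner_self_one h.nc,
      real_inner_self_eq_norm_sq, real_inner_self_eq_norm_sq, apothem]
    ring
  rw [e, abs_mul, hd, abs_neg, abs_of_pos (by positivity)]
  ring

end Tri

/-! ### Surface measure of spherical triangles -/

lemma measure_eq_two_mul_of_reflection {α : Type*} [MeasurableSpace α] {μ : Measure α}
    {R : α → α} (hR : MeasurePreserving R μ μ) {f : α → ℝ} (hf : Measurable f)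
    (hfR : ∀ x, f (R x) = -f x) (h0 : μ {x | f x = 0} = 0) {S : Set α} (hS : MeasurableSet S)
    (hSR : R ⁻¹' S = S) : μ S = 2 * μ (S ∩ {x | 0 ≤ f x}) := by
  have hm : MeasurableSet {x | 0 ≤ f x} := measurableSet_le measurable_const hf
  rw [← measure_inter_add_sdiff S hm, two_mul]
  congr 1
  have h1 : μ (S \ {x | 0 ≤ f x}) = μ (S ∩ {x | 0 < f x}) := by
    rw [← hR.measure_preimage (hS.diff hm).nullMeasurableSet]
    congr 1
    ext x
    have : R x ∈ S ↔ x ∈ S := by rw [← Set.mem_preimage, hSR]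
    simp [hfR, this]
  rw [h1]
  apply measure_congr
  refine Filter.EventuallyEq.rfl.inter ?_
  have : ∀ᵐ x ∂μ, f x ≠ 0 := by rw [ae_iff]; simpa using h0
  filter_upwards [this] with x hx
  exact propext ⟨fun h => le_of_lt h, fun h => lt_of_le_of_ne h (Ne.symm hx)⟩

/-- The standard corner simplex. -/
def corner : Set E3 := {s | (∀ i, 0 ≤ s i) ∧ s 0 + s 1 + s 2 < 1}

/-- The unit ball of the `ℓ¹` norm has volume `2 ^ 3 / Γ(4) = 8 / 6`, and three coordinate
reflections cut it into eight equal corners. -/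
lemma volume_pi_corner :
    volume {s : Fin 3 → ℝ | (∀ i, 0 ≤ s i) ∧ s 0 + s 1 + s 2 < 1} = ENNReal.ofReal (1 / 6) := by
  have hoct := volume_sum_rpow_lt_one (Fin 3) (le_refl (1 : ℝ))
  have hflip : ∀ k : Fin 3, MeasurePreserving
      (fun (x : Fin 3 → ℝ) j => (if j = k then (fun t : ℝ => -t) else id) (x j)) := by
    intro k
    refine volume_preserving_pi (f := fun j => if j = k then (fun t : ℝ => -t) else id) fun j => ?_
    by_cases h : j = k
    · simpa [h] using Measure.measurePreserving_neg (volume : Measure ℝ)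
    · simpa [h] using MeasurePreserving.id (volume : Measure ℝ)
  have hnull : ∀ k : Fin 3, volume {x : Fin 3 → ℝ | x k = 0} = 0 := by
    intro k
    have : {x : Fin 3 → ℝ | x k = 0} =
        (LinearMap.ker (LinearMap.proj k : (Fin 3 → ℝ) →ₗ[ℝ] ℝ) : Set (Fin 3 → ℝ)) := by
      ext; simp
    rw [this]
    apply Measure.addHaar_submodule
    intro h
    have : (LinearMap.proj k : (Fin 3 → ℝ) →ₗ[ℝ] ℝ) = 0 := LinearMap.ker_eq_top.1 h
    simpa using congrArg (fun g => g (fun _ => (1 : ℝ))) this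
  have hfl : ∀ (k : Fin 3) (x : Fin 3 → ℝ) (i : Fin 3),
      (if i = k then (fun t : ℝ => -t) else id) (x i) = if i = k then - x i else x i := by
    intro k x i; split_ifs <;> rfl
  have step : ∀ (k : Fin 3) (S : Set (Fin 3 → ℝ)), MeasurableSet S →
      ((fun (x : Fin 3 → ℝ) j => (if j = k then (fun t : ℝ => -t) else id) (x j)) ⁻¹' S = S) →
      volume S = 2 * volume (S ∩ {x | 0 ≤ x k}) := fun k S hS hR =>
    measure_eq_two_mul_of_reflection (hflip k) (measurable_pi_apply k) (by simp) (hnull k) hS hR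
  set O : Set (Fin 3 → ℝ) := {x | ∑ i, |x i| ^ (1 : ℝ) < 1} with hO
  have hOm : MeasurableSet O := by
    apply measurableSet_lt _ measurable_const
    fun_prop
  have hk : ∀ k : Fin 3, MeasurableSet {x : Fin 3 → ℝ | 0 ≤ x k} := fun k =>
    measurableSet_le measurable_const (measurable_pi_apply k)
  have hOi : ∀ k : Fin 3, (fun (x : Fin 3 → ℝ) j =>
      (if j = k then (fun t : ℝ => -t) else id) (x j)) ⁻¹' O = O := by
    intro k; ext x
    simp only [hO, Set.mem_preimage, Set.mem_ofPred_eq, hfl]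
    have : ∀ i, |if i = k then - x i else x i| = |x i| := by
      intro i; split_ifs <;> simp
    simp only [this]
  have h0 := step 0 O hOm (hOi 0)
  have h1 := step 1 (O ∩ {x | 0 ≤ x 0}) (hOm.inter (hk 0)) (by
    rw [Set.preimage_inter, hOi 1]; simp)
  have h2 := step 2 (O ∩ {x | 0 ≤ x 0} ∩ {x | 0 ≤ x 1}) ((hOm.inter (hk 0)).inter (hk 1)) (by
    rw [Set.preimage_inter, Set.preimage_inter, hOi 2]; simp)
  have hset : {s : Fin 3 → ℝ | (∀ i, 0 ≤ s i) ∧ s 0 + s 1 + s 2 < 1} =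
      O ∩ {x | 0 ≤ x 0} ∩ {x | 0 ≤ x 1} ∩ {x | 0 ≤ x 2} := by
    ext x
    simp only [hO, Real.rpow_one, Fin.sum_univ_three, Set.mem_ofPred_eq, Set.mem_inter_iff,
      Fin.forall_fin_succ]
    constructor
    · rintro ⟨⟨a, b, c, -⟩, h⟩
      simp only [Fin.succ_zero_eq_one, Fin.succ_one_eq_two] at b c
      refine ⟨⟨⟨?_, a⟩, b⟩, c⟩
      rwa [abs_of_nonneg a, abs_of_nonneg b, abs_of_nonneg c]
    · rintro ⟨⟨⟨h, a⟩, b⟩, c⟩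
      rw [abs_of_nonneg a, abs_of_nonneg b, abs_of_nonneg c] at h
      exact ⟨⟨a, b, c, fun i => i.elim0⟩, h⟩
  rw [hset]
  rw [h0, h1, h2] at hoct
  have hval : ENNReal.ofReal ((2 * Real.Gamma (1 / 1 + 1)) ^ Fintype.card (Fin 3) /
      Real.Gamma ((Fintype.card (Fin 3) : ℝ) / 1 + 1)) = 8 * ENNReal.ofReal (1 / 6) := by
    have g1 : Real.Gamma (1 / 1 + 1) = 1 := by norm_num [Real.Gamma_two]
    have g2 : Real.Gamma ((Fintype.card (Fin 3) : ℝ) / 1 + 1) = 6 := by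
      have := Real.Gamma_nat_eq_factorial 3
      rw [Fintype.card_fin, div_one, this]
      norm_num [Nat.factorial]
    rw [g1, g2, ← ENNReal.ofReal_ofNat 8, ← ENNReal.ofReal_mul (by norm_num)]
    norm_num
  rw [hval, ← mul_assoc, ← mul_assoc, show (2 : ℝ≥0∞) * 2 * 2 = 8 by norm_num] at hoct
  exact (ENNReal.mul_right_inj (by norm_num) (by norm_num)).1 hoct

lemma volume_corner : volume corner = ENNReal.ofReal (1 / 6) := by
  rw [← volume_pi_corner, ← (EuclideanSpace.volume_preserving_symm_measurableEquiv_toLp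
    (Fin 3)).measure_preimage_equiv]
  rfl

/-- The linear map `s ↦ s₀ a + s₁ b + s₂ c`. -/
def combo (a b c : E3) : E3 →ₗ[ℝ] E3 :=
  Matrix.toLin (EuclideanSpace.basisFun (Fin 3) ℝ).toBasis (EuclideanSpace.basisFun (Fin 3) ℝ).toBasis
    (Matrix.of fun i j => ![a, b, c] j i)

lemma combo_apply (a b c s : E3) : combo a b c s = s 0 • a + s 1 • b + s 2 • c := by
  rw [combo, Matrix.toLin_apply]
  ext i
  fin_cases i <;> simp [Matrix.mulVec, dotProduct, Fin.sum_univ_three] <;> ring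

lemma det_combo (a b c : E3) : LinearMap.det (combo a b c) = det3 a b c := by
  rw [combo, LinearMap.det_toLin, Matrix.det_fin_three]
  simp [det3]; ring

lemma volume_combo_corner (a b c : E3) :
    volume (combo a b c '' corner) = ENNReal.ofReal (|det3 a b c| / 6) := by
  rw [Measure.addHaar_image_linearMap, det_combo, volume_corner,
    ← ENNReal.ofReal_mul (abs_nonneg _)]
  congr 1; ring

lemma mem_S2 {y : E3} : y ∈ S2 ↔ ‖y‖ = 1 := by simp [S2]

lemma norm_radialProj {y : E3} (h : y ≠ 0) : ‖radialProj y‖ = 1 := by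
  rw [radialProj, norm_smul, norm_inv, norm_norm, inv_mul_cancel₀ (norm_ne_zero_iff.2 h)]

lemma radialProj_smul {t : ℝ} (ht : 0 < t) (y : E3) : radialProj (t • y) = radialProj y := by
  rw [radialProj, radialProj, norm_smul, Real.norm_of_nonneg ht.le, smul_smul, mul_inv,
    mul_right_comm, inv_mul_cancel₀ ht.ne', one_mul]

lemma radialProj_of_norm_one {y : E3} (h : ‖y‖ = 1) : radialProj y = y := by
  rw [radialProj, h, inv_one, one_smul]

lemma continuousOn_radialProj : ContinuousOn radialProj {y : E3 | y ≠ 0} := by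
  apply ContinuousOn.smul (ContinuousOn.inv₀ continuous_norm.continuousOn ?_) continuousOn_id
  exact fun y hy => norm_ne_zero_iff.2 hy

lemma surf_apply {s : Set E3} (hs : MeasurableSet s) :
    surf s = 3 * volume (Set.Ioo (0 : ℝ) 1 • (S2 ∩ s)) := by
  rw [surf, Measure.map_apply measurable_subtype_coe hs,
    Measure.toSphere_apply' _ (measurable_subtype_coe hs), Subtype.image_preimage_coe]
  simp [S2]

instance : IsFiniteMeasure surf := by unfold surf; infer_instance

lemma surf_compl_S2 : surf S2ᶜ = 0 := by
  rw [surf_apply (s := S2ᶜ) Metric.isClosed_sphere.measurableSet.compl]; simp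

lemma ae_mem_S2 : ∀ᵐ y ∂surf, y ∈ S2 := surf_compl_S2

lemma surf_submodule {V : Submodule ℝ E3} (hV : V ≠ ⊤) : surf V = 0 := by
  rw [surf_apply V.closed_of_finiteDimensional.measurableSet]
  have : volume (Set.Ioo (0 : ℝ) 1 • (S2 ∩ (V : Set E3))) = 0 := by
    refine measure_mono_null ?_ (Measure.addHaar_submodule volume V hV)
    rintro _ ⟨t, -, y, hy, rfl⟩
    exact V.smul_mem t hy.2
  rw [this, mul_zero]

lemma span_pair_ne_top (a b : E3) : Submodule.span ℝ {a, b} ≠ ⊤ := by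
  intro h
  have h1 := finrank_span_le_card (R := ℝ) ({a, b} : Set E3)
  rw [h, finrank_top, finrank_euclideanSpace, Fintype.card_fin] at h1
  have h2 : ({a, b} : Set E3).toFinset.card ≤ 2 := by
    rw [Set.toFinset_insert, Set.toFinset_singleton]; exact Finset.card_le_two
  omega

lemma surf_span_pair (a b : E3) : surf (Submodule.span ℝ {a, b} : Set E3) = 0 :=
  surf_submodule (span_pair_ne_top a b)

lemma surf_orthogonal {w : E3} (hw : w ≠ 0) : surf {y | ⟪w, y⟫ = 0} = 0 := by
  have : {y | ⟪w, y⟫ = 0} = ((Submodule.span ℝ {w})ᗮ : Set E3) := by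
    ext y; simp [Submodule.mem_orthogonal_singleton_iff_inner_right]
  rw [this]
  apply surf_submodule
  intro h
  have hw2 : w ∈ (Submodule.span ℝ {w})ᗮ := h ▸ Submodule.mem_top
  exact hw (inner_self_eq_zero.1 (Submodule.mem_orthogonal_singleton_iff_inner_right.1 hw2))

/-- The spherical polygon with the given (non-normalised) vertices. -/
def geoHull (s : Set E3) : Set E3 := radialProj '' convexHull ℝ s

lemma inner_convexHull {s : Set E3} {n : E3} {ρ : ℝ} (h : ∀ a ∈ s, ⟪n, a⟫ = ρ) {y : E3}
    (hy : y ∈ convexHull ℝ s) : ⟪n, y⟫ = ρ := by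
  have hc : Convex ℝ {y : E3 | ⟪n, y⟫ = ρ} :=
    convex_hyperplane (innerSL ℝ n).toLinearMap.isLinear ρ
  exact convexHull_min h hc hy

lemma norm_convexHull_le {s : Set E3} (h : ∀ a ∈ s, ‖a‖ ≤ 1) {y : E3}
    (hy : y ∈ convexHull ℝ s) : ‖y‖ ≤ 1 := by
  have : convexHull ℝ s ⊆ Metric.closedBall (0 : E3) 1 :=
    convexHull_min (fun a ha => by simpa using h a ha) (convex_closedBall _ _)
  simpa using this hy

lemma ne_zero_of_inner_pos {n y : E3} (h : 0 < ⟪n, y⟫) : y ≠ 0 := by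
  rintro rfl; simp at h

lemma isCompact_geoHull {s : Set E3} (hs : s.Finite) {n : E3} {ρ : ℝ} (hρ : 0 < ρ)
    (h : ∀ a ∈ s, ⟪n, a⟫ = ρ) : IsCompact (geoHull s) := by
  refine (hs.isCompact_convexHull ℝ).image_of_continuousOn ?_
  refine continuousOn_radialProj.mono fun y hy => ne_zero_of_inner_pos (n := n) ?_
  rwa [inner_convexHull h hy]

lemma geoHull_subset_S2 {s : Set E3} {n : E3} {ρ : ℝ} (hρ : 0 < ρ)
    (h : ∀ a ∈ s, ⟪n, a⟫ = ρ) : geoHull s ⊆ S2 := by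
  rintro _ ⟨y, hy, rfl⟩
  refine mem_S2.2 (norm_radialProj (ne_zero_of_inner_pos (n := n) ?_))
  rwa [inner_convexHull h hy]

lemma mem_convexHull_triple {a b c y : E3} : y ∈ convexHull ℝ {a, b, c} ↔
    ∃ α β γ : ℝ, 0 ≤ α ∧ 0 ≤ β ∧ 0 ≤ γ ∧ α + β + γ = 1 ∧ α • a + β • b + γ • c = y := by
  rw [convexHull_insert (by simp), convexHull_pair]
  simp only [mem_convexJoin, Set.mem_singleton_iff, exists_eq_left, segment, Set.mem_ofPred_eq]
  constructor
  · rintro ⟨_, ⟨s, t, hs, ht, hst, rfl⟩, p, q, hp, hq, hpq, rfl⟩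
    refine ⟨p, q * s, q * t, hp, mul_nonneg hq hs, mul_nonneg hq ht, ?_, ?_⟩
    · rw [add_assoc, ← mul_add, hst, mul_one, hpq]
    · rw [smul_add, smul_smul, smul_smul, add_assoc]
  · rintro ⟨α, β, γ, hα, hβ, hγ, h1, rfl⟩
    by_cases h0 : β + γ = 0
    · have hb : β = 0 := by linarith
      have hc : γ = 0 := by linarith
      refine ⟨b, ⟨1, 0, by simp⟩, 1, 0, by simp, by simp, by simp, ?_⟩
      have : α = 1 := by linarith
      simp [hb, hc, this]
    · refine ⟨(β / (β + γ)) • b + (γ / (β + γ)) • c, ⟨_, _, div_nonneg hβ (by linarith),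
        div_nonneg hγ (by linarith), by field_simp, rfl⟩, α, β + γ, hα, by linarith,
        by linarith, ?_⟩
      rw [smul_add, smul_smul, smul_smul, mul_div_cancel₀ _ h0, mul_div_cancel₀ _ h0, add_assoc]

/-- Radial projection forgets scaling, so barycentric coordinates may be replaced by arbitrary
nonnegative ones. -/
lemma mem_geoHull_triple {a b c n y : E3} {ρ : ℝ} (hρ : 0 < ρ) (ha : ⟪n, a⟫ = ρ)
    (hb : ⟪n, b⟫ = ρ) (hc : ⟪n, c⟫ = ρ) : y ∈ geoHull {a, b, c} ↔ ‖y‖ = 1 ∧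
    ∃ α β γ : ℝ, 0 ≤ α ∧ 0 ≤ β ∧ 0 ≤ γ ∧ α • a + β • b + γ • c = y := by
  constructor
  · rintro ⟨z, hz, rfl⟩
    have hz0 : z ≠ 0 := ne_zero_of_inner_pos (n := n) (by
      rwa [inner_convexHull (ρ := ρ) (by rintro _ (rfl | rfl | rfl) <;> assumption) hz])
    refine ⟨norm_radialProj hz0, ?_⟩
    obtain ⟨α, β, γ, h1, h2, h3, -, rfl⟩ := mem_convexHull_triple.1 hz
    have hn : 0 ≤ ‖α • a + β • b + γ • c‖⁻¹ := inv_nonneg.2 (norm_nonneg _)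
    refine ⟨_, _, _, mul_nonneg hn h1, mul_nonneg hn h2, mul_nonneg hn h3, ?_⟩
    rw [radialProj, smul_add, smul_add, smul_smul, smul_smul, smul_smul]
  · rintro ⟨h1, α, β, γ, hα, hβ, hγ, rfl⟩
    have hs : 0 < α + β + γ := by
      rcases (by positivity : 0 ≤ α + β + γ).lt_or_eq with h | h
      · exact h
      · have e1 : α = 0 := by linarith
        have e2 : β = 0 := by linarith
        have e3 : γ = 0 := by linarith
        simp [e1, e2, e3] at h1
    refine ⟨(α + β + γ)⁻¹ • (α • a + β • b + γ • c), ?_, ?_⟩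
    · refine mem_convexHull_triple.2 ⟨_, _, _, div_nonneg hα hs.le, div_nonneg hβ hs.le,
        div_nonneg hγ hs.le, by field_simp, ?_⟩
      rw [smul_add, smul_add, smul_smul, smul_smul, smul_smul, div_eq_inv_mul, div_eq_inv_mul,
        div_eq_inv_mul]
    · rw [radialProj_smul (inv_pos.2 hs), radialProj_of_norm_one h1]

/-- The area is three times the volume of the solid cone over the spherical triangle. Up to the
origin, that cone contains the flat simplex on `0, a, b, c`, and it is contained in its dilation by
`ρ⁻¹`. -/
lemma surf_geoHull_bounds {a b c n : E3} {ρ : ℝ} (hn : ‖n‖ = 1) (hρ : 0 < ρ) (ha : ⟪n, a⟫ = ρ)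
    (hb : ⟪n, b⟫ = ρ) (hc : ⟪n, c⟫ = ρ) (ha1 : ‖a‖ ≤ 1) (hb1 : ‖b‖ ≤ 1) (hc1 : ‖c‖ ≤ 1) :
    |det3 a b c| / 2 ≤ surf.real (geoHull {a, b, c}) ∧
      surf.real (geoHull {a, b, c}) ≤ |det3 a b c| / (2 * ρ ^ 3) := by
  have hin : ∀ v ∈ ({a, b, c} : Set E3), ⟪n, v⟫ = ρ := by
    rintro _ (rfl | rfl | rfl) <;> assumption
  have hno : ∀ v ∈ ({a, b, c} : Set E3), ‖v‖ ≤ 1 := by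
    rintro _ (rfl | rfl | rfl) <;> assumption
  have hK := isCompact_geoHull (Set.toFinite {a, b, c}) hρ hin
  have hS : surf (geoHull {a, b, c}) =
      3 * volume (Set.Ioo (0 : ℝ) 1 • geoHull {a, b, c}) := by
    rw [surf_apply hK.isClosed.measurableSet,
      Set.inter_eq_self_of_subset_right (geoHull_subset_S2 hρ hin)]
  have hval := volume_combo_corner a b c
  have hinner : ∀ s : E3, ⟪n, combo a b c s⟫ = ρ * (s 0 + s 1 + s 2) := by
    intro s
    rw [combo_apply]
    simp only [inner_add_right, real_inner_smul_right, ha, hb, hc]; ring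
  have hlow : combo a b c '' corner \ {0} ⊆ Set.Ioo (0 : ℝ) 1 • geoHull {a, b, c} := by
    rintro _ ⟨⟨s, ⟨hs0, hs1⟩, rfl⟩, hne⟩
    have hnn : combo a b c s ≠ 0 := hne
    have hle : ‖combo a b c s‖ < 1 := by
      rw [combo_apply]
      refine lt_of_le_of_lt (norm_add₃_le) (lt_of_le_of_lt ?_ hs1)
      simp only [norm_smul, Real.norm_of_nonneg (hs0 _)]
      gcongr ?_ + ?_ + ?_
      · exact mul_le_of_le_one_right (hs0 _) ha1
      · exact mul_le_of_le_one_right (hs0 _) hb1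
      · exact mul_le_of_le_one_right (hs0 _) hc1
    refine ⟨‖combo a b c s‖, ⟨norm_pos_iff.2 hnn, hle⟩, radialProj (combo a b c s), ?_, ?_⟩
    · rw [mem_geoHull_triple hρ ha hb hc]
      refine ⟨norm_radialProj hnn, ‖combo a b c s‖⁻¹ * s 0, ‖combo a b c s‖⁻¹ * s 1,
        ‖combo a b c s‖⁻¹ * s 2, mul_nonneg (by positivity) (hs0 _),
        mul_nonneg (by positivity) (hs0 _), mul_nonneg (by positivity) (hs0 _), ?_⟩
      rw [radialProj, mul_smul, mul_smul, mul_smul, ← smul_add, ← smul_add, ← combo_apply]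
    · simp only [radialProj, smul_smul]
      rw [mul_inv_cancel₀ (norm_ne_zero_iff.2 hnn), one_smul]
  have hupp : Set.Ioo (0 : ℝ) 1 • geoHull {a, b, c} ⊆ ρ⁻¹ • (combo a b c '' corner) := by
    rintro _ ⟨t, ⟨ht0, ht1⟩, y, hy, rfl⟩
    obtain ⟨hy1, α, β, γ, hα, hβ, hγ, rfl⟩ := (mem_geoHull_triple hρ ha hb hc).1 hy
    rw [Set.mem_smul_set]
    refine ⟨_, ⟨WithLp.toLp 2 ![ρ * t * α, ρ * t * β, ρ * t * γ], ⟨?_, ?_⟩, rfl⟩, ?_⟩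
    · intro i
      fin_cases i <;> simp <;> positivity
    · have h1 : ρ * (α + β + γ) ≤ 1 := by
        have := real_inner_le_norm n (α • a + β • b + γ • c)
        simp only [inner_add_right, real_inner_smul_right, ha, hb, hc, hn, hy1] at this
        linarith
      have h2 : ρ * (α + β + γ) * t < 1 :=
        lt_of_le_of_lt (mul_le_of_le_one_left ht0.le h1) ht1
      simp
      linarith
    · rw [combo_apply]
      simp only [Matrix.cons_val_zero, Matrix.cons_val_one, Matrix.cons_val, smul_add, smul_smul]
      rw [show ρ⁻¹ * (ρ * t * α) = t * α by field_simp,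
        show ρ⁻¹ * (ρ * t * β) = t * β by field_simp,
        show ρ⁻¹ * (ρ * t * γ) = t * γ by field_simp]
  have h3 : ∀ d : ℝ, 0 ≤ d → (3 : ℝ≥0∞) * ENNReal.ofReal d = ENNReal.ofReal (3 * d) := by
    intro d hd
    rw [ENNReal.ofReal_mul (by norm_num)]; simp
  constructor
  · rw [measureReal_def, ← ENNReal.ofReal_le_iff_le_toReal (measure_ne_top _ _), hS]
    have := measure_mono (μ := volume) hlow
    rw [measure_sdiff_null (by simp), hval] at this
    refine le_trans (le_of_eq ?_) (mul_le_mul_right this 3)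
    rw [h3 _ (by positivity)]
    congr 1; ring
  · rw [measureReal_def]
    refine ENNReal.toReal_le_of_le_ofReal (by positivity) ?_
    have := measure_mono (μ := volume) hupp
    rw [Measure.addHaar_smul, hval, finrank_euclideanSpace, Fintype.card_fin] at this
    rw [hS]
    refine (mul_le_mul_right this 3).trans (le_of_eq ?_)
    rw [← ENNReal.ofReal_mul (abs_nonneg _), h3 _ (by positivity), abs_of_pos (by positivity)]
    congr 1; field_simp; ring

/-! ### Length of geodesic arcs -/

lemma norm_radialProj_sub_sq {y z : E3} (hy : y ≠ 0) (hz : z ≠ 0) :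
    ‖radialProj y - radialProj z‖ ^ 2 = 2 - 2 * (⟪y, z⟫ / (‖y‖ * ‖z‖)) := by
  rw [norm_sub_sq_unit (norm_radialProj hy) (norm_radialProj hz), radialProj, radialProj,
    real_inner_smul_left, real_inner_smul_right]
  congr 2
  rw [div_eq_inv_mul, mul_inv, mul_assoc]

/-- Dropping the radial part `(‖y‖ - ‖z‖) ^ 2` from `‖y - z‖ ^ 2` leaves `‖y‖ ‖z‖` times the squared
distance of the projections. -/
lemma norm_radialProj_sub_le {ρ : ℝ} (hρ : 0 < ρ) {y z : E3} (hy : ρ ≤ ‖y‖) (hz : ρ ≤ ‖z‖) :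
    ‖radialProj y - radialProj z‖ ≤ ρ⁻¹ * ‖y - z‖ := by
  have hy0 := hρ.trans_le hy
  have hz0 := hρ.trans_le hz
  apply le_of_sq_le_sq _ (by positivity)
  rw [norm_radialProj_sub_sq (norm_pos_iff.1 hy0) (norm_pos_iff.1 hz0), mul_pow,
    norm_sub_sq_real, inv_pow, ← div_eq_inv_mul, le_div_iff₀ (by positivity)]
  have ht := real_inner_le_norm y z
  have h1 : 2 - 2 * (⟪y, z⟫ / (‖y‖ * ‖z‖)) = 2 * (‖y‖ * ‖z‖ - ⟪y, z⟫) / (‖y‖ * ‖z‖) := by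
    field_simp
  rw [h1, div_mul_eq_mul_div, div_le_iff₀ (by positivity)]
  have h2 : ρ ^ 2 ≤ ‖y‖ * ‖z‖ := by rw [sq]; exact mul_le_mul hy hz hρ.le hy0.le
  calc 2 * (‖y‖ * ‖z‖ - ⟪y, z⟫) * ρ ^ 2 ≤ 2 * (‖y‖ * ‖z‖ - ⟪y, z⟫) * (‖y‖ * ‖z‖) := by
        apply mul_le_mul_of_nonneg_left h2; linarith
    _ ≤ _ := by
        apply mul_le_mul_of_nonneg_right _ (by positivity)
        nlinarith [sq_nonneg (‖y‖ - ‖z‖)]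

lemma le_norm_radialProj_sub {ρ : ℝ} (hρ : 0 < ρ) {n y z : E3} (hn : ‖n‖ = 1)
    (hy : ⟪n, y⟫ = ρ) (hz : ⟪n, z⟫ = ρ) (hy1 : ‖y‖ ≤ 1) (hz1 : ‖z‖ ≤ 1) :
    ‖y - z‖ ≤ ρ⁻¹ * ‖radialProj y - radialProj z‖ := by
  have hyne : y ≠ 0 := ne_zero_of_inner_pos (n := n) (by rwa [hy])
  have hzne : z ≠ 0 := ne_zero_of_inner_pos (n := n) (by rwa [hz])
  have hy0 := norm_pos_iff.2 hyne
  have hz0 := norm_pos_iff.2 hzne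
  have ht := real_inner_le_norm y z
  have hρ1 : ρ ≤ 1 := by
    have := real_inner_le_norm n y
    rw [hy, hn] at this; linarith
  -- The radial part of `y - z` is small within the plane: `‖y‖ ^ 2 - ‖z‖ ^ 2` only sees the
  -- components of `y + z` orthogonal to `n`. What is left of `‖y - z‖ ^ 2` is then at least the
  -- fraction `ρ ^ 2`.
  have hkey : (‖y‖ - ‖z‖) ^ 2 ≤ (1 - ρ ^ 2) * ‖y - z‖ ^ 2 := by
    have e1 : ‖y‖ ^ 2 - ‖z‖ ^ 2 = ⟪y + z - (2 * ρ) • n, y - z⟫ := by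
      simp only [inner_sub_left, inner_sub_right, inner_add_left, real_inner_smul_left, hy, hz,
        real_inner_self_eq_norm_sq, real_inner_comm y z]; ring
    have e2 : ‖y + z - (2 * ρ) • n‖ ^ 2 = ‖y‖ ^ 2 + 2 * ⟪y, z⟫ + ‖z‖ ^ 2 - 4 * ρ ^ 2 := by
      rw [norm_sub_sq_real, norm_add_sq_real, norm_smul, hn, real_inner_smul_right, inner_add_left,
        real_inner_comm n y, real_inner_comm n z, hy, hz, mul_pow, Real.norm_eq_abs, sq_abs]
      ring
    have e3 : ‖y + z - (2 * ρ) • n‖ ^ 2 ≤ (1 - ρ ^ 2) * (‖y‖ + ‖z‖) ^ 2 := by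
      rw [e2]
      have : (‖y‖ + ‖z‖) ^ 2 ≤ 4 := by nlinarith
      nlinarith [sq_nonneg ρ]
    have e4 := abs_real_inner_le_norm (y + z - (2 * ρ) • n) (y - z)
    rw [← e1] at e4
    have e5 : (‖y‖ ^ 2 - ‖z‖ ^ 2) ^ 2 ≤ (1 - ρ ^ 2) * (‖y‖ + ‖z‖) ^ 2 * ‖y - z‖ ^ 2 := by
      rw [← sq_abs (‖y‖ ^ 2 - ‖z‖ ^ 2)]
      calc |‖y‖ ^ 2 - ‖z‖ ^ 2| ^ 2 ≤ (‖y + z - (2 * ρ) • n‖ * ‖y - z‖) ^ 2 := by gcongr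
        _ = ‖y + z - (2 * ρ) • n‖ ^ 2 * ‖y - z‖ ^ 2 := by ring
        _ ≤ _ := by gcongr
    have e6 : 0 < (‖y‖ + ‖z‖) ^ 2 := by positivity
    apply le_of_mul_le_mul_right _ e6
    linarith
  apply le_of_sq_le_sq _ (by positivity)
  rw [mul_pow, norm_radialProj_sub_sq hyne hzne, inv_pow, ← div_eq_inv_mul,
    le_div_iff₀ (by positivity)]
  have h1 : 2 - 2 * (⟪y, z⟫ / (‖y‖ * ‖z‖)) = 2 * (‖y‖ * ‖z‖ - ⟪y, z⟫) / (‖y‖ * ‖z‖) := by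
    field_simp
  rw [h1, le_div_iff₀ (by positivity)]
  have h2 : ‖y‖ * ‖z‖ ≤ 1 := mul_le_one₀ hy1 hz0.le hz1
  calc ‖y - z‖ ^ 2 * ρ ^ 2 * (‖y‖ * ‖z‖) ≤ ‖y - z‖ ^ 2 * ρ ^ 2 * 1 := by gcongr
    _ ≤ _ := by
      rw [norm_sub_sq_real] at hkey ⊢
      nlinarith

lemma geoHull_pair (a b : E3) : geoHull {a, b} = radialProj '' segment ℝ a b := by
  rw [geoHull, convexHull_pair]

lemma len_geoHull_le {a b n : E3} {ρ : ℝ} (hn : ‖n‖ = 1) (hρ : 0 < ρ) (ha : ⟪n, a⟫ = ρ)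
    (hb : ⟪n, b⟫ = ρ) : len (geoHull {a, b}) ≤ ENNReal.ofReal (‖a - b‖ / ρ) := by
  have hin : ∀ y ∈ segment ℝ a b, ⟪n, y⟫ = ρ := fun y hy =>
    inner_convexHull (s := {a, b}) (by rintro _ (rfl | rfl) <;> assumption)
      (by rwa [convexHull_pair])
  have hnorm : ∀ y ∈ segment ℝ a b, ρ ≤ ‖y‖ := fun y hy => by
    have := real_inner_le_norm n y
    rwa [hin y hy, hn, one_mul] at this
  have hL : LipschitzOnWith (Real.toNNReal ρ⁻¹) radialProj (segment ℝ a b) := by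
    apply LipschitzOnWith.of_dist_le_mul
    intro y hy z hz
    rw [dist_eq_norm, dist_eq_norm, Real.coe_toNNReal _ (by positivity)]
    exact norm_radialProj_sub_le hρ (hnorm y hy) (hnorm z hz)
  have := hL.hausdorffMeasure_image_le (zero_le_one)
  rw [hausdorffMeasure_segment, ENNReal.rpow_one, edist_dist, dist_eq_norm] at this
  rw [len, geoHull_pair]
  refine this.trans (le_of_eq ?_)
  rw [div_eq_inv_mul, ENNReal.ofReal_mul (by positivity)]; rfl

lemma le_len_geoHull {a b n : E3} {ρ : ℝ} (hn : ‖n‖ = 1) (hρ : 0 < ρ) (ha : ⟪n, a⟫ = ρ)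
    (hb : ⟪n, b⟫ = ρ) (ha1 : ‖a‖ ≤ 1) (hb1 : ‖b‖ ≤ 1) :
    ENNReal.ofReal (ρ * ‖a - b‖) ≤ len (geoHull {a, b}) := by
  have hin : ∀ y ∈ segment ℝ a b, ⟪n, y⟫ = ρ := fun y hy =>
    inner_convexHull (s := {a, b}) (by rintro _ (rfl | rfl) <;> assumption)
      (by rwa [convexHull_pair])
  have hnorm : ∀ y ∈ segment ℝ a b, ‖y‖ ≤ 1 := fun y hy =>
    norm_convexHull_le (s := {a, b}) (by rintro _ (rfl | rfl) <;> assumption)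
      (by rwa [convexHull_pair])
  -- Central projection back to the plane `⟪n, ·⟫ = ρ` inverts the radial projection; its Lipschitz
  -- constant bounds the arc length from below.
  have hinv : ∀ y ∈ segment ℝ a b, (ρ / ⟪n, radialProj y⟫) • radialProj y = y := fun y hy => by
    have h0 : ‖y‖ ≠ 0 :=
      norm_ne_zero_iff.2 (ne_zero_of_inner_pos (n := n) (by rw [hin y hy]; exact hρ))
    rw [radialProj, real_inner_smul_right, hin y hy, smul_smul]
    rw [show ρ / (‖y‖⁻¹ * ρ) * ‖y‖⁻¹ = 1 by field_simp, one_smul]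
  have himg : (fun x => (ρ / ⟪n, x⟫) • x) '' (radialProj '' segment ℝ a b) = segment ℝ a b := by
    rw [Set.image_image]
    ext y
    constructor
    · rintro ⟨z, hz, rfl⟩; simpa only [hinv z hz] using hz
    · intro hy; exact ⟨y, hy, hinv y hy⟩
  have hL : LipschitzOnWith (Real.toNNReal ρ⁻¹) (fun x => (ρ / ⟪n, x⟫) • x)
      (radialProj '' segment ℝ a b) := by
    apply LipschitzOnWith.of_dist_le_mul
    rintro _ ⟨y, hy, rfl⟩ _ ⟨z, hz, rfl⟩
    simp only [hinv y hy, hinv z hz]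
    rw [dist_eq_norm, dist_eq_norm, Real.coe_toNNReal _ (by positivity)]
    exact le_norm_radialProj_sub hρ hn (hin y hy) (hin z hz) (hnorm y hy) (hnorm z hz)
  have := hL.hausdorffMeasure_image_le (zero_le_one)
  rw [himg, hausdorffMeasure_segment, ENNReal.rpow_one, edist_dist, dist_eq_norm,
    ← geoHull_pair] at this
  calc ENNReal.ofReal (ρ * ‖a - b‖) = ENNReal.ofReal ρ * ENNReal.ofReal ‖a - b‖ :=
        ENNReal.ofReal_mul hρ.le
    _ ≤ ENNReal.ofReal ρ * (ENNReal.ofReal ρ⁻¹ * len (geoHull {a, b})) := by gcongr; exact this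
    _ = _ := by
      rw [← mul_assoc, ← ENNReal.ofReal_mul hρ.le, mul_inv_cancel₀ hρ.ne', ENNReal.ofReal_one,
        one_mul]

lemma inner_geoHull {s : Set E3} {n : E3} {ρ : ℝ} (hn : ‖n‖ = 1) (hρ : 0 < ρ)
    (h : ∀ a ∈ s, ⟪n, a⟫ = ρ) (h1 : ∀ a ∈ s, ‖a‖ ≤ 1) {y : E3} (hy : y ∈ geoHull s) :
    ρ ≤ ⟪n, y⟫ ∧ ⟪n, y⟫ ≤ 1 := by
  constructor
  · obtain ⟨z, hz, rfl⟩ := hy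
    have hz1 := norm_convexHull_le h1 hz
    have h0 : 0 < ‖z‖ :=
      norm_pos_iff.2 (ne_zero_of_inner_pos (n := n) (by rwa [inner_convexHull h hz]))
    rw [radialProj, real_inner_smul_right, inner_convexHull h hz]
    exact le_mul_of_one_le_left hρ.le ((one_le_inv₀ h0).2 hz1)
  · have := real_inner_le_norm n y
    rwa [hn, mem_S2.1 (geoHull_subset_S2 hρ h hy), mul_one] at this

/-- The integrand is the weight that lifting puts on a planar flux (`inner_liftGrad`); on the arc it
lies between `ρ` and `1`. -/
lemma integral_geoHull_bounds {a b n : E3} {ρ : ℝ} (hn : ‖n‖ = 1) (hρ : 0 < ρ) (ha : ⟪n, a⟫ = ρ)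
    (hb : ⟪n, b⟫ = ρ) (ha1 : ‖a‖ ≤ 1) (hb1 : ‖b‖ ≤ 1) :
    IntegrableOn (fun y => ρ / ⟪n, y⟫) (geoHull {a, b}) len ∧
    ρ ^ 2 * ‖a - b‖ ≤ ∫ y in geoHull {a, b}, ρ / ⟪n, y⟫ ∂len ∧
      ∫ y in geoHull {a, b}, ρ / ⟪n, y⟫ ∂len ≤ ‖a - b‖ / ρ := by
  have hin : ∀ v ∈ ({a, b} : Set E3), ⟪n, v⟫ = ρ := by rintro _ (rfl | rfl) <;> assumption
  have hno : ∀ v ∈ ({a, b} : Set E3), ‖v‖ ≤ 1 := by rintro _ (rfl | rfl) <;> assumption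
  have hK := isCompact_geoHull (Set.toFinite {a, b}) hρ hin
  have hm := hK.isClosed.measurableSet
  have hle := len_geoHull_le hn hρ ha hb
  have hge := le_len_geoHull hn hρ ha hb ha1 hb1
  have hfin : len (geoHull {a, b}) ≠ ∞ := ne_top_of_le_ne_top ENNReal.ofReal_ne_top hle
  have hbd : ∀ y ∈ geoHull {a, b}, ρ ≤ ρ / ⟪n, y⟫ ∧ ρ / ⟪n, y⟫ ≤ 1 := fun y hy => by
    obtain ⟨h1, h2⟩ := inner_geoHull hn hρ hin hno hy
    exact ⟨le_div_self hρ.le (hρ.trans_le h1) h2, (div_le_one (hρ.trans_le h1)).2 h1⟩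
  have hi : IntegrableOn (fun y => ρ / ⟪n, y⟫) (geoHull {a, b}) len := by
    apply Measure.integrableOn_of_bounded (M := 1) hfin
    · have : Measurable fun y : E3 => ρ / ⟪n, y⟫ := by fun_prop
      exact this.aestronglyMeasurable
    · refine (ae_restrict_iff' hm).2 (Filter.Eventually.of_forall fun y hy => ?_)
      obtain ⟨h1, h2⟩ := hbd y hy
      rw [Real.norm_of_nonneg (hρ.le.trans h1)]; exact h2
  have hr : len.real (geoHull {a, b}) ≤ ‖a - b‖ / ρ :=
    ENNReal.toReal_le_of_le_ofReal (by positivity) hle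
  have hr2 : ρ * ‖a - b‖ ≤ len.real (geoHull {a, b}) :=
    (ENNReal.ofReal_le_iff_le_toReal hfin).1 hge
  refine ⟨hi, ?_, ?_⟩
  · have := setIntegral_mono_on (integrableOn_const (C := ρ) hfin) hi hm fun y hy => (hbd y hy).1
    rw [setIntegral_const, smul_eq_mul] at this
    nlinarith
  · have := setIntegral_mono_on hi (integrableOn_const (C := (1 : ℝ)) hfin) hm
      fun y hy => (hbd y hy).2
    rw [setIntegral_const, smul_eq_mul, mul_one] at this
    linarith

lemma len_finite {s : Set E3} (hs : s.Finite) : len s = 0 := by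
  have : NullSingletonClass len := Measure.nullSingletonClass_hausdorff E3 zero_lt_one
  exact hs.measure_zero len

/-! ### Lifted affine functions -/

/-- The tangential gradient of `w ↦ ρ ⟪a, w⟫ / ⟪c, w⟫`. -/
def liftGrad (c : E3) (ρ : ℝ) (a w : E3) : E3 :=
  ρ • (⟪c, w⟫⁻¹ • a - (⟪a, w⟫ / ⟪c, w⟫ ^ 2) • c)

lemma hasGradientAt_lift {c a w : E3} {ρ d : ℝ} (h : ⟪c, w⟫ ≠ 0) :
    HasGradientAt (fun v => d + ρ * (⟪a, v⟫ / ⟪c, v⟫)) (liftGrad c ρ a w) w := by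
  rw [hasGradientAt_iff_hasFDerivAt]
  have h1 : HasFDerivAt (fun v : E3 => ⟪a, v⟫) (innerSL ℝ a) w := (innerSL ℝ a).hasFDerivAt
  have h2 : HasFDerivAt (fun v : E3 => ⟪c, v⟫) (innerSL ℝ c) w := (innerSL ℝ c).hasFDerivAt
  have h3 := h1.mul ((hasDerivAt_inv h).comp_hasFDerivAt w h2)
  have h4 : HasFDerivAt (fun v : E3 => d + ρ * (⟪a, v⟫ / ⟪c, v⟫)) _ w :=
    (h3.const_mul ρ).const_add d
  refine h4.congr_fderiv ?_
  ext v
  simp only [liftGrad, InnerProductSpace.toDual_apply_apply, real_inner_smul_left, inner_sub_left,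
    smul_apply, add_apply, Function.comp_apply, innerSL_apply_apply, smul_eq_mul]
  field_simp
  ring

/-- The function is homogeneous of degree zero, so its gradient is already tangential and the normal
correction vanishes. -/
lemma tgrad_of_eventually {u : E3 → ℝ} {c a w : E3} {ρ d : ℝ} (h : ⟪c, w⟫ ≠ 0)
    (hu : radialExt u =ᶠ[nhds w] fun v => d + ρ * (⟪a, v⟫ / ⟪c, v⟫)) :
    tgrad u w = liftGrad c ρ a w := by
  have hg : gradient (radialExt u) w = liftGrad c ρ a w :=
    ((hasGradientAt_lift h).congr_of_eventuallyEq hu).gradient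
  rw [tgrad, hg]
  have : ⟪liftGrad c ρ a w, w⟫ = 0 := by
    simp only [liftGrad, real_inner_smul_left, inner_sub_left]
    field_simp
    ring
  rw [this, zero_smul, sub_zero]

lemma inner_liftGrad {c a e w : E3} {ρ : ℝ} (he : ⟪c, e⟫ = 0) :
    ⟪liftGrad c ρ a w, e⟫ = ⟪a, e⟫ * (ρ / ⟪c, w⟫) := by
  simp only [liftGrad, real_inner_smul_left, inner_sub_left, he]; ring

lemma inner_liftGrad_liftGrad {c a b w : E3} {ρ : ℝ} (hc : ‖c‖ = 1) (ha : ⟪c, a⟫ = 0)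
    (hb : ⟪c, b⟫ = 0) : ⟪liftGrad c ρ a w, liftGrad c ρ b w⟫ =
      ρ ^ 2 * (⟪a, b⟫ / ⟪c, w⟫ ^ 2 + ⟪a, w⟫ * ⟪b, w⟫ / ⟪c, w⟫ ^ 4) := by
  have ha' : ⟪a, c⟫ = 0 := by rw [real_inner_comm, ha]
  simp only [liftGrad, real_inner_smul_left, inner_sub_left, real_inner_smul_right,
    inner_sub_right, hb, ha', inner_self_one hc]
  ring

lemma norm_liftGrad_ge {c a w : E3} {ρ : ℝ} (hc : ‖c‖ = 1) (ha : ⟪c, a⟫ = 0)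
    (h0 : 0 < ⟪c, w⟫) (h1 : ⟪c, w⟫ ≤ 1) : ρ * ‖a‖ ≤ ‖liftGrad c ρ a w‖ := by
  apply le_of_sq_le_sq _ (norm_nonneg _)
  rw [← real_inner_self_eq_norm_sq (liftGrad c ρ a w), inner_liftGrad_liftGrad hc ha ha, mul_pow]
  apply mul_le_mul_of_nonneg_left _ (sq_nonneg _)
  rw [real_inner_self_eq_norm_sq]
  have : ‖a‖ ^ 2 ≤ ‖a‖ ^ 2 / ⟪c, w⟫ ^ 2 :=
    le_div_self (sq_nonneg _) (by positivity) (pow_le_one₀ h0.le h1)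
  have h2 : 0 ≤ ⟪a, w⟫ * ⟪a, w⟫ / ⟪c, w⟫ ^ 4 := div_nonneg (mul_self_nonneg _) (by positivity)
  linarith

lemma norm_liftGrad_le {c a w : E3} {ρ : ℝ} (hρ : 0 < ρ) (hc : ‖c‖ = 1) (hw : ‖w‖ = 1)
    (h0 : ρ ≤ ⟪c, w⟫) : ‖liftGrad c ρ a w‖ ≤ (1 + ρ⁻¹) * ‖a‖ := by
  have hcw := hρ.trans_le h0
  rw [liftGrad, norm_smul, Real.norm_of_nonneg hρ.le]
  have h1 : ‖⟪c, w⟫⁻¹ • a - (⟪a, w⟫ / ⟪c, w⟫ ^ 2) • c‖ ≤ ρ⁻¹ * ‖a‖ + ‖a‖ / ρ ^ 2 := by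
    refine (norm_sub_le _ _).trans (add_le_add ?_ ?_)
    · rw [norm_smul, norm_inv, Real.norm_of_nonneg hcw.le]; gcongr
    · rw [norm_smul, hc, mul_one, norm_div, norm_pow, Real.norm_of_nonneg hcw.le]
      have := norm_inner_le_norm (𝕜 := ℝ) a w
      rw [hw, mul_one] at this
      gcongr
  calc _ ≤ ρ * (ρ⁻¹ * ‖a‖ + ‖a‖ / ρ ^ 2) := by gcongr
    _ = _ := by field_simp

lemma inner_sq_le_of_orthogonal {c a w : E3} (hc : ‖c‖ = 1) (ha : ⟪c, a⟫ = 0) (hw : ‖w‖ = 1) :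
    |⟪a, w⟫| ≤ ‖a‖ * √(1 - ⟪c, w⟫ ^ 2) := by
  have h1 : ⟪a, w⟫ = ⟪a, w - ⟪c, w⟫ • c⟫ := by
    rw [inner_sub_right, real_inner_smul_right, real_inner_comm, real_inner_comm c a, ha]; simp
  have h2 : ‖w - ⟪c, w⟫ • c‖ = √(1 - ⟪c, w⟫ ^ 2) := by
    rw [← Real.sqrt_sq (norm_nonneg (w - ⟪c, w⟫ • c)), norm_sub_sq_real, hw, norm_smul, hc,
      real_inner_smul_right, real_inner_comm, mul_pow, Real.norm_eq_abs, sq_abs]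
    congr 1; ring
  rw [h1, ← h2]
  exact abs_real_inner_le_norm _ _

/-- The error is second order for two reasons: the factor `ρ ^ 2 / ⟪c, w⟫ ^ 2` is within `1 - ρ ^ 2`
of `1`, and `⟪a, w⟫`, `⟪b, w⟫` are each of order `√(1 - ρ ^ 2)` and occur only as a product. -/
lemma abs_inner_liftGrad_sub_le {c a b w : E3} {ρ : ℝ} (hρ : 0 < ρ) (hc : ‖c‖ = 1)
    (ha : ⟪c, a⟫ = 0) (hb : ⟪c, b⟫ = 0) (hw : ‖w‖ = 1) (h0 : ρ ≤ ⟪c, w⟫) (h1 : ⟪c, w⟫ ≤ 1) :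
    |⟪liftGrad c ρ a w, liftGrad c ρ b w⟫ - ⟪a, b⟫| ≤
      ‖a‖ * ‖b‖ * ((1 - ρ ^ 2) * (1 + 1 / ρ ^ 2)) := by
  have hcw := hρ.trans_le h0
  rw [inner_liftGrad_liftGrad hc ha hb]
  set t := ⟪c, w⟫
  have hs : √(1 - t ^ 2) * √(1 - t ^ 2) = 1 - t ^ 2 := Real.mul_self_sqrt (by nlinarith)
  have hq : ρ ^ 2 ≤ t ^ 2 := by gcongr
  have e : ρ ^ 2 * (⟪a, b⟫ / t ^ 2 + ⟪a, w⟫ * ⟪b, w⟫ / t ^ 4) - ⟪a, b⟫ =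
      ⟪a, b⟫ * (ρ ^ 2 / t ^ 2 - 1) + ⟪a, w⟫ * ⟪b, w⟫ * (ρ ^ 2 / t ^ 4) := by ring
  rw [e]
  have k1 : |ρ ^ 2 / t ^ 2 - 1| ≤ 1 - ρ ^ 2 := by
    have u1 : ρ ^ 2 / t ^ 2 ≤ 1 := (div_le_one (by positivity)).2 hq
    have u2 : ρ ^ 2 ≤ ρ ^ 2 / t ^ 2 :=
      le_div_self (sq_nonneg _) (by positivity) (pow_le_one₀ hcw.le h1)
    rw [abs_le]; constructor <;> nlinarith
  have k2 : |⟪a, w⟫ * ⟪b, w⟫| ≤ ‖a‖ * ‖b‖ * (1 - ρ ^ 2) := by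
    rw [abs_mul]
    calc |⟪a, w⟫| * |⟪b, w⟫| ≤ (‖a‖ * √(1 - t ^ 2)) * (‖b‖ * √(1 - t ^ 2)) :=
          mul_le_mul (inner_sq_le_of_orthogonal hc ha hw) (inner_sq_le_of_orthogonal hc hb hw)
            (abs_nonneg _) (by positivity)
      _ = ‖a‖ * ‖b‖ * (1 - t ^ 2) := by rw [mul_mul_mul_comm, hs]
      _ ≤ _ := by gcongr
  have k3 : ρ ^ 2 / t ^ 4 ≤ 1 / ρ ^ 2 := by
    rw [div_le_div_iff₀ (by positivity) (by positivity)]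
    calc ρ ^ 2 * ρ ^ 2 ≤ t ^ 2 * t ^ 2 := by gcongr
      _ = 1 * t ^ 4 := by ring
  have k0 := abs_real_inner_le_norm a b
  calc _ ≤ |⟪a, b⟫ * (ρ ^ 2 / t ^ 2 - 1)| + |⟪a, w⟫ * ⟪b, w⟫ * (ρ ^ 2 / t ^ 4)| := abs_add_le _ _
    _ = |⟪a, b⟫| * |ρ ^ 2 / t ^ 2 - 1| + |⟪a, w⟫ * ⟪b, w⟫| * (ρ ^ 2 / t ^ 4) := by
      rw [abs_mul, abs_mul, abs_of_nonneg (show 0 ≤ ρ ^ 2 / t ^ 4 by positivity)]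
    _ ≤ (‖a‖ * ‖b‖) * (1 - ρ ^ 2) + ‖a‖ * ‖b‖ * (1 - ρ ^ 2) * (1 / ρ ^ 2) := by
      have : 0 ≤ 1 - ρ ^ 2 := (abs_nonneg _).trans k1
      gcongr
    _ = _ := by ring

/-- `a` is the gradient, orthogonal to `c`, of an affine function that agrees with `u` on `P`. -/
def IsSlope (P : Set E3) (c : E3) (u : E3 → ℝ) (a : E3) : Prop :=
  ⟪c, a⟫ = 0 ∧ ∀ p ∈ P, ∀ q ∈ P, ⟪a, p - q⟫ = u p - u q

namespace Tri
variable {x y z c : E3} {ρ : ℝ}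

lemma exists_isSlope (h : Tri x y z c ρ) (u : E3 → ℝ) : ∃ a, IsSlope {x, y, z} c u a := by
  have hg := h.gram_pos
  obtain ⟨A, hA⟩ : ∃ A, A = x - z := ⟨_, rfl⟩
  obtain ⟨B, hB⟩ : ∃ B, B = y - z := ⟨_, rfl⟩
  have hAc : ⟪c, A⟫ = 0 := by rw [hA, real_inner_comm, h.sub_xz]
  have hBc : ⟪c, B⟫ = 0 := by rw [hB, real_inner_comm, h.sub_yz]
  have hG : gram x y z = ‖A‖ ^ 2 * ‖B‖ ^ 2 - ⟪A, B⟫ ^ 2 := by rw [hA, hB, gram]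
  set s := u x - u z
  set t := u y - u z
  obtain ⟨a, ha⟩ : ∃ a, a = (gram x y z)⁻¹ • ((‖B‖ ^ 2 * s - ⟪A, B⟫ * t) • A
    + (‖A‖ ^ 2 * t - ⟪A, B⟫ * s) • B) := ⟨_, rfl⟩
  have h1 : ⟪a, A⟫ = u x - u z := by
    rw [ha]
    simp only [real_inner_smul_left, inner_add_left, real_inner_self_eq_norm_sq,
      real_inner_comm A B, hG]
    rw [inv_mul_eq_iff_eq_mul₀ (by rw [← hG]; exact hg.ne')]; ring
  have h2 : ⟪a, B⟫ = u y - u z := by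
    rw [ha]
    simp only [real_inner_smul_left, inner_add_left, real_inner_self_eq_norm_sq, hG]
    rw [inv_mul_eq_iff_eq_mul₀ (by rw [← hG]; exact hg.ne')]; ring
  rw [hA, inner_sub_right] at h1
  rw [hB, inner_sub_right] at h2
  refine ⟨a, ?_, ?_⟩
  · rw [ha]; simp [real_inner_smul_right, inner_add_right, hAc, hBc]
  · rintro p (rfl | rfl | rfl) q (rfl | rfl | rfl) <;> rw [inner_sub_right] <;> linarith

/-- The ray through `v` meets the plane of the triangle at `(ρ / ⟪c, v⟫) • v`, where the affine
function is evaluated. -/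
lemma radialExt_eq (h : Tri x y z c ρ) {u : E3 → ℝ} {a : E3} (ha : IsSlope {x, y, z} c u a)
    {l : E3 →ᵃ[ℝ] ℝ} (hl : ∀ w ∈ convexHull ℝ {x, y, z}, u (radialProj w) = l w)
    {α β γ : ℝ} (hα : 0 ≤ α) (hβ : 0 ≤ β) (hγ : 0 ≤ γ) (hs : 0 < α + β + γ) :
    radialExt u (α • x + β • y + γ • z) = (u z - ⟪a, z⟫) +
      ρ * (⟪a, α • x + β • y + γ • z⟫ / ⟪c, α • x + β • y + γ • z⟫) := by
  have hp := h.pos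
  have hsub := subset_convexHull ℝ ({x, y, z} : Set E3)
  have hlx := hl x (hsub (by simp))
  have hly := hl y (hsub (by simp))
  have hlz := hl z (hsub (by simp))
  rw [radialProj_of_norm_one h.nx] at hlx
  rw [radialProj_of_norm_one h.ny] at hly
  rw [radialProj_of_norm_one h.nz] at hlz
  have hxz := ha.2 x (by simp) z (by simp)
  have hyz := ha.2 y (by simp) z (by simp)
  rw [inner_sub_right] at hxz hyz
  have hmem : (α + β + γ)⁻¹ • (α • x + β • y + γ • z) ∈ convexHull ℝ {x, y, z} := by
    refine mem_convexHull_triple.2 ⟨_, _, _, div_nonneg hα hs.le, div_nonneg hβ hs.le,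
      div_nonneg hγ hs.le, by field_simp, ?_⟩
    rw [smul_add, smul_add, smul_smul, smul_smul, smul_smul, div_eq_inv_mul, div_eq_inv_mul,
      div_eq_inv_mul]
  have hlin : ∀ v, l v = l.linear v + l 0 := fun v => by
    rw [AffineMap.decomp' l]; simp
  rw [radialExt, ← radialProj_smul (inv_pos.2 hs), hl _ hmem, hlin]
  rw [hlin] at hlx hly hlz
  simp only [map_smul, map_add, inner_add_right, real_inner_smul_right, h.cx, h.cy, h.cz,
    smul_eq_mul]
  have hx : l.linear x = u x - l 0 := by linarith
  have hy : l.linear y = u y - l 0 := by linarith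
  have hz : l.linear z = u z - l 0 := by linarith
  have ex : u x = ⟪a, x⟫ - ⟪a, z⟫ + u z := by linarith
  have ey : u y = ⟪a, y⟫ - ⟪a, z⟫ + u z := by linarith
  rw [hx, hy, hz, ex, ey, show α * ρ + β * ρ + γ * ρ = ρ * (α + β + γ) by ring]
  field_simp
  ring

lemma det3_ne_zero (h : Tri x y z c ρ) : det3 x y z ≠ 0 := by
  have h1 := det3_ne_zero_of_gram h.gram_pos h.nc h.sub_xz h.sub_yz
  have h2 : ρ * det3 (x - z) (y - z) c = det3 (x - z) (y - z) (ρ • c) := by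
    simp only [det3, PiLp.smul_apply, smul_eq_mul]; ring
  have h3 : det3 (x - z) (y - z) (ρ • c) = (wt y z x + wt z x y + wt x y z) * det3 x y z := by
    rw [h.center_eq]
    simp only [det3, PiLp.smul_apply, PiLp.add_apply, PiLp.sub_apply, smul_eq_mul]; ring
  rw [h3, h.wt_sum, one_mul] at h2
  rw [← h2]
  exact mul_ne_zero h.pos.ne' h1

lemma cramer (h : Tri x y z c ρ) (w : E3) : (det3 w y z / det3 x y z) • x +
    (det3 x w z / det3 x y z) • y + (det3 x y w / det3 x y z) • z = w := by
  have h0 := h.det3_ne_zero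
  ext i
  apply mul_left_cancel₀ h0
  simp only [PiLp.add_apply, PiLp.smul_apply, smul_eq_mul, mul_add, ← mul_assoc,
    mul_div_cancel₀ _ h0]
  fin_cases i <;> simp only [det3, Fin.zero_eta, Fin.mk_one, Fin.reduceFinMk] <;> ring

lemma continuous_det3 {X : Type*} [TopologicalSpace X] {f g k : X → E3} (hf : Continuous f)
    (hg : Continuous g) (hk : Continuous k) : Continuous fun t => det3 (f t) (g t) (k t) := by
  unfold det3; fun_prop

/-- Formula for the tangential gradient of a lifted affine function inside a triangle. -/
lemma tgrad_eq (h : Tri x y z c ρ) {u : E3 → ℝ} {a : E3} (ha : IsSlope {x, y, z} c u a)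
    {l : E3 →ᵃ[ℝ] ℝ} (hl : ∀ w ∈ convexHull ℝ {x, y, z}, u (radialProj w) = l w)
    {α β γ : ℝ} (hα : 0 < α) (hβ : 0 < β) (hγ : 0 < γ) :
    tgrad u (α • x + β • y + γ • z) = liftGrad c ρ a (α • x + β • y + γ • z) := by
  have h0 := h.det3_ne_zero
  have hp := h.pos
  apply tgrad_of_eventually (d := u z - ⟪a, z⟫)
  · simp only [inner_add_right, real_inner_smul_right, h.cx, h.cy, h.cz]; positivity
  · have e1 : det3 (α • x + β • y + γ • z) y z / det3 x y z = α := by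
      rw [div_eq_iff h0]
      simp only [det3, PiLp.smul_apply, PiLp.add_apply, smul_eq_mul]; ring
    have e2 : det3 x (α • x + β • y + γ • z) z / det3 x y z = β := by
      rw [div_eq_iff h0]
      simp only [det3, PiLp.smul_apply, PiLp.add_apply, smul_eq_mul]; ring
    have e3 : det3 x y (α • x + β • y + γ • z) / det3 x y z = γ := by
      rw [div_eq_iff h0]
      simp only [det3, PiLp.smul_apply, PiLp.add_apply, smul_eq_mul]; ring
    have c1 : ContinuousAt (fun w => det3 w y z / det3 x y z) (α • x + β • y + γ • z) :=
      ((continuous_det3 continuous_id continuous_const continuous_const).div_const _).continuousAt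
    have c2 : ContinuousAt (fun w => det3 x w z / det3 x y z) (α • x + β • y + γ • z) :=
      ((continuous_det3 continuous_const continuous_id continuous_const).div_const _).continuousAt
    have c3 : ContinuousAt (fun w => det3 x y w / det3 x y z) (α • x + β • y + γ • z) :=
      ((continuous_det3 continuous_const continuous_const continuous_id).div_const _).continuousAt
    filter_upwards [c1.eventually (lt_mem_nhds (by simpa only [e1] using hα)),
      c2.eventually (lt_mem_nhds (by simpa only [e2] using hβ)),
      c3.eventually (lt_mem_nhds (by simpa only [e3] using hγ))] with w w1 w2 w3
    have := h.radialExt_eq ha hl w1.le w2.le w3.le (by positivity)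
    rwa [h.cramer w] at this

end Tri

/-! ### Combinatorics of the Voronoi decomposition -/


/-- The closed convex cone spanned by the Voronoi cell of `x i`. -/
def vcone (x : Fin N → E3) (i : Fin N) : Set E3 := {y | ∀ j, ⟪y, x j⟫ ≤ ⟪y, x i⟫}

lemma vcone_add {x : Fin N → E3} {i : Fin N} {y z : E3} (hy : y ∈ vcone x i)
    (hz : z ∈ vcone x i) : y + z ∈ vcone x i := fun j => by
  rw [inner_add_left, inner_add_left]; exact add_le_add (hy j) (hz j)

lemma vcone_smul {x : Fin N → E3} {i : Fin N} {y : E3} {t : ℝ} (ht : 0 ≤ t)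
    (hy : y ∈ vcone x i) : t • y ∈ vcone x i := fun j => by
  rw [real_inner_smul_left, real_inner_smul_left]; exact mul_le_mul_of_nonneg_left (hy j) ht

lemma vcone_of_eq {x : Fin N → E3} {i k : Fin N} {y : E3} (hy : y ∈ vcone x i)
    (h : ⟪y, x i⟫ = ⟪y, x k⟫) : y ∈ vcone x k := fun j => h ▸ hy j

lemma inner_eq_of_vcone {x : Fin N → E3} {i k : Fin N} {y : E3} (hi : y ∈ vcone x i)
    (hk : y ∈ vcone x k) : ⟪y, x i⟫ = ⟪y, x k⟫ := le_antisymm (hk i) (hi k)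

lemma exists_mem_vcone (x : Fin N → E3) (hN : 0 < N) (y : E3) : ∃ i, y ∈ vcone x i := by
  have : Nonempty (Fin N) := ⟨⟨0, hN⟩⟩
  obtain ⟨i, hi⟩ := Finite.exists_max (fun i => ⟪y, x i⟫)
  exact ⟨i, hi⟩

/-- Three distinct sites whose Voronoi cones have a common ray. -/
def Del (x : Fin N → E3) (i j k : Fin N) : Prop :=
  i ≠ j ∧ j ≠ k ∧ i ≠ k ∧ ∃ c, ‖c‖ = 1 ∧ ∀ l ∈ ({i, j, k} : Set (Fin N)), c ∈ vcone x l

lemma Del.rot {x : Fin N → E3} {i j k : Fin N} (h : Del x i j k) : Del x j k i := by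
  obtain ⟨h1, h2, h3, c, hc, h⟩ := h
  exact ⟨h2, h3.symm, h1.symm, c, hc, fun l hl => h l (by aesop)⟩

lemma Del.swap {x : Fin N → E3} {i j k : Fin N} (h : Del x i j k) : Del x j i k := by
  obtain ⟨h1, h2, h3, c, hc, h⟩ := h
  exact ⟨h1.symm, h3, h2, c, hc, fun l hl => h l (by aesop)⟩

/-- The common unit vector of the Voronoi cones of the sites in `s`. -/
def ctr (x : Fin N → E3) (s : Set (Fin N)) : E3 :=
  if h : ∃ c, ‖c‖ = 1 ∧ ∀ l ∈ s, c ∈ vcone x l then h.choose else 0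

lemma Del.norm_ctr {x : Fin N → E3} {i j k : Fin N} (h : Del x i j k) :
    ‖ctr x {i, j, k}‖ = 1 := by
  rw [ctr, dif_pos h.2.2.2]; exact h.2.2.2.choose_spec.1

lemma Del.ctr_mem {x : Fin N → E3} {i j k : Fin N} (h : Del x i j k) :
    ∀ l ∈ ({i, j, k} : Set (Fin N)), ctr x {i, j, k} ∈ vcone x l := by
  rw [ctr, dif_pos h.2.2.2]; exact h.2.2.2.choose_spec.2

/-- Since `ctr` is chosen from the set of sites, it does not depend on their order. -/
lemma triple_rot (i j k : Fin N) : ({j, k, i} : Set (Fin N)) = {i, j, k} := by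
  ext; simp; tauto

lemma triple_swap (i j k : Fin N) : ({j, i, k} : Set (Fin N)) = {i, j, k} := by
  ext; simp; tauto

/-- The distance to the origin of the plane of the Delaunay triangle. -/
def rho (x : Fin N → E3) (i j k : Fin N) : ℝ := ⟪ctr x {i, j, k}, x i⟫

lemma Del.rho_rot {x : Fin N → E3} {i j k : Fin N} (h : Del x i j k) :
    rho x j k i = rho x i j k := by
  rw [rho, rho, triple_rot]
  exact inner_eq_of_vcone (h.ctr_mem _ (by simp)) (h.ctr_mem _ (by simp))

lemma Del.rho_swap {x : Fin N → E3} {i j k : Fin N} (h : Del x i j k) :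
    rho x j i k = rho x i j k := by
  rw [rho, rho, triple_swap]
  exact inner_eq_of_vcone (h.ctr_mem _ (by simp)) (h.ctr_mem _ (by simp))

/-- Half of the Voronoi edge dual to `x i`, `x j`, from the midpoint to the Voronoi vertex of the
triangle `x i`, `x j`, `x k`. -/
def halfEdge (x : Fin N → E3) (i j k : Fin N) : Set E3 :=
  geoHull {midpoint ℝ (x i) (x j), rho x i j k • ctr x {i, j, k}}

/-- The spherical triangle joining the site `x i` to `halfEdge x i j k`. -/
def flag (x : Fin N → E3) (i j k : Fin N) : Set E3 :=
  geoHull {x i, midpoint ℝ (x i) (x j), rho x i j k • ctr x {i, j, k}}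

/-- Non-degenerate Voronoi decompositions, in terms of the cones `vcone`. -/
structure Mesh (x : Fin N → E3) (κ : ℝ) : Prop where
  norm : ∀ i, ‖x i‖ = 1
  inj : Function.Injective x
  κ_pos : 0 < κ
  bound : ∀ i, ∀ y ∈ vcone x i, κ * ‖y‖ ≤ ⟪y, x i⟫
  -- Edge crossing; here and below `c` only witnesses that the two cells are adjacent.
  mid : ∀ i j c, i ≠ j → ‖c‖ = 1 → c ∈ vcone x i → c ∈ vcone x j →
    midpoint ℝ (x i) (x j) ∈ vcone x i
  -- No Voronoi edge is a single point.
  long : ∀ i j c, i ≠ j → ‖c‖ = 1 → c ∈ vcone x i → c ∈ vcone x j →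
    ∀ d, ∃ y, y ≠ d ∧ ‖y‖ = 1 ∧ y ∈ vcone x i ∧ y ∈ vcone x j

/-! ### Non-obtuse triangles and absence of quadruple points -/

namespace Mesh
variable {x : Fin N → E3} {κ : ℝ} {i j k : Fin N}

lemma inner_midpoint_eq (h : Mesh x κ) (i j : Fin N) :
    ⟪midpoint ℝ (x i) (x j), x i⟫ = ⟪midpoint ℝ (x i) (x j), x j⟫ := by
  rw [midpoint_eq_smul_add]
  simp only [real_inner_smul_left, inner_add_left, inner_self_one (h.norm _),
    real_inner_comm (x i) (x j)]
  ring

lemma inner_pos (h : Mesh x κ) {y : E3} (hy : y ∈ vcone x i) (h0 : y ≠ 0) : 0 < ⟪y, x i⟫ :=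
  (mul_pos h.κ_pos (norm_pos_iff.2 h0)).trans_le (h.bound i y hy)

/-- By Thales: the midpoint being no closer to `x k` than to `x i` puts `x k` outside the open ball
with diameter `x i`, `x j`. -/
lemma ang_nonneg (h : Mesh x κ) {c : E3} (hij : i ≠ j) (hc : ‖c‖ = 1) (hi : c ∈ vcone x i)
    (hj : c ∈ vcone x j) : 0 ≤ ang (x i) (x j) (x k) := by
  have := h.mid i j c hij hc hi hj k
  rw [midpoint_eq_smul_add, invOf_eq_inv] at this
  simp only [real_inner_smul_left, inner_add_left, inner_self_one (h.norm _),
    real_inner_comm (x i) (x j)] at this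
  rw [ang_unit (h.norm k)]
  linarith

lemma tri_of_mem (h : Mesh x κ) (hij : i ≠ j) (hjk : j ≠ k) (hik : i ≠ k) {c : E3}
    (hc : ‖c‖ = 1) (hi : c ∈ vcone x i) (hj : c ∈ vcone x j) (hk : c ∈ vcone x k) :
    Tri (x i) (x j) (x k) c ⟪c, x i⟫ :=
  ⟨h.norm i, h.norm j, h.norm k, hc, h.inj.ne hij, h.inj.ne hjk, h.inj.ne hik.symm,
    h.inner_pos hi (norm_ne_zero_iff.1 (by rw [hc]; norm_num)), rfl, inner_eq_of_vcone hj hi,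
    inner_eq_of_vcone hk hi, h.ang_nonneg hjk hc hj hk, h.ang_nonneg hik.symm hc hk hi,
    h.ang_nonneg hij hc hi hj⟩

lemma tri (h : Mesh x κ) (hd : Del x i j k) :
    Tri (x i) (x j) (x k) (ctr x {i, j, k}) (rho x i j k) :=
  h.tri_of_mem hd.1 hd.2.1 hd.2.2.1 hd.norm_ctr (hd.ctr_mem _ (by simp))
    (hd.ctr_mem _ (by simp)) (hd.ctr_mem _ (by simp))

/-- Directions equidistant from three non-collinear points form a line, and positivity against `x i`
selects one of its two unit vectors. -/
lemma eq_of_mem (h : Mesh x κ) (hij : i ≠ j) (hjk : j ≠ k) (hik : i ≠ k) {c d : E3}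
    (hc : ‖c‖ = 1) (hd : ‖d‖ = 1) (hi : c ∈ vcone x i) (hj : c ∈ vcone x j) (hk : c ∈ vcone x k)
    (hi' : d ∈ vcone x i) (hj' : d ∈ vcone x j) (hk' : d ∈ vcone x k) : d = c := by
  have T := h.tri_of_mem hij hjk hik hc hi hj hk
  have T' := h.tri_of_mem hij hjk hik hd hi' hj' hk'
  have hv : d - ⟪c, d⟫ • c = 0 := by
    apply T.eq_zero
    · rw [inner_sub_right, real_inner_smul_right, T.sub_xz, T'.sub_xz]; ring
    · rw [inner_sub_right, real_inner_smul_right, T.sub_yz, T'.sub_yz]; ring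
    · rw [inner_sub_right, real_inner_smul_right, inner_self_one hc]; ring
  have hdc : d = ⟪c, d⟫ • c := sub_eq_zero.1 hv
  have hpos : 0 < ⟪c, d⟫ := by
    have h1 := T'.pos
    rw [hdc, real_inner_smul_left] at h1
    exact pos_of_mul_pos_left h1 T.pos.le
  have hn := congrArg (fun v : E3 => ‖v‖) hdc
  beta_reduce at hn
  rw [hd, norm_smul, hc, mul_one, Real.norm_of_nonneg hpos.le] at hn
  rw [hdc, ← hn, one_smul]

lemma eq_ctr (h : Mesh x κ) (hd : Del x i j k) {d : E3} (h1 : ‖d‖ = 1)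
    (hi : d ∈ vcone x i) (hj : d ∈ vcone x j) (hk : d ∈ vcone x k) : d = ctr x {i, j, k} :=
  h.eq_of_mem hd.1 hd.2.1 hd.2.2.1 hd.norm_ctr h1 (hd.ctr_mem _ (by simp))
    (hd.ctr_mem _ (by simp)) (hd.ctr_mem _ (by simp)) hi hj hk

/-- A segment in `vcone x i` can be prolonged until it meets the boundary. -/
lemma exists_exit (h : Mesh x κ) {p y : E3} (hp : p ∈ vcone x i) (hy : y ∈ vcone x i)
    (hpy : y ≠ p) (h0 : ⟪y - p, x i⟫ = 0) : ∃ t : ℝ, 1 ≤ t ∧ p + t • (y - p) ∈ vcone x i ∧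
      ∃ k, ⟪y - p, x i - x k⟫ < 0 ∧ p + t • (y - p) ∈ vcone x k := by
  set d := y - p with hd
  have hd0 : d ≠ 0 := sub_ne_zero.2 hpy
  -- The constraints that tighten along `d`. If there were none, `d` itself would lie in the cone,
  -- where `⟪d, x i⟫ > 0`. The smallest ratio over `K` is the exit time.
  set K : Finset (Fin N) := Finset.univ.filter fun k => ⟪d, x i - x k⟫ < 0 with hK
  have hKne : K.Nonempty := by
    by_contra hne
    have hdv : d ∈ vcone x i := fun k => by
      by_contra hk
      push Not at hk
      apply hne
      refine ⟨k, Finset.mem_filter.2 ⟨Finset.mem_univ _, ?_⟩⟩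
      rw [inner_sub_right]; linarith
    have := h.inner_pos hdv hd0
    linarith
  obtain ⟨k, hkK, hmin⟩ := K.exists_min_image
    (fun k => ⟪p, x i - x k⟫ / (-⟪d, x i - x k⟫)) hKne
  have hkneg : ⟪d, x i - x k⟫ < 0 := (Finset.mem_filter.1 hkK).2
  set t := ⟪p, x i - x k⟫ / (-⟪d, x i - x k⟫) with ht
  have ht1 : 1 ≤ t := by
    rw [ht, le_div_iff₀ (by linarith)]
    have := hy k
    rw [show y = p + d by rw [hd]; abel, inner_add_left, inner_add_left] at this
    rw [inner_sub_right, inner_sub_right]; linarith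
  have hz : p + t • d ∈ vcone x i := fun l => by
    suffices 0 ≤ ⟪p, x i - x l⟫ + t * ⟪d, x i - x l⟫ by
      rw [inner_sub_right, inner_sub_right] at this
      rw [inner_add_left, inner_add_left, real_inner_smul_left, real_inner_smul_left]; linarith
    have hpl : 0 ≤ ⟪p, x i - x l⟫ := by rw [inner_sub_right]; linarith [hp l]
    by_cases hl : ⟪d, x i - x l⟫ < 0
    · have := hmin l (Finset.mem_filter.2 ⟨Finset.mem_univ _, hl⟩)
      rw [le_div_iff₀ (by linarith)] at this
      linarith
    · push Not at hl
      have : 0 ≤ t * ⟪d, x i - x l⟫ := mul_nonneg (by linarith) hl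
      linarith
  refine ⟨t, ht1, hz, k, hkneg, vcone_of_eq hz ?_⟩
  have : ⟪p, x i - x k⟫ + t * ⟪d, x i - x k⟫ = 0 := by
    rw [ht, div_neg, neg_mul, div_mul_cancel₀ _ hkneg.ne]; ring
  rw [inner_sub_right, inner_sub_right] at this
  rw [inner_add_left, inner_add_left, real_inner_smul_left, real_inner_smul_left]; linarith

lemma inner_site_pos (h : Mesh x κ) (hij : i ≠ j) : 0 < ⟪x i, x i - x j⟫ := by
  rw [inner_sub_right, inner_self_one (h.norm i)]
  linarith [inner_lt_one_of_ne (h.norm i) (h.norm j) (h.inj.ne hij)]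

lemma site_mem (h : Mesh x κ) (i : Fin N) : x i ∈ vcone x i := fun j => by
  rw [inner_self_one (h.norm i)]
  have := real_inner_le_norm (x i) (x j)
  rwa [h.norm, h.norm, one_mul] at this

/-- A unit vector is not a convex combination of other unit vectors. -/
lemma not_convex_combination {p q r s : E3} (hp : ‖p‖ = 1) (hq : ‖q‖ = 1) (hr : ‖r‖ = 1)
    (hs : ‖s‖ = 1) (hpq : p ≠ q) (hpr : p ≠ r) (hps : p ≠ s) {t α β γ : ℝ} (ht : 0 < t)
    (hα : 0 ≤ α) (hβ : 0 ≤ β) (hγ : 0 ≤ γ) (hsum : α + β + γ = t)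
    (he : t • p = α • q + β • r + γ • s) : False := by
  have h1 := congrArg (fun v => ⟪p, v⟫) he
  simp only [inner_add_right, real_inner_smul_right, inner_self_one hp] at h1
  have a1 := inner_lt_one_of_ne hp hq hpq
  have a2 := inner_lt_one_of_ne hp hr hpr
  have a3 := inner_lt_one_of_ne hp hs hps
  have b1 : 0 ≤ α * (1 - ⟪p, q⟫) := mul_nonneg hα (by linarith)
  have b2 : 0 ≤ β * (1 - ⟪p, r⟫) := mul_nonneg hβ (by linarith)
  have b3 : 0 ≤ γ * (1 - ⟪p, s⟫) := mul_nonneg hγ (by linarith)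
  have z1 : α * (1 - ⟪p, q⟫) = 0 := by nlinarith
  have z2 : β * (1 - ⟪p, r⟫) = 0 := by nlinarith
  have z3 : γ * (1 - ⟪p, s⟫) = 0 := by nlinarith
  have y1 : α = 0 := (mul_eq_zero.1 z1).resolve_right (by linarith)
  have y2 : β = 0 := (mul_eq_zero.1 z2).resolve_right (by linarith)
  have y3 : γ = 0 := (mul_eq_zero.1 z3).resolve_right (by linarith)
  linarith

/-- Here `x i x l` would be a diagonal of an inscribed quadrilateral. Pairing the relation with a
second point `y` of the edge between cells `i` and `l` forces `y` into cell `j` or `k`, so `y = c`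
by uniqueness of the circumcentre. -/
lemma not_four_of_crossing (h : Mesh x κ) {l : Fin N} (hij : i ≠ j) (hik : i ≠ k)
    (hil : i ≠ l) (hjl : j ≠ l) (hkl : k ≠ l) {c : E3} (hc : ‖c‖ = 1) (hi : c ∈ vcone x i)
    (hj : c ∈ vcone x j) (hk : c ∈ vcone x k) (hl : c ∈ vcone x l) {t α β γ : ℝ} (ht : 0 < t)
    (hα : α < 0) (hβ : 0 ≤ β) (hγ : 0 ≤ γ) (hsum : α + β + γ = t)
    (he : t • x l = α • x i + β • x j + γ • x k) : False := by
  obtain ⟨y, hyc, hy1, hyi, hyl⟩ := h.long i l c hil hc hi hl c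
  have h1 := congrArg (fun v => ⟪y, v⟫) he
  simp only [inner_add_right, real_inner_smul_right] at h1
  rw [← inner_eq_of_vcone hyi hyl] at h1
  have b1 : 0 ≤ β * (⟪y, x i⟫ - ⟪y, x j⟫) := mul_nonneg hβ (by linarith [hyi j])
  have b2 : 0 ≤ γ * (⟪y, x i⟫ - ⟪y, x k⟫) := mul_nonneg hγ (by linarith [hyi k])
  have hz : β * (⟪y, x i⟫ - ⟪y, x j⟫) + γ * (⟪y, x i⟫ - ⟪y, x k⟫) = 0 := by
    rw [← hsum] at h1; linarith
  apply hyc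
  rcases hβ.lt_or_eq with hb | hb
  · have : ⟪y, x i⟫ - ⟪y, x j⟫ = 0 :=
      (mul_eq_zero.1 (by linarith : β * (⟪y, x i⟫ - ⟪y, x j⟫) = 0)).resolve_left hb.ne'
    exact h.eq_of_mem hij hjl hil hc hy1 hi hj hl hyi (vcone_of_eq hyi (by linarith)) hyl
  · have hg : γ ≠ 0 := by intro h0; rw [← hb, h0] at hsum; linarith
    have : ⟪y, x i⟫ - ⟪y, x k⟫ = 0 :=
      (mul_eq_zero.1 (by linarith : γ * (⟪y, x i⟫ - ⟪y, x k⟫) = 0)).resolve_left hg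
    exact h.eq_of_mem hik hkl hil hc hy1 hi hk hl hyi (vcone_of_eq hyi (by linarith)) hyl

/-- Four Voronoi cells have no common point. -/
lemma not_four (h : Mesh x κ) {l : Fin N} (hij : i ≠ j) (hjk : j ≠ k) (hik : i ≠ k)
    (hil : i ≠ l) (hjl : j ≠ l) (hkl : k ≠ l) {c : E3} (hc : ‖c‖ = 1) (hi : c ∈ vcone x i)
    (hj : c ∈ vcone x j) (hk : c ∈ vcone x k) (hl : c ∈ vcone x l) : False := by
  have T := h.tri_of_mem hij hjk hik hc hi hj hk
  -- All four sites lie in the plane where `⟪c, ·⟫` takes their common value, so `x l` is an affine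
  -- combination of the others, here with denominators cleared.
  have hrep : ∃ t α β γ : ℝ, 0 < t ∧ α + β + γ = t ∧
      t • x l = α • x i + β • x j + γ • x k := by
    have hg := T.gram_pos
    obtain ⟨A, hA⟩ : ∃ A, A = x i - x k := ⟨_, rfl⟩
    obtain ⟨B, hB⟩ : ∃ B, B = x j - x k := ⟨_, rfl⟩
    obtain ⟨a, ha⟩ : ∃ a, a = x l - x k := ⟨_, rfl⟩
    have hAc : ⟪A, c⟫ = 0 := hA ▸ T.sub_xz
    have hBc : ⟪B, c⟫ = 0 := hB ▸ T.sub_yz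
    have hac : ⟪c, a⟫ = 0 := by
      rw [ha, inner_sub_right, inner_eq_of_vcone hl hk, sub_self]
    have hG : gram (x i) (x j) (x k) = ‖A‖ ^ 2 * ‖B‖ ^ 2 - ⟪A, B⟫ ^ 2 := by rw [hA, hB, gram]
    have hv : gram (x i) (x j) (x k) • a - (‖B‖ ^ 2 * ⟪A, a⟫ - ⟪A, B⟫ * ⟪B, a⟫) • A
        - (‖A‖ ^ 2 * ⟪B, a⟫ - ⟪A, B⟫ * ⟪A, a⟫) • B = 0 := by
      apply T.eq_zero
      · rw [← hA]
        simp only [inner_sub_right, real_inner_smul_right, hG, real_inner_self_eq_norm_sq]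
        ring
      · rw [← hB]
        simp only [inner_sub_right, real_inner_smul_right, hG, real_inner_self_eq_norm_sq,
          real_inner_comm A B]
        ring
      · simp only [inner_sub_right, real_inner_smul_right, hac, real_inner_comm A c,
          real_inner_comm B c, hAc, hBc]
        ring
    generalize (‖B‖ ^ 2 * ⟪A, a⟫ - ⟪A, B⟫ * ⟪B, a⟫) = α at hv
    generalize (‖A‖ ^ 2 * ⟪B, a⟫ - ⟪A, B⟫ * ⟪A, a⟫) = β at hv
    refine ⟨_, α, β, gram (x i) (x j) (x k) - α - β, hg, by ring, ?_⟩
    rw [hA, hB, ha] at hv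
    rw [← sub_eq_zero, ← hv]
    module
  obtain ⟨t, α, β, γ, ht, hsum, he⟩ := hrep
  have ne := fun a b (hab : a ≠ b) => h.inj.ne hab
  -- One negative coefficient is the crossing case; none or two put one site in the convex hull of
  -- the other three; three contradict the positive sum.
  rcases lt_or_ge α 0 with ha | ha <;> rcases lt_or_ge β 0 with hb | hb <;>
    rcases lt_or_ge γ 0 with hg | hg
  · linarith
  · refine not_convex_combination (h.norm k) (h.norm l) (h.norm i) (h.norm j) (ne _ _ hkl)
      (ne _ _ hik.symm) (ne _ _ hjk.symm) (t := γ) (by linarith) ht.le (neg_nonneg.2 ha.le)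
      (neg_nonneg.2 hb.le) (by linarith) ?_
    rw [he]; module
  · refine not_convex_combination (h.norm j) (h.norm l) (h.norm i) (h.norm k) (ne _ _ hjl)
      (ne _ _ hij.symm) (ne _ _ hjk) (t := β) (by linarith) ht.le (neg_nonneg.2 ha.le)
      (neg_nonneg.2 hg.le) (by linarith) ?_
    rw [he]; module
  · exact h.not_four_of_crossing hij hik hil hjl hkl hc hi hj hk hl ht ha hb hg hsum he
  · refine not_convex_combination (h.norm i) (h.norm l) (h.norm j) (h.norm k) (ne _ _ hil)
      (ne _ _ hij) (ne _ _ hik) (t := α) (by linarith) ht.le (neg_nonneg.2 hb.le)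
      (neg_nonneg.2 hg.le) (by linarith) ?_
    rw [he]; module
  · exact h.not_four_of_crossing hij.symm hjk hjl hil hkl hc hj hi hk hl ht hb ha hg
      (by linarith) (by rw [he]; module)
  · exact h.not_four_of_crossing hik.symm hjk.symm hkl hil hjl hc hk hi hj hl ht hg ha hb
      (by linarith) (by rw [he]; module)
  · exact not_convex_combination (h.norm l) (h.norm i) (h.norm j) (h.norm k) (ne _ _ hil.symm)
      (ne _ _ hjl.symm) (ne _ _ hkl.symm) ht ha hb hg hsum he

end Mesh

namespace Tri
variable {x y z c : E3} {ρ : ℝ}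

lemma inner_mid (h : Tri x y z c ρ) : ⟪c, midpoint ℝ x y⟫ = ρ := by
  rw [midpoint_eq_smul_add, invOf_eq_inv, real_inner_smul_right, inner_add_right, h.cx, h.cy]; ring

lemma inner_center (h : Tri x y z c ρ) : ⟪c, ρ • c⟫ = ρ := by
  rw [real_inner_smul_right, inner_self_one h.nc, mul_one]

lemma norm_mid_le (h : Tri x y z c ρ) : ‖midpoint ℝ x y‖ ≤ 1 := by
  rw [midpoint_eq_smul_add, invOf_eq_inv, norm_smul]
  have := norm_add_le x y
  rw [h.nx, h.ny] at this
  norm_num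
  linarith

lemma rho_le_one (h : Tri x y z c ρ) : ρ ≤ 1 := by
  have := real_inner_le_norm c x
  rwa [h.cx, h.nc, h.nx, one_mul] at this

lemma norm_center_le (h : Tri x y z c ρ) : ‖ρ • c‖ ≤ 1 := by
  rw [norm_smul, h.nc, mul_one, Real.norm_of_nonneg h.pos.le]; exact h.rho_le_one

end Tri

lemma mem_geoHull_pair {a b n y : E3} {ρ : ℝ} (hρ : 0 < ρ) (ha : ⟪n, a⟫ = ρ)
    (hb : ⟪n, b⟫ = ρ) : y ∈ geoHull {a, b} ↔ ‖y‖ = 1 ∧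
    ∃ α β : ℝ, 0 ≤ α ∧ 0 ≤ β ∧ α • a + β • b = y := by
  rw [show ({a, b} : Set E3) = {a, a, b} by simp, mem_geoHull_triple hρ ha ha hb]
  refine and_congr_right fun _ => ⟨?_, ?_⟩
  · rintro ⟨α, β, γ, h1, h2, h3, h⟩
    exact ⟨α + β, γ, add_nonneg h1 h2, h3, by rw [add_smul, h]⟩
  · rintro ⟨α, β, h1, h2, h⟩
    exact ⟨0, α, β, le_rfl, h1, h2, by rw [zero_smul, zero_add, h]⟩

/-! ### Covering of edges and sphere by half edges and flags, and their overlaps -/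

namespace Mesh
variable {x : Fin N → E3} {κ : ℝ} {i j k : Fin N}

lemma mem_halfEdge (h : Mesh x κ) (hd : Del x i j k) {y : E3} :
    y ∈ halfEdge x i j k ↔ ‖y‖ = 1 ∧ ∃ β γ : ℝ, 0 ≤ β ∧ 0 ≤ γ ∧
      β • midpoint ℝ (x i) (x j) + γ • (rho x i j k • ctr x {i, j, k}) = y :=
  mem_geoHull_pair (h.tri hd).pos (h.tri hd).inner_mid (h.tri hd).inner_center

lemma mem_flag (h : Mesh x κ) (hd : Del x i j k) {y : E3} :
    y ∈ flag x i j k ↔ ‖y‖ = 1 ∧ ∃ α β γ : ℝ, 0 ≤ α ∧ 0 ≤ β ∧ 0 ≤ γ ∧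
      α • x i + β • midpoint ℝ (x i) (x j) + γ • (rho x i j k • ctr x {i, j, k}) = y :=
  mem_geoHull_triple (h.tri hd).pos (h.tri hd).cx (h.tri hd).inner_mid (h.tri hd).inner_center

lemma mid_mem (h : Mesh x κ) (hd : Del x i j k) : midpoint ℝ (x i) (x j) ∈ vcone x i :=
  h.mid i j _ hd.1 hd.norm_ctr (hd.ctr_mem _ (by simp)) (hd.ctr_mem _ (by simp))

lemma mid_mem' (h : Mesh x κ) (hd : Del x i j k) : midpoint ℝ (x i) (x j) ∈ vcone x j :=
  vcone_of_eq (h.mid_mem hd) (h.inner_midpoint_eq i j)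

/-- The segment from the midpoint through a multiple of `y` stays equidistant from `x i` and `x j`;
where it leaves the cone a third site is reached, at a Voronoi vertex. -/
lemma exists_halfEdge_of_ne (h : Mesh x κ) {y : E3} (hij : i ≠ j) (hy1 : ‖y‖ = 1)
    (hyi : y ∈ vcone x i) (hyj : y ∈ vcone x j)
    (hne : y ≠ radialProj (midpoint ℝ (x i) (x j))) :
    ∃ k, Del x i j k ∧ y ∈ halfEdge x i j k := by
  set m := midpoint ℝ (x i) (x j) with hm
  have hmi : m ∈ vcone x i := h.mid i j y hij hy1 hyi hyj
  have hmj : m ∈ vcone x j := vcone_of_eq hmi (h.inner_midpoint_eq i j)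
  have hy0 : y ≠ 0 := norm_ne_zero_iff.1 (by rw [hy1]; norm_num)
  have hyp := h.inner_pos hyi hy0
  have hmp : 0 < ⟪m, x i⟫ := by
    by_contra hneg
    have h0 : m = 0 := by
      by_contra hm0; exact hneg (h.inner_pos hmi hm0)
    have hji : x j = - x i := by
      rw [hm, midpoint_eq_smul_add, invOf_eq_inv, smul_eq_zero] at h0
      exact (neg_eq_of_add_eq_zero_right (h0.resolve_left (by norm_num))).symm
    have := inner_eq_of_vcone hyi hyj
    rw [hji, inner_neg_right] at this
    linarith
  -- Scales `y` so that the direction `s • y - m` is orthogonal to `x i`, as `exists_exit` requires.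
  obtain ⟨s, hs⟩ : ∃ s, s = ⟪m, x i⟫ / ⟪y, x i⟫ := ⟨_, rfl⟩
  have hs0 : 0 < s := hs ▸ div_pos hmp hyp
  have hsy : ⟪s • y, x i⟫ = ⟪m, x i⟫ := by
    rw [real_inner_smul_left, hs, div_mul_cancel₀ _ hyp.ne']
  have hsne : s • y ≠ m := fun he => hne (by
    rw [← he, radialProj_smul hs0, radialProj_of_norm_one hy1])
  obtain ⟨t, ht, hz, k, hk, hzk⟩ := h.exists_exit hmi (vcone_smul hs0.le hyi) hsne
    (by rw [inner_sub_left, hsy, sub_self])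
  have hd0 : ⟪s • y - m, x i⟫ = 0 := by rw [inner_sub_left, hsy, sub_self]
  have hdj : ⟪s • y - m, x j⟫ = 0 := by
    rw [inner_sub_left, real_inner_smul_left, ← inner_eq_of_vcone hyi hyj,
      ← inner_eq_of_vcone hmi hmj, ← real_inner_smul_left, hsy, sub_self]
  have hki : i ≠ k := by rintro rfl; simp at hk
  have hkj : j ≠ k := by rintro rfl; rw [inner_sub_right, hd0, hdj] at hk; simp at hk
  obtain ⟨z, hzd⟩ : ∃ z, z = m + t • (s • y - m) := ⟨_, rfl⟩
  rw [← hzd] at hz hzk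
  have hzx : ⟪z, x i⟫ = ⟪m, x i⟫ := by
    rw [hzd, inner_add_left, real_inner_smul_left, hd0, mul_zero, add_zero]
  have hz0 : z ≠ 0 := by rintro rfl; rw [inner_zero_left] at hzx; linarith
  have hzj : z ∈ vcone x j := by
    apply vcone_of_eq hz
    rw [hzx, hzd, inner_add_left, real_inner_smul_left, hdj, mul_zero, add_zero,
      inner_eq_of_vcone hmi hmj]
  have hn : 0 ≤ ‖z‖⁻¹ := inv_nonneg.2 (norm_nonneg _)
  have hD : Del x i j k := by
    refine ⟨hij, hkj, hki, radialProj z, norm_radialProj hz0, ?_⟩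
    rintro l (rfl | rfl | rfl)
    exacts [vcone_smul hn hz, vcone_smul hn hzj, vcone_smul hn hzk]
  have hc : radialProj z = ctr x {i, j, k} := h.eq_ctr hD (norm_radialProj hz0)
    (vcone_smul hn hz) (vcone_smul hn hzj) (vcone_smul hn hzk)
  have hzc : z = ‖z‖ • ctr x {i, j, k} := by
    rw [← hc, radialProj, smul_smul, mul_inv_cancel₀ (norm_ne_zero_iff.2 hz0), one_smul]
  -- The coefficients come from solving `z = m + t • (s • y - m)` for `y`, with `z` a multiple of
  -- the circumcentre.
  refine ⟨k, hD, (h.mem_halfEdge hD).2 ⟨hy1, s⁻¹ * (1 - t⁻¹),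
    s⁻¹ * (t⁻¹ * (‖z‖ * (rho x i j k)⁻¹)), ?_, ?_, ?_⟩⟩
  · have : t⁻¹ ≤ 1 := inv_le_one_of_one_le₀ ht
    exact mul_nonneg (by positivity) (by linarith)
  · have := (h.tri hD).pos
    have : 0 < t := by linarith
    positivity
  · have hr := (h.tri hD).pos.ne'
    have ht0 : t ≠ 0 := by linarith
    have e1 : (s⁻¹ * (t⁻¹ * (‖z‖ * (rho x i j k)⁻¹))) • (rho x i j k • ctr x {i, j, k}) =
        (s⁻¹ * t⁻¹) • z := by
      conv_rhs => rw [hzc]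
      rw [smul_smul, smul_smul]; congr 1; field_simp
    rw [e1, hzd, smul_add, smul_sub, smul_sub, smul_smul, smul_smul, smul_smul]
    have e2 : s⁻¹ * t⁻¹ * t = s⁻¹ := by field_simp
    rw [e2, inv_mul_cancel₀ hs0.ne', one_smul]
    module

/-- At the midpoint no direction is given, so another point of the edge, supplied by `long`,
provides the third site. -/
lemma exists_halfEdge (h : Mesh x κ) {y : E3} (hij : i ≠ j) (hy1 : ‖y‖ = 1)
    (hyi : y ∈ vcone x i) (hyj : y ∈ vcone x j) : ∃ k, Del x i j k ∧ y ∈ halfEdge x i j k := by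
  by_cases hne : y = radialProj (midpoint ℝ (x i) (x j))
  · obtain ⟨y', hy'ne, hy'1, hy'i, hy'j⟩ :=
      h.long i j y hij hy1 hyi hyj (radialProj (midpoint ℝ (x i) (x j)))
    obtain ⟨k, hD, -⟩ := h.exists_halfEdge_of_ne hij hy'1 hy'i hy'j hy'ne
    refine ⟨k, hD, (h.mem_halfEdge hD).2 ⟨hy1, ‖midpoint ℝ (x i) (x j)‖⁻¹, 0, by positivity,
      le_rfl, ?_⟩⟩
    rw [zero_smul, add_zero, hne, radialProj]
  · exact h.exists_halfEdge_of_ne hij hy1 hyi hyj hne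

lemma halfEdge_subset (h : Mesh x κ) (hd : Del x i j k) {y : E3} (hy : y ∈ halfEdge x i j k) :
    ‖y‖ = 1 ∧ y ∈ vcone x i ∧ y ∈ vcone x j := by
  obtain ⟨h1, β, γ, hβ, hγ, rfl⟩ := (h.mem_halfEdge hd).1 hy
  have hp := (h.tri hd).pos.le
  exact ⟨h1, vcone_add (vcone_smul hβ (h.mid_mem hd))
    (vcone_smul hγ (vcone_smul hp (hd.ctr_mem _ (by simp)))),
    vcone_add (vcone_smul hβ (h.mid_mem' hd))
    (vcone_smul hγ (vcone_smul hp (hd.ctr_mem _ (by simp))))⟩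

/-- The segment from the site through a multiple of `y` leaves the cone on a Voronoi edge, hence on
a half edge, and `y` lies between the two. -/
lemma exists_flag (h : Mesh x κ) (hN : 0 < N) {y : E3} (hy1 : ‖y‖ = 1) (hy : ∀ i, y ≠ x i) :
    ∃ i j k, Del x i j k ∧ y ∈ flag x i j k := by
  obtain ⟨i, hyi⟩ := exists_mem_vcone x hN y
  have hy0 : y ≠ 0 := norm_ne_zero_iff.1 (by rw [hy1]; norm_num)
  have hyp := h.inner_pos hyi hy0
  obtain ⟨s, hs⟩ : ∃ s, s = 1 / ⟪y, x i⟫ := ⟨_, rfl⟩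
  have hs0 : 0 < s := hs ▸ div_pos one_pos hyp
  have hsy : ⟪s • y, x i⟫ = 1 := by
    rw [real_inner_smul_left, hs, div_mul_cancel₀ _ hyp.ne']
  have hsne : s • y ≠ x i := fun he => hy i (by
    rw [← radialProj_of_norm_one (h.norm i), ← he, radialProj_smul hs0,
      radialProj_of_norm_one hy1])
  have hd0 : ⟪s • y - x i, x i⟫ = 0 := by
    rw [inner_sub_left, hsy, inner_self_one (h.norm i), sub_self]
  obtain ⟨t, ht, hz, j, hj, hzj⟩ := h.exists_exit (h.site_mem i) (vcone_smul hs0.le hyi) hsne hd0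
  have hij : i ≠ j := by rintro rfl; simp at hj
  obtain ⟨z, hzd⟩ : ∃ z, z = x i + t • (s • y - x i) := ⟨_, rfl⟩
  rw [← hzd] at hz hzj
  have hzx : ⟪z, x i⟫ = 1 := by
    rw [hzd, inner_add_left, real_inner_smul_left, hd0, mul_zero, add_zero,
      inner_self_one (h.norm i)]
  have hz0 : z ≠ 0 := by rintro rfl; rw [inner_zero_left] at hzx; linarith
  have hn : 0 ≤ ‖z‖⁻¹ := inv_nonneg.2 (norm_nonneg _)
  obtain ⟨k, hD, hk⟩ := h.exists_halfEdge hij (norm_radialProj hz0) (vcone_smul hn hz)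
    (vcone_smul hn hzj)
  obtain ⟨-, β, γ, hβ, hγ, he⟩ := (h.mem_halfEdge hD).1 hk
  have hzc : z = ‖z‖ • radialProj z := by
    rw [radialProj, smul_smul, mul_inv_cancel₀ (norm_ne_zero_iff.2 hz0), one_smul]
  have ht0 : 0 < t := by linarith
  refine ⟨i, j, k, hD, (h.mem_flag hD).2 ⟨hy1, s⁻¹ * (1 - t⁻¹), s⁻¹ * t⁻¹ * ‖z‖ * β,
    s⁻¹ * t⁻¹ * ‖z‖ * γ, ?_, by positivity, by positivity, ?_⟩⟩
  · have : t⁻¹ ≤ 1 := inv_le_one_of_one_le₀ ht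
    exact mul_nonneg (by positivity) (by linarith)
  · rw [mul_smul _ β, mul_smul _ γ, add_assoc, ← smul_add, he, mul_smul _ ‖z‖, ← hzc, hzd,
      smul_add, smul_sub, smul_sub, smul_smul, smul_smul, smul_smul]
    have e2 : s⁻¹ * t⁻¹ * t = s⁻¹ := by field_simp
    rw [e2, inv_mul_cancel₀ hs0.ne', one_smul]
    module

lemma flag_subset (h : Mesh x κ) (hd : Del x i j k) {y : E3} (hy : y ∈ flag x i j k) :
    ‖y‖ = 1 ∧ y ∈ vcone x i := by
  obtain ⟨h1, α, β, γ, hα, hβ, hγ, rfl⟩ := (h.mem_flag hd).1 hy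
  exact ⟨h1, vcone_add (vcone_add (vcone_smul hα (h.site_mem i)) (vcone_smul hβ (h.mid_mem hd)))
    (vcone_smul hγ (vcone_smul (h.tri hd).pos.le (hd.ctr_mem _ (by simp))))⟩

/-- Two different halves of a Voronoi edge meet only at the midpoint. -/
lemma halfEdge_overlap (h : Mesh x κ) {k' : Fin N} (hd : Del x i j k) (hd' : Del x i j k')
    (hk : k ≠ k') {β γ β' γ' : ℝ} (hγ : 0 ≤ γ) (hγ' : 0 ≤ γ')
    (he : β • midpoint ℝ (x i) (x j) + γ • (rho x i j k • ctr x {i, j, k}) =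
      β' • midpoint ℝ (x i) (x j) + γ' • (rho x i j k' • ctr x {i, j, k'})) :
    γ = 0 ∨ γ' = 0 := by
  -- The functional `⟪·, x i - x a⟫` separates the halves: it vanishes at the vertex of `a`, is
  -- positive at that of `b` because four cells never meet, and is nonnegative at the midpoint.
  have key : ∀ {a b : Fin N}, Del x i j a → Del x i j b → a ≠ b →
      ⟪ctr x {i, j, a}, x i - x a⟫ = 0 ∧ 0 < ⟪ctr x {i, j, b}, x i - x a⟫ ∧
        0 ≤ ⟪midpoint ℝ (x i) (x j), x i - x a⟫ := by
    intro a b ha hb hab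
    refine ⟨?_, ?_, ?_⟩
    · rw [inner_sub_right, inner_eq_of_vcone (ha.ctr_mem i (by simp)) (ha.ctr_mem a (by simp)),
        sub_self]
    · rw [inner_sub_right, sub_pos]
      refine lt_of_le_of_ne (hb.ctr_mem i (by simp) a) fun heq => ?_
      exact h.not_four hb.1 hb.2.1 hb.2.2.1 ha.2.2.1 ha.2.1 hab.symm hb.norm_ctr
        (hb.ctr_mem i (by simp)) (hb.ctr_mem j (by simp)) (hb.ctr_mem b (by simp))
        (vcone_of_eq (hb.ctr_mem i (by simp)) heq.symm)
    · rw [inner_sub_right, sub_nonneg]; exact h.mid_mem ha a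
  obtain ⟨a1, a2, a3⟩ := key hd hd' hk
  obtain ⟨b1, b2, b3⟩ := key hd' hd hk.symm
  have hp := (h.tri hd).pos
  have hp' := (h.tri hd').pos
  have e1 := congrArg (fun v => ⟪v, x i - x k⟫) he
  have e2 := congrArg (fun v => ⟪v, x i - x k'⟫) he
  simp only [inner_add_left, real_inner_smul_left, a1, b1, mul_zero, add_zero] at e1 e2
  rcases le_total β β' with hb | hb
  · right
    have h1 : γ' * (rho x i j k' * ⟪ctr x {i, j, k'}, x i - x k⟫) ≤ 0 := by
      nlinarith
    by_contra h0
    have : 0 < γ' := lt_of_le_of_ne hγ' (Ne.symm h0)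
    have : 0 < γ' * (rho x i j k' * ⟪ctr x {i, j, k'}, x i - x k⟫) := by positivity
    linarith
  · left
    have h1 : γ * (rho x i j k * ⟪ctr x {i, j, k}, x i - x k'⟫) ≤ 0 := by
      nlinarith
    by_contra h0
    have : 0 < γ := lt_of_le_of_ne hγ (Ne.symm h0)
    have : 0 < γ * (rho x i j k * ⟪ctr x {i, j, k}, x i - x k'⟫) := by positivity
    linarith

lemma halfEdge_inter (h : Mesh x κ) {k' : Fin N} (hd : Del x i j k) (hd' : Del x i j k')
    (hk : k ≠ k') : halfEdge x i j k ∩ halfEdge x i j k' ⊆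
      {radialProj (midpoint ℝ (x i) (x j))} := by
  rintro y ⟨hy, hy'⟩
  obtain ⟨h1, β, γ, hβ, hγ, e⟩ := (h.mem_halfEdge hd).1 hy
  obtain ⟨-, β', γ', hβ', hγ', e'⟩ := (h.mem_halfEdge hd').1 hy'
  have main : ∀ b : ℝ, 0 ≤ b → b • midpoint ℝ (x i) (x j) = y →
      y ∈ ({radialProj (midpoint ℝ (x i) (x j))} : Set E3) := by
    rintro b hb rfl
    have hb0 : 0 < b := by
      refine lt_of_le_of_ne hb ?_
      rintro rfl; simp at h1
    rw [Set.mem_singleton_iff, ← radialProj_smul hb0, radialProj_of_norm_one h1]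
  rcases h.halfEdge_overlap hd hd' hk hγ hγ' (e.trans e'.symm) with h0 | h0
  · rw [h0, zero_smul, add_zero] at e; exact main β hβ e
  · rw [h0, zero_smul, add_zero] at e'; exact main β' hβ' e'

/-- The overlap lies in a plane through the origin: the bisector of two sites, or the plane of the
common site and a midpoint, or that of the site and a Voronoi vertex. -/
lemma flag_inter_null (h : Mesh x κ) {i' j' k' : Fin N} (hd : Del x i j k) (hd' : Del x i' j' k')
    (hne : (i, j, k) ≠ (i', j', k')) : surf (flag x i j k ∩ flag x i' j' k') = 0 := by
  by_cases hi : i = i'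
  swap
  · refine measure_mono_null ?_ (surf_orthogonal (sub_ne_zero.2 (h.inj.ne hi)))
    rintro y ⟨hy, hy'⟩
    change ⟪x i - x i', y⟫ = 0
    rw [real_inner_comm, inner_sub_right,
      inner_eq_of_vcone (h.flag_subset hd hy).2 (h.flag_subset hd' hy').2, sub_self]
  subst hi
  have decomp : ∀ {j k : Fin N}, Del x i j k → ∀ y ∈ flag x i j k, ∃ α β γ : ℝ, ∃ g : E3,
      0 ≤ γ ∧ β • midpoint ℝ (x i) (x j) + γ • (rho x i j k • ctr x {i, j, k}) = g ∧
      α • x i + g = y ∧ g ∈ vcone x i ∧ g ∈ vcone x j := by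
    intro j k hd y hy
    obtain ⟨h1, α, β, γ, hα, hβ, hγ, e⟩ := (h.mem_flag hd).1 hy
    have hp := (h.tri hd).pos.le
    refine ⟨α, β, γ, _, hγ, rfl, by rw [← e, add_assoc], vcone_add (vcone_smul hβ (h.mid_mem hd))
      (vcone_smul hγ (vcone_smul hp (hd.ctr_mem _ (by simp)))),
      vcone_add (vcone_smul hβ (h.mid_mem' hd))
      (vcone_smul hγ (vcone_smul hp (hd.ctr_mem _ (by simp))))⟩
  -- Applied both ways, this shows that a point determines its splitting into a multiple of `x i`
  -- and a point of the cone over an edge.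
  have cancel : ∀ {j j' : Fin N} {α α' : ℝ} {g g' : E3}, i ≠ j → i ≠ j' →
      α • x i + g = α' • x i + g' → g ∈ vcone x i → g ∈ vcone x j → g' ∈ vcone x i →
      g' ∈ vcone x j' → α' ≤ α := by
    intro j j' α α' g g' hj hj' he gi gj gi' gj'
    have e := congrArg (fun v => ⟪v, x i - x j⟫) he
    have z1 : ⟪g, x i - x j⟫ = 0 := by rw [inner_sub_right, inner_eq_of_vcone gi gj, sub_self]
    have z2 : 0 ≤ ⟪g', x i - x j⟫ := by rw [inner_sub_right, sub_nonneg]; exact gi' j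
    simp only [inner_add_left, real_inner_smul_left, z1, add_zero] at e
    have := h.inner_site_pos hj
    nlinarith
  have same : ∀ y, y ∈ flag x i j k → y ∈ flag x i j' k' → ∃ α β γ β' γ' : ℝ, ∃ g : E3,
      0 ≤ γ ∧ β • midpoint ℝ (x i) (x j) + γ • (rho x i j k • ctr x {i, j, k}) = g ∧
      0 ≤ γ' ∧ β' • midpoint ℝ (x i) (x j') + γ' • (rho x i j' k' • ctr x {i, j', k'}) = g ∧
      α • x i + g = y ∧ g ∈ vcone x i ∧ g ∈ vcone x j ∧ g ∈ vcone x j' := by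
    intro y hy hy'
    obtain ⟨α, β, γ, g, hγ, e, ey, gi, gj⟩ := decomp hd y hy
    obtain ⟨α', β', γ', g', hγ', e', ey', gi', gj'⟩ := decomp hd' y hy'
    have hα : α = α' := le_antisymm
      (cancel hd'.1 hd.1 (ey'.trans ey.symm) gi' gj' gi gj)
      (cancel hd.1 hd'.1 (ey.trans ey'.symm) gi gj gi' gj')
    have hg : g = g' := by
      rw [← ey', hα] at ey; exact add_left_cancel ey
    exact ⟨α, β, γ, β', γ', g, hγ, e, hγ', hg ▸ e', ey, gi, gj, hg ▸ gj'⟩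
  by_cases hj : j = j'
  · subst hj
    have hk : k ≠ k' := fun hk => hne (by rw [hk])
    refine measure_mono_null ?_ (surf_span_pair (x i) (midpoint ℝ (x i) (x j)))
    rintro y ⟨hy, hy'⟩
    obtain ⟨α, β, γ, β', γ', g, hγ, e, hγ', e', rfl, -⟩ := same y hy hy'
    rcases h.halfEdge_overlap hd hd' hk hγ hγ' (e.trans e'.symm) with h0 | h0
    · rw [h0, zero_smul, add_zero] at e
      exact Submodule.mem_span_pair.2 ⟨α, β, by rw [e]⟩
    · rw [h0, zero_smul, add_zero] at e'
      exact Submodule.mem_span_pair.2 ⟨α, β', by rw [e']⟩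
  · refine measure_mono_null ?_ (surf_span_pair (x i) (ctr x {i, j, j'}))
    rintro y ⟨hy, hy'⟩
    obtain ⟨α, β, γ, β', γ', g, -, -, -, -, rfl, gi, gj, gj'⟩ := same y hy hy'
    by_cases hg : g = 0
    · exact Submodule.mem_span_pair.2 ⟨α, 0, by rw [hg, zero_smul]⟩
    · have hn : 0 ≤ ‖g‖⁻¹ := inv_nonneg.2 (norm_nonneg _)
      have hD : Del x i j j' := by
        refine ⟨hd.1, hj, hd'.1, radialProj g, norm_radialProj hg, ?_⟩
        rintro l (rfl | rfl | rfl)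
        exacts [vcone_smul hn gi, vcone_smul hn gj, vcone_smul hn gj']
      have hc := h.eq_ctr hD (norm_radialProj hg) (vcone_smul hn gi) (vcone_smul hn gj)
        (vcone_smul hn gj')
      refine Submodule.mem_span_pair.2 ⟨α, ‖g‖, ?_⟩
      rw [← hc, radialProj, smul_smul, mul_inv_cancel₀ (norm_ne_zero_iff.2 hg), one_smul]

end Mesh

/-! ### Local comparison with the planar box method -/

lemma measurable_tgrad (u : E3 → ℝ) : Measurable (tgrad u) := by
  have hg : Measurable (gradient (radialExt u)) :=
    ((InnerProductSpace.toDual ℝ E3).symm.continuous.measurable).comp (measurable_fderiv ℝ _)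
  exact hg.sub (Measurable.fun_smul (hg.inner measurable_id) measurable_id)

/-- `u` is the lift of a function that is affine on the triangle with vertices in `P`. -/
def LiftedAffine (P : Set E3) (u : E3 → ℝ) : Prop :=
  ∃ l : E3 →ᵃ[ℝ] ℝ, ∀ w ∈ convexHull ℝ P, u (radialProj w) = l w

namespace Tri
variable {x y z c : E3} {ρ : ℝ}

lemma flag_coeff (h : Tri x y z c ρ) (α β γ : ℝ) :
    α • x + β • midpoint ℝ x y + γ • (ρ • c) =
      (α + β / 2 + γ * wt y z x) • x + (β / 2 + γ * wt z x y) • y + (γ * wt x y z) • z := by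
  rw [h.center_eq, midpoint_eq_smul_add, invOf_eq_inv]; module

lemma flag_inner (h : Tri x y z c ρ) :
    ∀ v ∈ ({x, midpoint ℝ x y, ρ • c} : Set E3), ⟪c, v⟫ = ρ := by
  rintro _ (rfl | rfl | rfl)
  exacts [h.cx, h.inner_mid, h.inner_center]

lemma flag_norm (h : Tri x y z c ρ) :
    ∀ v ∈ ({x, midpoint ℝ x y, ρ • c} : Set E3), ‖v‖ ≤ 1 := by
  rintro _ (rfl | rfl | rfl)
  exacts [h.nx.le, h.norm_mid_le, h.norm_center_le]

/-- Non-obtuseness makes all barycentric coordinates on the flag nonnegative; where one vanishes,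
the point lies in one of three null planes. -/
lemma ae_tgrad_flag (h : Tri x y z c ρ) {u : E3 → ℝ} {a : E3} (ha : IsSlope {x, y, z} c u a)
    (hl : LiftedAffine {x, y, z} u) :
    ∀ᵐ w ∂surf, w ∈ geoHull {x, midpoint ℝ x y, ρ • c} → tgrad u w = liftGrad c ρ a w := by
  obtain ⟨l, hl⟩ := hl
  have n1 := measure_eq_zero_iff_ae_notMem.1 (surf_span_pair y z)
  have n2 := measure_eq_zero_iff_ae_notMem.1 (surf_span_pair x z)
  have n3 := measure_eq_zero_iff_ae_notMem.1 (surf_span_pair x y)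
  filter_upwards [n1, n2, n3] with w w1 w2 w3 hw
  obtain ⟨-, α, β, γ, hα, hβ, hγ, rfl⟩ :=
    (mem_geoHull_triple h.pos h.cx h.inner_mid h.inner_center).1 hw
  rw [h.flag_coeff] at w1 w2 w3 ⊢
  have t1 := h.rot.wt_nonneg
  have t2 := h.rot.rot.wt_nonneg
  have t3 := h.wt_nonneg
  have p1 : 0 ≤ α + β / 2 + γ * wt y z x := by positivity
  have p2 : 0 ≤ β / 2 + γ * wt z x y := by positivity
  have p3 : 0 ≤ γ * wt x y z := by positivity
  refine h.tgrad_eq ha hl (lt_of_le_of_ne p1 fun e => ?_) (lt_of_le_of_ne p2 fun e => ?_)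
    (lt_of_le_of_ne p3 fun e => ?_)
  · exact w1 (Submodule.mem_span_pair.2
      ⟨β / 2 + γ * wt z x y, γ * wt x y z, by rw [← e, zero_smul, zero_add]⟩)
  · exact w2 (Submodule.mem_span_pair.2
      ⟨α + β / 2 + γ * wt y z x, γ * wt x y z, by rw [← e, zero_smul, add_zero]⟩)
  · exact w3 (Submodule.mem_span_pair.2
      ⟨α + β / 2 + γ * wt y z x, β / 2 + γ * wt z x y, by rw [← e, zero_smul, add_zero]⟩)

lemma ae_tgrad_halfEdge (h : Tri x y z c ρ) {u : E3 → ℝ} {a : E3}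
    (ha : IsSlope {x, y, z} c u a) (hl : LiftedAffine {x, y, z} u) :
    ∀ᵐ w ∂len, w ∈ geoHull {midpoint ℝ x y, ρ • c} → tgrad u w = liftGrad c ρ a w := by
  obtain ⟨l, hl⟩ := hl
  have hn := measure_eq_zero_iff_ae_notMem.1
    (len_finite (Set.toFinite {radialProj (midpoint ℝ x y), c}))
  filter_upwards [hn] with w hw0 hw
  obtain ⟨hw1, β, γ, hβ, hγ, rfl⟩ := (mem_geoHull_pair h.pos h.inner_mid h.inner_center).1 hw
  have hp := h.pos
  have hβ0 : 0 < β := by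
    refine lt_of_le_of_ne hβ ?_
    rintro rfl
    apply hw0
    rw [zero_smul, zero_add, smul_smul] at hw1 ⊢
    rw [norm_smul, h.nc, mul_one, Real.norm_of_nonneg (by positivity)] at hw1
    right
    rw [hw1, one_smul]; rfl
  -- Excludes both the midpoint end and the right-angled case, in which the circumcentre is the
  -- midpoint and the half edge is one point.
  have hgen : γ • (ρ • c) ≠ γ • midpoint ℝ x y := by
    intro he
    apply hw0
    left
    rw [he, ← add_smul] at hw1 ⊢
    rw [← radialProj_smul (t := β + γ) (by positivity), radialProj_of_norm_one hw1]
  have hγ0 : 0 < γ := by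
    refine lt_of_le_of_ne hγ ?_
    rintro rfl; simp at hgen
  have hang : 0 < ang x y z := by
    refine lt_of_le_of_ne h.az fun e => hgen ?_
    have := h.apothem_eq
    rw [← e, mul_zero, zero_div, apothem, norm_eq_zero, sub_eq_zero] at this
    rw [this]
  have hxy : 0 < ‖x - y‖ := norm_pos_iff.2 (sub_ne_zero.2 h.hxy)
  have hwt : 0 < wt x y z := by
    have := h.gram_pos
    rw [wt]; positivity
  have t1 := h.rot.wt_nonneg
  have t2 := h.rot.rot.wt_nonneg
  have e := h.flag_coeff 0 β γ
  rw [zero_smul, zero_add] at e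
  rw [e]
  exact h.tgrad_eq ha hl (by positivity) (by positivity) (by positivity)

/-- The exact flux across the half of a Voronoi edge. -/
lemma integral_halfEdge (h : Tri x y z c ρ) {u : E3 → ℝ} {a n : E3}
    (ha : IsSlope {x, y, z} c u a) (hl : LiftedAffine {x, y, z} u) (hn : ⟪c, n⟫ = 0) :
    IntegrableOn (fun w => ⟪tgrad u w, n⟫) (geoHull {midpoint ℝ x y, ρ • c}) len ∧
    ∫ w in geoHull {midpoint ℝ x y, ρ • c}, ⟪tgrad u w, n⟫ ∂len =
      ⟪a, n⟫ * ∫ w in geoHull {midpoint ℝ x y, ρ • c}, ρ / ⟪c, w⟫ ∂len := by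
  obtain ⟨hi, -, -⟩ := integral_geoHull_bounds h.nc h.pos h.inner_mid h.inner_center h.norm_mid_le
    h.norm_center_le
  have hm : MeasurableSet (geoHull {midpoint ℝ x y, ρ • c}) :=
    (isCompact_geoHull (Set.toFinite _) h.pos
      (fun v hv => h.flag_inner v (Set.mem_insert_of_mem _ hv))).isClosed.measurableSet
  have hae : ∀ᵐ w ∂len.restrict (geoHull {midpoint ℝ x y, ρ • c}),
      ⟪a, n⟫ * (ρ / ⟪c, w⟫) = ⟪tgrad u w, n⟫ := by
    rw [ae_restrict_iff' hm]
    filter_upwards [h.ae_tgrad_halfEdge ha hl] with w hw hwE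
    rw [hw hwE, inner_liftGrad hn]
  exact ⟨(hi.const_mul _).congr hae, by
    rw [← integral_const_mul]; exact (integral_congr_ae hae).symm⟩

/-- The contribution of one flag to the planar box-method identity. -/
def planarDefect (x y c : E3) (ρ : ℝ) (a b : E3) : ℝ :=
  apothem x y c ρ * ‖x - y‖ / 4 * ⟪a, b⟫ -
    apothem x y c ρ * (⟪a, x - y⟫ * ⟪b, x - y⟫) / (2 * ‖x - y‖)

/-- By `apothem_eq` each defect is a term of `box_identity` divided by the rotation-invariant `8 *
√(gram x y z)`. -/
lemma planarDefect_sum (h : Tri x y z c ρ) {a b : E3} (ha : ⟪c, a⟫ = 0) :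
    planarDefect x y c ρ a b + planarDefect y z c ρ a b + planarDefect z x c ρ a b = 0 := by
  have aux : ∀ {x y z : E3}, Tri x y z c ρ → planarDefect x y c ρ a b =
      (8 * √(gram x y z))⁻¹ *
        (ang x y z * (‖x - y‖ ^ 2 * ⟪a, b⟫ - 2 * (⟪a, x - y⟫ * ⟪b, x - y⟫))) := by
    intro x y z h
    have hg := Real.sqrt_pos.2 h.gram_pos
    have hxy : 0 < ‖x - y‖ := norm_pos_iff.2 (sub_ne_zero.2 h.hxy)
    rw [planarDefect, h.apothem_eq]
    field_simp
    ring
  rw [aux h, aux h.rot, aux h.rot.rot, h.rot.gram_rot, h.gram_rot, ← mul_add, ← mul_add,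
    h.box_identity ha, mul_zero]

lemma surf_flag_bounds (h : Tri x y z c ρ) :
    ρ * (apothem x y c ρ * ‖x - y‖ / 4) ≤ surf.real (geoHull {x, midpoint ℝ x y, ρ • c}) ∧
      surf.real (geoHull {x, midpoint ℝ x y, ρ • c}) ≤
        (apothem x y c ρ * ‖x - y‖ / 4) / ρ ^ 2 := by
  have hp := h.pos
  obtain ⟨h1, h2⟩ := surf_geoHull_bounds h.nc hp h.cx h.inner_mid h.inner_center h.nx.le
    h.norm_mid_le h.norm_center_le
  rw [h.det3_eq] at h1 h2
  refine ⟨le_trans (le_of_eq ?_) h1, h2.trans (le_of_eq ?_)⟩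
  · ring
  · field_simp; ring

lemma measurableSet_flag (h : Tri x y z c ρ) :
    MeasurableSet (geoHull {x, midpoint ℝ x y, ρ • c}) :=
  (isCompact_geoHull (Set.toFinite _) h.pos h.flag_inner).isClosed.measurableSet

/-- Pointwise bounds on a flag. -/
lemma ae_flag_bounds (h : Tri x y z c ρ) {u v : E3 → ℝ} {a b : E3}
    (ha : IsSlope {x, y, z} c u a) (hb : IsSlope {x, y, z} c v b)
    (hu : LiftedAffine {x, y, z} u) (hv : LiftedAffine {x, y, z} v) :
    ∀ᵐ w ∂surf.restrict (geoHull {x, midpoint ℝ x y, ρ • c}),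
      |⟪tgrad u w, tgrad v w⟫ - ⟪a, b⟫| ≤ ‖a‖ * ‖b‖ * ((1 - ρ ^ 2) * (1 + 1 / ρ ^ 2)) ∧
      ρ ^ 2 * (‖a‖ * ‖b‖) ≤ ‖tgrad u w‖ * ‖tgrad v w‖ ∧
      ‖tgrad u w‖ ≤ (1 + ρ⁻¹) * ‖a‖ ∧ ‖tgrad v w‖ ≤ (1 + ρ⁻¹) * ‖b‖ := by
  rw [ae_restrict_iff' h.measurableSet_flag]
  filter_upwards [h.ae_tgrad_flag ha hu, h.ae_tgrad_flag hb hv] with w w1 w2 hw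
  rw [w1 hw, w2 hw]
  have hp := h.pos
  have hn := mem_S2.1 (geoHull_subset_S2 hp h.flag_inner hw)
  obtain ⟨i1, i2⟩ := inner_geoHull h.nc hp h.flag_inner h.flag_norm hw
  refine ⟨abs_inner_liftGrad_sub_le hp h.nc ha.1 hb.1 hn i1 i2, ?_,
    norm_liftGrad_le hp h.nc hn i1, norm_liftGrad_le hp h.nc hn i1⟩
  calc ρ ^ 2 * (‖a‖ * ‖b‖) = (ρ * ‖a‖) * (ρ * ‖b‖) := by ring
    _ ≤ _ := mul_le_mul (norm_liftGrad_ge h.nc ha.1 (hp.trans_le i1) i2)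
      (norm_liftGrad_ge h.nc hb.1 (hp.trans_le i1) i2) (by positivity) (norm_nonneg _)

lemma integrable_flag (h : Tri x y z c ρ) {u v : E3 → ℝ} {a b : E3}
    (ha : IsSlope {x, y, z} c u a) (hb : IsSlope {x, y, z} c v b)
    (hu : LiftedAffine {x, y, z} u) (hv : LiftedAffine {x, y, z} v) :
    IntegrableOn (fun w => ⟪tgrad u w, tgrad v w⟫) (geoHull {x, midpoint ℝ x y, ρ • c}) surf ∧
    IntegrableOn (fun w => ‖tgrad u w‖ * ‖tgrad v w‖)
      (geoHull {x, midpoint ℝ x y, ρ • c}) surf := by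
  have hb1 : ∀ᵐ w ∂surf.restrict (geoHull {x, midpoint ℝ x y, ρ • c}),
      ‖tgrad u w‖ * ‖tgrad v w‖ ≤ ((1 + ρ⁻¹) * ‖a‖) * ((1 + ρ⁻¹) * ‖b‖) := by
    have hp := h.pos
    filter_upwards [h.ae_flag_bounds ha hb hu hv] with w hw
    exact mul_le_mul hw.2.2.1 hw.2.2.2 (norm_nonneg _) (by positivity)
  constructor
  · refine Measure.integrableOn_of_bounded (measure_ne_top _ _)
      ((measurable_tgrad u).inner (measurable_tgrad v)).aestronglyMeasurable
      (M := ((1 + ρ⁻¹) * ‖a‖) * ((1 + ρ⁻¹) * ‖b‖)) ?_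
    filter_upwards [hb1] with w hw
    exact (norm_inner_le_norm _ _).trans hw
  · refine Measure.integrableOn_of_bounded (measure_ne_top _ _)
      ((measurable_tgrad u).norm.mul (measurable_tgrad v).norm).aestronglyMeasurable
      (M := ((1 + ρ⁻¹) * ‖a‖) * ((1 + ρ⁻¹) * ‖b‖)) ?_
    filter_upwards [hb1] with w hw
    rwa [Real.norm_of_nonneg (by positivity)]

/-- On one flag, the exact form and the exact flux agree up to `1 - ρ²` with the planar ones. -/
lemma local_error (h : Tri x y z c ρ) {u v : E3 → ℝ} {a b : E3}
    (ha : IsSlope {x, y, z} c u a) (hb : IsSlope {x, y, z} c v b)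
    (hu : LiftedAffine {x, y, z} u) (hv : LiftedAffine {x, y, z} v) :
    |(∫ w in geoHull {x, midpoint ℝ x y, ρ • c}, ⟪tgrad u w, tgrad v w⟫ ∂surf) -
      (∫ w in geoHull {midpoint ℝ x y, ρ • c}, ρ / ⟪c, w⟫ ∂len) *
        (⟪a, x - y⟫ * ⟪b, x - y⟫) / (2 * ‖x - y‖) - planarDefect x y c ρ a b| ≤
      5 * (1 - ρ ^ 2) / ρ ^ 5 *
        ∫ w in geoHull {x, midpoint ℝ x y, ρ • c}, ‖tgrad u w‖ * ‖tgrad v w‖ ∂surf := by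
  have hp := h.pos
  have hp1 := h.rho_le_one
  have hδ : 0 ≤ 1 - ρ ^ 2 := by nlinarith
  have hxy : 0 < ‖x - y‖ := norm_pos_iff.2 (sub_ne_zero.2 h.hxy)
  have hℓ : 0 ≤ apothem x y c ρ := norm_nonneg _
  obtain ⟨-, k1, k2⟩ := integral_geoHull_bounds h.nc h.pos h.inner_mid h.inner_center
    h.norm_mid_le h.norm_center_le
  obtain ⟨s1, s2⟩ := h.surf_flag_bounds
  obtain ⟨i1, i2⟩ := h.integrable_flag ha hb hu hv
  have hae := h.ae_flag_bounds ha hb hu hv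
  rw [norm_sub_rev (midpoint ℝ x y) (ρ • c), ← apothem] at k1 k2
  set F := geoHull {x, midpoint ℝ x y, ρ • c} with hF
  set K := ∫ w in geoHull {midpoint ℝ x y, ρ • c}, ρ / ⟪c, w⟫ ∂len
  set I := ∫ w in F, ⟪tgrad u w, tgrad v w⟫ ∂surf
  set J := ∫ w in F, ‖tgrad u w‖ * ‖tgrad v w‖ ∂surf
  set σ := surf.real F
  set ℓ := apothem x y c ρ with hℓd
  set M := ‖a‖ * ‖b‖ with hM
  have hM0 : 0 ≤ M := by positivity
  have hσ0 : 0 ≤ σ := measureReal_nonneg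
  have hab : |⟪a, b⟫| ≤ M := abs_real_inner_le_norm a b
  -- Turns bounds in terms of the constants `‖a‖ * ‖b‖` and the area back into the integral of the
  -- gradient norms.
  have hJ : ρ ^ 2 * M * σ ≤ J := by
    have := integral_mono_ae (integrableOn_const (s := F) (C := ρ ^ 2 * M) (measure_ne_top surf _))
      i2 (by filter_upwards [hae] with w hw using hw.2.1)
    rw [setIntegral_const, smul_eq_mul, mul_comm] at this
    exact this
  have hI : |I - ⟪a, b⟫ * σ| ≤ M * ((1 - ρ ^ 2) * (1 + 1 / ρ ^ 2)) * σ := by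
    have e : I - ⟪a, b⟫ * σ = ∫ w in F, (⟪tgrad u w, tgrad v w⟫ - ⟪a, b⟫) ∂surf := by
      rw [integral_sub i1 (integrableOn_const (measure_ne_top surf _)), setIntegral_const,
        smul_eq_mul, mul_comm ⟪a, b⟫]
    rw [e, ← Real.norm_eq_abs]
    refine norm_setIntegral_le_of_norm_le_const_ae (measure_lt_top _ _) ?_
    filter_upwards [hae] with w hw
    exact hw.1
  have hf0 : 0 ≤ ℓ * ‖x - y‖ / 4 := by positivity
  have e1 : |σ - ℓ * ‖x - y‖ / 4| ≤ (1 - ρ ^ 2) / ρ ^ 2 * (ℓ * ‖x - y‖ / 4) := by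
    set f := ℓ * ‖x - y‖ / 4
    have g1 : f / ρ ^ 2 = f + (1 - ρ ^ 2) / ρ ^ 2 * f := by field_simp; ring
    have g2 : (1 - ρ ^ 2) ≤ (1 - ρ ^ 2) / ρ ^ 2 :=
      le_div_self hδ (by positivity) (pow_le_one₀ hp.le hp1)
    have g3 : f - ρ * f ≤ (1 - ρ ^ 2) * f := by nlinarith [mul_nonneg hf0 hp.le]
    have g4 : (1 - ρ ^ 2) * f ≤ (1 - ρ ^ 2) / ρ ^ 2 * f := by gcongr
    rw [abs_le]; constructor <;> linarith
  have e2 : |K - ℓ| ≤ (1 - ρ ^ 2) / ρ ^ 2 * ℓ := by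
    have g1 : ℓ / ρ ≤ ℓ + (1 - ρ ^ 2) / ρ ^ 2 * ℓ := by
      have : ℓ + (1 - ρ ^ 2) / ρ ^ 2 * ℓ = ℓ / ρ ^ 2 := by field_simp; ring
      rw [this]
      exact div_le_div_of_nonneg_left hℓ (by positivity) (by nlinarith)
    have g2 : (1 - ρ ^ 2) ≤ (1 - ρ ^ 2) / ρ ^ 2 :=
      le_div_self hδ (by positivity) (pow_le_one₀ hp.le hp1)
    have g4 : (1 - ρ ^ 2) * ℓ ≤ (1 - ρ ^ 2) / ρ ^ 2 * ℓ := by gcongr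
    rw [abs_le]; constructor <;> linarith
  have hn : |⟪a, x - y⟫ * ⟪b, x - y⟫| ≤ M * ‖x - y‖ ^ 2 := by
    rw [abs_mul]
    calc _ ≤ (‖a‖ * ‖x - y‖) * (‖b‖ * ‖x - y‖) :=
          mul_le_mul (abs_real_inner_le_norm _ _) (abs_real_inner_le_norm _ _) (abs_nonneg _)
            (by positivity)
      _ = _ := by rw [hM]; ring
  -- Three replacements by planar data: gradients, flag area, and weighted length of the half edge.
  have hsplit : I - K * (⟪a, x - y⟫ * ⟪b, x - y⟫) / (2 * ‖x - y‖) - planarDefect x y c ρ a b =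
      (I - ⟪a, b⟫ * σ) + (σ - ℓ * ‖x - y‖ / 4) * ⟪a, b⟫ -
        (K - ℓ) * ((⟪a, x - y⟫ * ⟪b, x - y⟫) / (2 * ‖x - y‖)) := by
    rw [planarDefect, ← hℓd]; ring
  have h3 : |(σ - ℓ * ‖x - y‖ / 4) * ⟪a, b⟫| ≤
      (1 - ρ ^ 2) / ρ ^ 2 * (ℓ * ‖x - y‖ / 4) * M := by
    rw [abs_mul]
    exact mul_le_mul e1 hab (abs_nonneg _) (by positivity)
  have h4 : |(K - ℓ) * ((⟪a, x - y⟫ * ⟪b, x - y⟫) / (2 * ‖x - y‖))| ≤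
      (1 - ρ ^ 2) / ρ ^ 2 * (ℓ * ‖x - y‖ / 4) * M * 2 := by
    rw [abs_mul, abs_div, abs_of_pos (show 0 < 2 * ‖x - y‖ by positivity)]
    calc _ ≤ ((1 - ρ ^ 2) / ρ ^ 2 * ℓ) * (M * ‖x - y‖ ^ 2 / (2 * ‖x - y‖)) := by gcongr
      _ = _ := by field_simp; ring
  have hfσ : ℓ * ‖x - y‖ / 4 ≤ σ / ρ := by rw [le_div_iff₀ hp]; linarith
  -- The constant is `5 = 2 + 1 + 2`, the first `2` from `1 + 1 / ρ ^ 2 ≤ 2 / ρ ^ 3`.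
  have hfin : M * ((1 - ρ ^ 2) * (1 + 1 / ρ ^ 2)) * σ +
      (1 - ρ ^ 2) / ρ ^ 2 * (ℓ * ‖x - y‖ / 4) * M +
      (1 - ρ ^ 2) / ρ ^ 2 * (ℓ * ‖x - y‖ / 4) * M * 2 ≤
        5 * (1 - ρ ^ 2) / ρ ^ 5 * (ρ ^ 2 * M * σ) := by
    have q0 : 0 ≤ (1 - ρ ^ 2) * M * σ := by positivity
    have q1 : (1 - ρ ^ 2) / ρ ^ 2 * (ℓ * ‖x - y‖ / 4) * M ≤
        (1 - ρ ^ 2) / ρ ^ 2 * (σ / ρ) * M := by gcongr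
    have q2 : (1 - ρ ^ 2) / ρ ^ 2 * (σ / ρ) * M = ((1 - ρ ^ 2) * M * σ) * (1 / ρ ^ 3) := by
      field_simp
    have q3 : 5 * (1 - ρ ^ 2) / ρ ^ 5 * (ρ ^ 2 * M * σ) =
        ((1 - ρ ^ 2) * M * σ) * (5 * (1 / ρ ^ 3)) := by field_simp
    have q4 : 1 + 1 / ρ ^ 2 ≤ 2 * (1 / ρ ^ 3) := by
      have r1 : 1 ≤ 1 / ρ ^ 3 := (one_le_div (by positivity)).2 (pow_le_one₀ hp.le hp1)
      have r2 : 1 / ρ ^ 2 ≤ 1 / ρ ^ 3 := one_div_le_one_div_of_le (by positivity)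
        (pow_le_pow_of_le_one hp.le hp1 (by norm_num))
      linarith
    have q5 : M * ((1 - ρ ^ 2) * (1 + 1 / ρ ^ 2)) * σ ≤
        ((1 - ρ ^ 2) * M * σ) * (2 * (1 / ρ ^ 3)) := by
      rw [show M * ((1 - ρ ^ 2) * (1 + 1 / ρ ^ 2)) * σ =
        ((1 - ρ ^ 2) * M * σ) * (1 + 1 / ρ ^ 2) by ring]
      gcongr
    rw [q3]
    rw [q2] at q1
    linarith
  rw [hsplit]
  calc _ ≤ |I - ⟪a, b⟫ * σ| + |(σ - ℓ * ‖x - y‖ / 4) * ⟪a, b⟫| +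
        |(K - ℓ) * ((⟪a, x - y⟫ * ⟪b, x - y⟫) / (2 * ‖x - y‖))| :=
        (abs_sub _ _).trans (add_le_add (abs_add_le _ _) le_rfl)
    _ ≤ _ := add_le_add (add_le_add hI h3) h4
    _ ≤ _ := hfin
    _ ≤ _ := by gcongr

end Tri

/-! ### Sums over flags -/

/-- Sum over all ordered Delaunay triples. -/
def delSum (x : Fin N → E3) (f : Fin N → Fin N → Fin N → ℝ) : ℝ :=
  ∑ i, ∑ j, ∑ k, if Del x i j k then f i j k else 0

lemma delSum_congr {x : Fin N → E3} {f g : Fin N → Fin N → Fin N → ℝ}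
    (h : ∀ i j k, Del x i j k → f i j k = g i j k) : delSum x f = delSum x g := by
  refine Finset.sum_congr rfl fun i _ => Finset.sum_congr rfl fun j _ =>
    Finset.sum_congr rfl fun k _ => ?_
  split_ifs with hd
  exacts [h i j k hd, rfl]

lemma delSum_le {x : Fin N → E3} {f g : Fin N → Fin N → Fin N → ℝ}
    (h : ∀ i j k, Del x i j k → f i j k ≤ g i j k) : delSum x f ≤ delSum x g := by
  refine Finset.sum_le_sum fun i _ => Finset.sum_le_sum fun j _ =>
    Finset.sum_le_sum fun k _ => ?_
  split_ifs with hd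
  exacts [h i j k hd, le_rfl]

lemma delSum_add (x : Fin N → E3) (f g : Fin N → Fin N → Fin N → ℝ) :
    delSum x (fun i j k => f i j k + g i j k) = delSum x f + delSum x g := by
  simp only [delSum, ← Finset.sum_add_distrib]
  refine Finset.sum_congr rfl fun i _ => Finset.sum_congr rfl fun j _ =>
    Finset.sum_congr rfl fun k _ => ?_
  split_ifs <;> simp

lemma delSum_mul (x : Fin N → E3) (c : ℝ) (f : Fin N → Fin N → Fin N → ℝ) :
    delSum x (fun i j k => c * f i j k) = c * delSum x f := by
  simp only [delSum, Finset.mul_sum, mul_ite, mul_zero]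

lemma delSum_sub (x : Fin N → E3) (f g : Fin N → Fin N → Fin N → ℝ) :
    delSum x (fun i j k => f i j k - g i j k) = delSum x f - delSum x g := by
  have := delSum_add x (fun i j k => f i j k - g i j k) g
  simp only [sub_add_cancel] at this
  linarith

lemma abs_delSum_le (x : Fin N → E3) (f : Fin N → Fin N → Fin N → ℝ) :
    |delSum x f| ≤ delSum x fun i j k => |f i j k| := by
  refine (Finset.abs_sum_le_sum_abs _ _).trans (Finset.sum_le_sum fun i _ => ?_)
  refine (Finset.abs_sum_le_sum_abs _ _).trans (Finset.sum_le_sum fun j _ => ?_)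
  refine (Finset.abs_sum_le_sum_abs _ _).trans (Finset.sum_le_sum fun k _ => ?_)
  split_ifs <;> simp

lemma delSum_swap (x : Fin N → E3) (f : Fin N → Fin N → Fin N → ℝ) :
    delSum x (fun i j k => f j i k) = delSum x f := by
  rw [delSum, Finset.sum_comm]
  refine Finset.sum_congr rfl fun i _ => Finset.sum_congr rfl fun j _ =>
    Finset.sum_congr rfl fun k _ => ?_
  simp only [show Del x j i k ↔ Del x i j k from ⟨Del.swap, Del.swap⟩]

lemma delSum_rot (x : Fin N → E3) (f : Fin N → Fin N → Fin N → ℝ) :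
    delSum x (fun i j k => f j k i) = delSum x f := by
  rw [delSum, Finset.sum_comm]
  refine Finset.sum_congr rfl fun i _ => ?_
  rw [Finset.sum_comm]
  refine Finset.sum_congr rfl fun j _ => Finset.sum_congr rfl fun k _ => ?_
  simp only [show Del x k i j ↔ Del x i j k from ⟨Del.rot, fun h => h.rot.rot⟩]

/-- The type of ordered Delaunay triples. -/
abbrev DelTriple (x : Fin N → E3) : Type :=
  {t : Fin N × Fin N × Fin N // Del x t.1 t.2.1 t.2.2}

lemma sum_delTriple (x : Fin N → E3) (f : Fin N → Fin N → Fin N → ℝ) :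
    ∑ t : DelTriple x, f t.1.1 t.1.2.1 t.1.2.2 = delSum x f := by
  rw [delSum, ← Finset.sum_subtype (Finset.univ.filter
    fun t : Fin N × Fin N × Fin N => Del x t.1 t.2.1 t.2.2) (by simp)
    (fun t => f t.1 t.2.1 t.2.2), Finset.sum_filter, Fintype.sum_prod_type]
  refine Finset.sum_congr rfl fun i _ => ?_
  rw [Fintype.sum_prod_type]

namespace Mesh
variable {x : Fin N → E3} {κ : ℝ}

lemma measurableSet_flag (h : Mesh x κ) {i j k : Fin N} (hd : Del x i j k) :
    MeasurableSet (flag x i j k) := (h.tri hd).measurableSet_flag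

lemma measurableSet_halfEdge (h : Mesh x κ) {i j k : Fin N} (hd : Del x i j k) :
    MeasurableSet (halfEdge x i j k) :=
  (isCompact_geoHull (Set.toFinite _) (h.tri hd).pos
    (fun v hv => (h.tri hd).flag_inner v (Set.mem_insert_of_mem _ hv))).isClosed.measurableSet

lemma ae_mem_iUnion_flag (h : Mesh x κ) (hN : 0 < N) :
    ∀ᵐ y ∂surf, y ∈ ⋃ t : DelTriple x, flag x t.1.1 t.1.2.1 t.1.2.2 := by
  have h0 : ∀ᵐ y ∂surf, ∀ i, y ≠ x i := by
    rw [ae_all_iff]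
    intro i
    filter_upwards [measure_eq_zero_iff_ae_notMem.1 (surf_span_pair (x i) (x i))] with y hy he
    exact hy (he ▸ Submodule.subset_span (by simp))
  filter_upwards [h0, ae_mem_S2] with y hy hS
  obtain ⟨i, j, k, hd, hf⟩ := h.exists_flag hN (mem_S2.1 hS) hy
  exact Set.mem_iUnion.2 ⟨⟨(i, j, k), hd⟩, hf⟩

lemma integral_surf_eq (h : Mesh x κ) (hN : 0 < N) {f : E3 → ℝ}
    (hf : ∀ i j k, Del x i j k → IntegrableOn f (flag x i j k) surf) :
    ∫ y, f y ∂surf = delSum x fun i j k => ∫ y in flag x i j k, f y ∂surf := by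
  rw [integral_eq_setIntegral (h.ae_mem_iUnion_flag hN), integral_iUnion_ae, tsum_fintype,
    ← sum_delTriple]
  · exact fun t => (h.measurableSet_flag t.2).nullMeasurableSet
  · intro t t' hne
    exact h.flag_inter_null t.2 t'.2 fun he => hne (Subtype.ext he)
  · rw [integrableOn_finite_iUnion]
    exact fun t => hf _ _ _ t.2

/-- The gradient of the affine function on the triangle `x i`, `x j`, `x k` which `u` lifts. -/
def slope (x : Fin N → E3) (u : E3 → ℝ) (i j k : Fin N) : E3 :=
  if h : ∃ a, IsSlope {x i, x j, x k} (ctr x {i, j, k}) u a then h.choose else 0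

lemma isSlope_slope (h : Mesh x κ) (u : E3 → ℝ) {i j k : Fin N} (hd : Del x i j k) :
    IsSlope {x i, x j, x k} (ctr x {i, j, k}) u (slope x u i j k) := by
  have he := (h.tri hd).exists_isSlope u
  rw [slope, dif_pos he]; exact he.choose_spec

lemma slope_rot (x : Fin N → E3) (u : E3 → ℝ) (i j k : Fin N) :
    slope x u j k i = slope x u i j k := by
  have : ({x j, x k, x i} : Set E3) = {x i, x j, x k} := by ext; simp; tauto
  simp only [slope, triple_rot, this]

lemma slope_swap (x : Fin N → E3) (u : E3 → ℝ) (i j k : Fin N) :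
    slope x u j i k = slope x u i j k := by
  have : ({x j, x i, x k} : Set E3) = {x i, x j, x k} := by ext; simp; tauto
  simp only [slope, triple_swap, this]

/-- Makes every `L^p` norm finite, so that `toReal` in `tgradNorm` loses nothing in Hölder's
inequality. -/
lemma ae_bounded_tgrad (h : Mesh x κ) (hN : 0 < N) {u : E3 → ℝ}
    (hu : ∀ i j k, Del x i j k → LiftedAffine {x i, x j, x k} u) :
    ∃ M : ℝ, ∀ᵐ y ∂surf, ‖tgrad u y‖ ≤ M := by
  set b : DelTriple x → ℝ := fun t => (1 + (rho x t.1.1 t.1.2.1 t.1.2.2)⁻¹) *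
    ‖slope x u t.1.1 t.1.2.1 t.1.2.2‖ with hb
  have hb0 : ∀ t, 0 ≤ b t := fun t => by
    have := (h.tri t.2).pos
    positivity
  refine ⟨∑ t, b t, ?_⟩
  have hcov := h.ae_mem_iUnion_flag hN
  rw [← Measure.restrict_eq_self_of_ae_mem hcov, ae_restrict_iUnion_iff]
  intro t
  have hs := h.isSlope_slope u t.2
  filter_upwards [(h.tri t.2).ae_flag_bounds hs hs (hu _ _ _ t.2) (hu _ _ _ t.2)] with y hy
  exact hy.2.2.1.trans (Finset.single_le_sum (f := b) (fun t _ => hb0 t) (Finset.mem_univ t))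

end Mesh

lemma integral_norm_mul_norm_le {p q : ℝ≥0∞} (hpq : 1 / p + 1 / q = 1) {μ : Measure E3}
    {f g : E3 → E3} (hf : MemLp f p μ) (hg : MemLp g q μ) :
    ∫ y, ‖f y‖ * ‖g y‖ ∂μ ≤ (eLpNorm f p μ).toReal * (eLpNorm g q μ).toReal := by
  have : ENNReal.HolderTriple p q 1 := ⟨by simpa using hpq⟩
  have h1 := eLpNorm_smul_le_mul_eLpNorm (r := 1) (p := p) (q := q) hg.norm.1 hf.norm.1
  rw [eLpNorm_norm, eLpNorm_norm] at h1
  have h2 := integral_norm_eq_lintegral_enorm (hf.norm.1.smul hg.norm.1)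
  rw [← eLpNorm_one_eq_lintegral_enorm] at h2
  rw [← ENNReal.toReal_mul]
  calc ∫ y, ‖f y‖ * ‖g y‖ ∂μ = ∫ y, ‖((fun y => ‖f y‖) • (fun y => ‖g y‖)) y‖ ∂μ := by
        refine integral_congr_ae (Filter.Eventually.of_forall fun y => ?_)
        simp
    _ = _ := h2
    _ ≤ _ := ENNReal.toReal_mono (ENNReal.mul_ne_top hf.2.ne hg.2.ne) h1

/-! ### The finite volume form as a sum over flags, and the global estimate -/

namespace Mesh
variable {x : Fin N → E3} {κ : ℝ}

lemma closure_inter (hcl : ∀ i, closure (cell x i) = S2 ∩ vcone x i) (i j : Fin N) :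
    vedge x i j = {y | ‖y‖ = 1 ∧ y ∈ vcone x i ∧ y ∈ vcone x j} := by
  ext y
  rw [vedge, hcl, hcl]
  simp only [Set.mem_inter_iff, mem_S2, Set.mem_ofPred_eq]
  tauto

/-- The weight of half of a Voronoi edge in the exact flux. -/
def halfFlux (x : Fin N → E3) (i j k : Fin N) : ℝ :=
  ∫ y in halfEdge x i j k, rho x i j k / ⟪ctr x {i, j, k}, y⟫ ∂len

lemma _root_.SphereFV.Del.halfFlux_swap {i j k : Fin N} (hd : Del x i j k) :
    halfFlux x j i k = halfFlux x i j k := by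
  rw [halfFlux, halfFlux, halfEdge, halfEdge, hd.rho_swap, triple_swap, midpoint_comm]

lemma inner_conormal (h : Mesh x κ) {i j k : Fin N} (hd : Del x i j k) :
    ⟪ctr x {i, j, k}, conormal x i j⟫ = 0 := by
  rw [conormal, real_inner_smul_right, inner_sub_right, (h.tri hd).cx, (h.tri hd).cy, sub_self,
    mul_zero]

lemma flux_eq (h : Mesh x κ) (hcl : ∀ i, closure (cell x i) = S2 ∩ vcone x i) {u : E3 → ℝ}
    (hu : ∀ i j k, Del x i j k → LiftedAffine {x i, x j, x k} u) {i j : Fin N} (hij : i ≠ j) :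
    flux x u i j = ∑ k, if Del x i j k then
      -(⟪slope x u i j k, conormal x i j⟫ * halfFlux x i j k) else 0 := by
  have hU : vedge x i j = ⋃ k : {k // Del x i j k}, halfEdge x i j k := by
    rw [closure_inter hcl]
    ext y
    simp only [Set.mem_iUnion]
    constructor
    · rintro ⟨h1, h2, h3⟩
      obtain ⟨k, hd, hk⟩ := h.exists_halfEdge hij h1 h2 h3
      exact ⟨⟨k, hd⟩, hk⟩
    · rintro ⟨⟨k, hd⟩, hk⟩
      exact h.halfEdge_subset hd hk
  have hloc : ∀ k : {k // Del x i j k}, _ := fun k =>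
    (h.tri k.2).integral_halfEdge (h.isSlope_slope u k.2) (hu _ _ _ k.2) (h.inner_conormal k.2)
  rw [flux, hU, integral_iUnion_ae, tsum_fintype, ← Finset.sum_neg_distrib, ← Finset.sum_filter,
    Finset.sum_subtype (Finset.univ.filter fun k => Del x i j k) (p := fun k => Del x i j k)
    (by simp)]
  · exact Finset.sum_congr rfl fun k _ => congrArg Neg.neg (hloc k).2
  · exact fun k => (h.measurableSet_halfEdge k.2).nullMeasurableSet
  · intro k k' hne
    refine measure_mono_null (h.halfEdge_inter k.2 k'.2 fun he => hne (Subtype.ext he)) ?_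
    exact len_finite (Set.finite_singleton _)
  · rw [integrableOn_finite_iUnion]
    exact fun k => (hloc k).1

lemma sum_nbrs_flux (h : Mesh x κ) (hcl : ∀ i, closure (cell x i) = S2 ∩ vcone x i) {u : E3 → ℝ}
    (hu : ∀ i j k, Del x i j k → LiftedAffine {x i, x j, x k} u) (i : Fin N) :
    ∑ j ∈ nbrs x i, flux x u i j = ∑ j, ∑ k, if Del x i j k then
      -(⟪slope x u i j k, conormal x i j⟫ * halfFlux x i j k) else 0 := by
  rw [nbrs, Finset.sum_filter]
  refine Finset.sum_congr rfl fun j _ => ?_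
  split_ifs with hj
  · exact h.flux_eq hcl hu hj.1.symm
  · symm
    refine Finset.sum_eq_zero fun k _ => if_neg fun hd => hj ⟨hd.1.symm, ctr x {i, j, k}, ?_⟩
    rw [closure_inter hcl]
    exact ⟨hd.norm_ctr, hd.ctr_mem _ (by simp), hd.ctr_mem _ (by simp)⟩

/-- Summation by parts: the flux is antisymmetric in `i` and `j`, so `v (x i)` may be replaced by
`(v (x i) - v (x j)) / 2`, and that difference is `⟪slope, x i - x j⟫ / 2`. -/
lemma formFV_eq (h : Mesh x κ) (hcl : ∀ i, closure (cell x i) = S2 ∩ vcone x i) {u v w : E3 → ℝ}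
    (hu : ∀ i j k, Del x i j k → LiftedAffine {x i, x j, x k} u) (hw : ∀ i, w (x i) = v (x i)) :
    formFV x u w = delSum x fun i j k => halfFlux x i j k *
      (⟪slope x u i j k, x i - x j⟫ * ⟪slope x v i j k, x i - x j⟫) / (2 * ‖x i - x j‖) := by
  set φ : Fin N → Fin N → Fin N → ℝ := fun i j k =>
    -(⟪slope x u i j k, conormal x i j⟫ * halfFlux x i j k) with hφ
  have h1 : formFV x u w = delSum x fun i j k => v (x i) * φ i j k := by
    simp only [formFV, delSum]
    refine Finset.sum_congr rfl fun i _ => ?_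
    rw [hw, h.sum_nbrs_flux hcl hu, Finset.mul_sum]
    refine Finset.sum_congr rfl fun j _ => ?_
    rw [Finset.mul_sum]
    refine Finset.sum_congr rfl fun k _ => ?_
    split_ifs <;> simp [hφ]
  have h2 : delSum x (fun i j k => v (x i) * φ i j k) =
      delSum x (fun i j k => (-1) * (v (x j) * φ i j k)) := by
    rw [← delSum_swap]
    refine delSum_congr fun i j k hd => ?_
    have : conormal x j i = - conormal x i j := by
      rw [conormal, conormal, norm_sub_rev, ← smul_neg, neg_sub]
    simp only [hφ, slope_swap, hd.halfFlux_swap, this, inner_neg_right]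
    ring
  have h3 : delSum x (fun i j k => halfFlux x i j k *
      (⟪slope x u i j k, x i - x j⟫ * ⟪slope x v i j k, x i - x j⟫) / (2 * ‖x i - x j‖)) =
      delSum x (fun i j k => (1 / 2) * (v (x i) * φ i j k + (-1) * (v (x j) * φ i j k))) := by
    refine delSum_congr fun i j k hd => ?_
    have hv := (h.isSlope_slope v hd).2 (x i) (by simp) (x j) (by simp)
    have hn : ⟪slope x u i j k, conormal x i j⟫ =
        -(‖x i - x j‖⁻¹ * ⟪slope x u i j k, x i - x j⟫) := by
      rw [conormal, real_inner_smul_right, norm_sub_rev, ← neg_sub (x i), inner_neg_right]; ring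
    rw [hv, hφ]
    simp only [hn]
    ring
  rw [h3, delSum_mul, delSum_add, ← h2, h1]
  ring

/-- The comparison of the two bilinear forms on a non-degenerate Voronoi decomposition. -/
theorem abs_formA_sub_formFV_le (h : Mesh x κ) (hκ1 : κ ≤ 1) (hN : 0 < N)
    (hcl : ∀ i, closure (cell x i) = S2 ∩ vcone x i) {u v w : E3 → ℝ}
    (hu : ∀ i j k, Del x i j k → LiftedAffine {x i, x j, x k} u)
    (hv : ∀ i j k, Del x i j k → LiftedAffine {x i, x j, x k} v) (hw : ∀ i, w (x i) = v (x i))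
    {p q : ℝ≥0∞} (hpq : 1 / p + 1 / q = 1) :
    |formA u v - formFV x u w| ≤ 5 * (1 - κ ^ 2) / κ ^ 5 * (tgradNorm p u * tgradNorm q v) := by
  have hκ := h.κ_pos
  have hint := fun i j k (hd : Del x i j k) => (h.tri hd).integrable_flag (h.isSlope_slope u hd)
    (h.isSlope_slope v hd) (hu i j k hd) (hv i j k hd)
  have hA : formA u v = delSum x fun i j k => ∫ y in flag x i j k, ⟪tgrad u y, tgrad v y⟫ ∂surf :=
    h.integral_surf_eq hN fun i j k hd => (hint i j k hd).1
  have hJ := h.integral_surf_eq hN fun i j k hd => (hint i j k hd).2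
  set P : Fin N → Fin N → Fin N → ℝ := fun i j k => Tri.planarDefect (x i) (x j) (ctr x {i, j, k})
    (rho x i j k) (slope x u i j k) (slope x v i j k) with hP
  -- Three copies of the sum, with the indices rotated, group the defects triangle by triangle.
  have hP0 : delSum x P = 0 := by
    have e : delSum x P + delSum x P + delSum x P = 0 := by
      conv_lhs => rw [← delSum_rot x P]
      conv_lhs =>
        enter [1, 1]
        rw [delSum_rot x P]
      conv_lhs =>
        enter [2]
        rw [← delSum_rot x fun i j k => P j k i]
      rw [← delSum_add, ← delSum_add]
      have : delSum x (fun i j k => P i j k + P j k i + P k i j) = delSum x fun _ _ _ => 0 := by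
        refine delSum_congr fun i j k hd => ?_
        have e1 : P j k i = Tri.planarDefect (x j) (x k) (ctr x {i, j, k}) (rho x i j k)
            (slope x u i j k) (slope x v i j k) := by
          simp only [hP]
          rw [triple_rot i j k, hd.rho_rot, slope_rot x u i j k, slope_rot x v i j k]
        have e2 : P k i j = Tri.planarDefect (x k) (x i) (ctr x {i, j, k}) (rho x i j k)
            (slope x u i j k) (slope x v i j k) := by
          simp only [hP]
          rw [triple_rot j k i, triple_rot i j k, hd.rot.rho_rot, hd.rho_rot,
            slope_rot x u j k i, slope_rot x v j k i, slope_rot x u i j k, slope_rot x v i j k]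
        rw [e1, e2]
        exact (h.tri hd).planarDefect_sum (h.isSlope_slope u hd).1
      rw [this]
      simp [delSum]
    linarith
  have hρ : ∀ i j k, Del x i j k → κ ≤ rho x i j k := fun i j k hd => by
    have := h.bound i _ (hd.ctr_mem i (by simp))
    rwa [hd.norm_ctr, mul_one] at this
  have hκ0 : 0 ≤ 1 - κ ^ 2 := by nlinarith
  have hmain : |formA u v - formFV x u w| ≤
      5 * (1 - κ ^ 2) / κ ^ 5 * ∫ y, ‖tgrad u y‖ * ‖tgrad v y‖ ∂surf := by
    rw [hA, h.formFV_eq hcl hu hw, ← sub_zero (delSum x _ - delSum x _), ← hP0, ← delSum_sub,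
      ← delSum_sub, hJ, ← delSum_mul]
    refine (abs_delSum_le x _).trans (delSum_le fun i j k hd => ?_)
    have T := h.tri hd
    refine (T.local_error (h.isSlope_slope u hd) (h.isSlope_slope v hd) (hu i j k hd)
      (hv i j k hd)).trans ?_
    have hk := hρ i j k hd
    have : 0 ≤ 1 - rho x i j k ^ 2 := by nlinarith [T.pos, T.rho_le_one]
    refine mul_le_mul_of_nonneg_right ?_ (integral_nonneg fun y => by positivity)
    gcongr
  obtain ⟨M, hM⟩ := h.ae_bounded_tgrad hN hu
  obtain ⟨M', hM'⟩ := h.ae_bounded_tgrad hN hv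
  have hH := integral_norm_mul_norm_le hpq
    (MemLp.of_bound (p := p) (measurable_tgrad u).aestronglyMeasurable M hM)
    (MemLp.of_bound (p := q) (measurable_tgrad v).aestronglyMeasurable M' hM')
  refine hmain.trans (mul_le_mul_of_nonneg_left hH (by positivity))

end Mesh

/-! ### Voronoi cells -/

lemma inner_mem_Icc {y z : E3} (hy : ‖y‖ = 1) (hz : ‖z‖ = 1) :
    ⟪y, z⟫ ∈ Set.Icc (-1 : ℝ) 1 := by
  have := abs_real_inner_le_norm y z
  rw [hy, hz, one_mul] at this
  exact abs_le.1 this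

lemma mem_cell {x : Fin N → E3} (hx : ∀ i, ‖x i‖ = 1) {i : Fin N} {y : E3} :
    y ∈ cell x i ↔ ‖y‖ = 1 ∧ ∀ j, j ≠ i → ⟪y, x j⟫ < ⟪y, x i⟫ := by
  rw [cell, Set.mem_ofPred_eq, mem_S2]
  refine and_congr_right fun hy => forall₂_congr fun j _ => ?_
  exact Real.strictAntiOn_arccos.lt_iff_gt (inner_mem_Icc hy (hx i)) (inner_mem_Icc hy (hx j))

lemma isClosed_vcone (x : Fin N → E3) (i : Fin N) : IsClosed (vcone x i) := by
  simp only [vcone, Set.ofPred_forall]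
  exact isClosed_iInter fun j => isClosed_le (by fun_prop) (by fun_prop)

/-- Moving a point of the closed cone slightly towards `x i` makes every Voronoi inequality strict.
-/
lemma closure_cell {x : Fin N → E3} (hx : ∀ i, ‖x i‖ = 1) (hinj : Function.Injective x)
    (i : Fin N) : closure (cell x i) = S2 ∩ vcone x i := by
  apply Set.Subset.antisymm
  · refine closure_minimal (fun y hy => ?_) (Metric.isClosed_sphere.inter (isClosed_vcone x i))
    obtain ⟨h1, h2⟩ := (mem_cell hx).1 hy
    refine ⟨mem_S2.2 h1, fun j => ?_⟩
    by_cases hj : j = i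
    · rw [hj]
    · exact (h2 j hj).le
  · rintro y ⟨hyS, hy⟩
    have hy1 := mem_S2.1 hyS
    have hne : ∀ t : ℝ, 0 < t → t < 1 → y + t • x i ≠ 0 := by
      intro t ht ht1 h0
      have := congrArg (fun v : E3 => ‖v‖) (eq_neg_of_add_eq_zero_left h0)
      simp only [hy1, norm_neg, norm_smul, hx, mul_one, Real.norm_of_nonneg ht.le] at this
      linarith
    have hcont : ContinuousAt (fun t : ℝ => radialProj (y + t • x i)) 0 := by
      have h1 : ContinuousAt radialProj (y + (0 : ℝ) • x i) := by
        refine continuousOn_radialProj.continuousAt (IsOpen.mem_nhds isOpen_ne ?_)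
        rw [zero_smul, add_zero]
        exact norm_ne_zero_iff.1 (by rw [hy1]; norm_num)
      exact h1.comp (f := fun t : ℝ => y + t • x i) (by fun_prop)
    have ht : Filter.Tendsto (fun t : ℝ => radialProj (y + t • x i)) (nhdsWithin 0 (Set.Ioi 0))
        (nhds y) := by
      have := hcont.tendsto
      rw [zero_smul, add_zero, radialProj_of_norm_one hy1] at this
      exact this.mono_left nhdsWithin_le_nhds
    refine mem_closure_of_tendsto ht ?_
    filter_upwards [Ioo_mem_nhdsGT (zero_lt_one' ℝ)] with t ht
    have h0 := hne t ht.1 ht.2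
    rw [mem_cell hx]
    refine ⟨norm_radialProj h0, fun j hj => ?_⟩
    rw [radialProj, real_inner_smul_left, real_inner_smul_left]
    refine mul_lt_mul_of_pos_left ?_ (inv_pos.2 (norm_pos_iff.2 h0))
    rw [inner_add_left, inner_add_left, real_inner_smul_left, real_inner_smul_left,
      inner_self_one (hx i)]
    have h1 := hy j
    have h2 := inner_lt_one_of_ne (hx i) (hx j) (hinj.ne hj.symm)
    nlinarith [ht.1]

lemma transfer_site {x : Fin N → E3} (hx : ∀ i, ‖x i‖ = 1) (hinj : Function.Injective x)
    (v : E3 → ℝ) (i : Fin N) : transfer x v (x i) = v (x i) := by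
  rw [transfer, Finset.sum_eq_single i]
  · refine Set.indicator_of_mem ((mem_cell hx).2 ⟨hx i, fun j hj => ?_⟩) _
    rw [inner_self_one (hx i)]
    exact inner_lt_one_of_ne (hx i) (hx j) (hinj.ne hj.symm)
  · intro j _ hj
    refine Set.indicator_of_notMem (fun hm => ?_) _
    have := ((mem_cell hx).1 hm).2 i hj.symm
    rw [inner_self_one (hx i)] at this
    linarith [inner_lt_one_of_ne (hx i) (hx j) (hinj.ne hj.symm)]
  · intro h; exact absurd (Finset.mem_univ i) h

lemma cellRadius_nonneg (x : Fin N → E3) (i : Fin N) : 0 ≤ cellRadius x i := by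
  apply Real.sSup_nonneg
  rintro _ ⟨y, -, rfl⟩
  exact Real.arccos_nonneg _

lemma meshSize_nonneg (x : Fin N → E3) : 0 ≤ meshSize x :=
  Real.iSup_nonneg fun i => cellRadius_nonneg x i

lemma geoDist_le_meshSize {x : Fin N → E3} {i : Fin N} {y : E3} (hy : y ∈ cell x i) :
    geoDist (x i) y ≤ meshSize x := by
  have h1 : geoDist (x i) y ≤ cellRadius x i := by
    refine le_csSup ⟨Real.pi, ?_⟩ ⟨y, hy, rfl⟩
    rintro _ ⟨z, -, rfl⟩
    exact Real.arccos_le_pi _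
  exact h1.trans (le_ciSup (f := fun i => cellRadius x i) (Set.finite_range _).bddAbove i)

/-- The distance bound on the open cell passes to its closure by continuity and to the cone by
homogeneity. -/
lemma cos_meshSize_le {x : Fin N → E3} (hx : ∀ i, ‖x i‖ = 1) (hinj : Function.Injective x)
    (hm : meshSize x ≤ Real.pi) {i : Fin N} {y : E3} (hy : y ∈ vcone x i) :
    Real.cos (meshSize x) * ‖y‖ ≤ ⟪y, x i⟫ := by
  by_cases h0 : y = 0
  · simp [h0]
  have hsub : closure (cell x i) ⊆ {z | Real.cos (meshSize x) ≤ ⟪x i, z⟫} := by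
    refine closure_minimal (fun z hz => ?_) (isClosed_le (by fun_prop) (by fun_prop))
    have h1 := inner_mem_Icc (hx i) ((mem_cell hx).1 hz).1
    have h2 := Real.cos_le_cos_of_nonneg_of_le_pi (Real.arccos_nonneg _) hm
      (geoDist_le_meshSize hz)
    rwa [Real.cos_arccos h1.1 h1.2] at h2
  have hmem : radialProj y ∈ closure (cell x i) := by
    rw [closure_cell hx hinj]
    exact ⟨mem_S2.2 (norm_radialProj h0), vcone_smul (inv_nonneg.2 (norm_nonneg _)) hy⟩
  have := hsub hmem
  rw [Set.mem_ofPred_eq, radialProj, real_inner_smul_right, real_inner_comm,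
    ← div_eq_inv_mul, le_div_iff₀ (norm_pos_iff.2 h0)] at this
  exact this

lemma isDelaunay_of_del {x : Fin N → E3} (hcl : ∀ i, closure (cell x i) = S2 ∩ vcone x i)
    {i j k : Fin N} (hd : Del x i j k) : IsDelaunay x i j k := by
  obtain ⟨h1, h2, h3, c, hc, h⟩ := hd
  refine ⟨h1, h2, h3, c, ?_⟩
  rw [hcl, hcl, hcl]
  have := mem_S2.2 hc
  exact ⟨⟨⟨this, h i (by simp)⟩, ⟨this, h j (by simp)⟩⟩, ⟨this, h k (by simp)⟩⟩

lemma IsLiftedP1.liftedAffine {x : Fin N → E3} {u : E3 → ℝ} (hu : IsLiftedP1 x u)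
    (hcl : ∀ i, closure (cell x i) = S2 ∩ vcone x i) {i j k : Fin N} (hd : Del x i j k) :
    LiftedAffine {x i, x j, x k} u := by
  obtain ⟨-, w, ⟨-, hw⟩, h⟩ := hu
  have hD := isDelaunay_of_del hcl hd
  obtain ⟨l, hl⟩ := hw i j k hD
  exact ⟨l, fun y hy => (h y ⟨i, j, k, hD, hy⟩).trans (hl hy)⟩

/-- An almost uniform decomposition of mesh size less than `π / 2` whose Voronoi edges cross their
dual Delaunay edges is non-degenerate. -/
lemma mesh_of_almostUniform {x : Fin N → E3} (hx : ∀ i, ‖x i‖ = 1) (hinj : Function.Injective x)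
    {C₀ C₁ : ℝ} (hC₀ : 0 < C₀) (hau : AlmostUniform x C₀ C₁) (hec : EdgesCross x)
    (hm : meshSize x < Real.pi / 2) : Mesh x (Real.cos (meshSize x)) := by
  have hcl := closure_cell hx hinj
  have hpi := Real.pi_pos
  have hm0 := meshSize_nonneg x
  have hκ : 0 < Real.cos (meshSize x) := Real.cos_pos_of_mem_Ioo ⟨by linarith, hm⟩
  have hb : ∀ i, ∀ y ∈ vcone x i, Real.cos (meshSize x) * ‖y‖ ≤ ⟪y, x i⟫ := fun i y hy =>
    cos_meshSize_le hx hinj (by linarith) hy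
  have hnb : ∀ {i j : Fin N} {c : E3}, i ≠ j → ‖c‖ = 1 → c ∈ vcone x i → c ∈ vcone x j →
      j ∈ nbrs x i := fun {i j c} hij hc hi hj => by
    refine Finset.mem_filter.2 ⟨Finset.mem_univ _, hij.symm, c, ?_⟩
    rw [Mesh.closure_inter hcl]
    exact ⟨hc, hi, hj⟩
  refine ⟨hx, hinj, hκ, hb, ?_, ?_⟩
  · intro i j c hij hc hi hj
    -- Antipodal sites have midpoint the origin, which lies in every cone.
    by_cases h0 : midpoint ℝ (x i) (x j) = 0
    · rw [h0]; intro k; simp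
    have := hec i j (hnb hij hc hi hj)
    rw [Mesh.closure_inter hcl] at this
    have e : midpoint ℝ (x i) (x j) =
        ‖midpoint ℝ (x i) (x j)‖ • radialProj (midpoint ℝ (x i) (x j)) := by
      rw [radialProj, smul_smul, mul_inv_cancel₀ (norm_ne_zero_iff.2 h0), one_smul]
    rw [e]
    exact vcone_smul (norm_nonneg _) this.2.1
  · intro i j c hij hc hi hj d
    -- With mesh size zero, a common point of two cells would equal both sites.
    have hmpos : 0 < meshSize x := by
      refine lt_of_le_of_ne hm0 fun h0 => ?_
      have key : ∀ l, c ∈ vcone x l → c = x l := fun l hl => by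
        by_contra hne
        have h1 := hb l c hl
        rw [← h0, Real.cos_zero, one_mul, hc] at h1
        linarith [inner_lt_one_of_ne hc (hx l) hne]
      exact hij (hinj ((key i hi).symm.trans (key j hj)))
    by_contra hno
    push Not at hno
    have hsub : vedge x i j ⊆ {d} := by
      rw [Mesh.closure_inter hcl]
      rintro y ⟨h1, h2, h3⟩
      by_contra hyd
      exact hno y hyd h1 h2 h3
    have hz : len.real (vedge x i j) = 0 := by
      rw [measureReal_def, measure_mono_null hsub (len_finite (Set.finite_singleton d)),
        ENNReal.toReal_zero]
    have h1 := ((hau i).1 j (hnb hij hc hi hj)).1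
    rw [hz] at h1
    have : 0 < 1 / C₀ * meshSize x := by positivity
    linarith

end SphereFV

end

theorem mainTheorem8 (p q : ℝ≥0∞) (hp : 1 < p) (hpq : 1 / p + 1 / q = 1)
    (C₀ C₁ : ℝ) (hC₀ : 0 < C₀) (hC₁ : 0 < C₁) (H : ℝ) (hH : H < Real.pi / 2) :
    ∃ C : ℝ, 0 < C ∧
      ∀ (N : ℕ) (x : Fin N → SphereFV.E3), 0 < N → (∀ i, x i ∈ SphereFV.S2) →
        Function.Injective x →
        SphereFV.AlmostUniform x C₀ C₁ →
        SphereFV.EdgesCross x →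
        SphereFV.meshSize x ≤ H →
        ∀ u v : SphereFV.E3 → ℝ, SphereFV.IsLiftedP1 x u → SphereFV.IsLiftedP1 x v →
          |SphereFV.formA u v - SphereFV.formFV x u (SphereFV.transfer x v)| ≤
            C * SphereFV.meshSize x ^ 2 *
              SphereFV.tgradNorm p u * SphereFV.tgradNorm q v := by
  have hpi := Real.pi_pos
  -- The maximum with `0` keeps `κ` positive when `H` is very negative, since the constant is chosen
  -- before any mesh.
  set κ := Real.cos (max H 0) with hκ
  have hκ0 : 0 < κ := Real.cos_pos_of_mem_Ioo
    ⟨by linarith [le_max_right H 0], max_lt hH (by linarith)⟩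
  refine ⟨5 / κ ^ 5, by positivity, fun N x hN hxS hinj hau hec hm u v hu hv => ?_⟩
  have hx : ∀ i, ‖x i‖ = 1 := fun i => SphereFV.mem_S2.1 (hxS i)
  have hcl := SphereFV.closure_cell hx hinj
  have hm0 := SphereFV.meshSize_nonneg x
  have hmesh := SphereFV.mesh_of_almostUniform hx hinj hC₀ hau hec (hm.trans_lt hH)
  have hmain := hmesh.abs_formA_sub_formFV_le (Real.cos_le_one _) hN hcl
    (fun i j k hd => hu.liftedAffine hcl hd) (fun i j k hd => hv.liftedAffine hcl hd)
    (SphereFV.transfer_site hx hinj v) hpq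
  refine hmain.trans ?_
  have hle : κ ≤ Real.cos (SphereFV.meshSize x) :=
    Real.cos_le_cos_of_nonneg_of_le_pi hm0 (by linarith [max_lt hH (by linarith : 0 < Real.pi / 2)])
      (hm.trans (le_max_left _ _))
  have hsin : 1 - Real.cos (SphereFV.meshSize x) ^ 2 ≤ SphereFV.meshSize x ^ 2 := by
    rw [← Real.sin_sq]
    exact Real.sin_sq_le_sq
  have hfac : 5 * (1 - Real.cos (SphereFV.meshSize x) ^ 2) / Real.cos (SphereFV.meshSize x) ^ 5 ≤
      5 / κ ^ 5 * SphereFV.meshSize x ^ 2 := by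
    rw [div_mul_eq_mul_div]
    gcongr
  have hn : 0 ≤ SphereFV.tgradNorm p u * SphereFV.tgradNorm q v :=
    mul_nonneg ENNReal.toReal_nonneg ENNReal.toReal_nonneg
  calc _ ≤ 5 / κ ^ 5 * SphereFV.meshSize x ^ 2 *
        (SphereFV.tgradNorm p u * SphereFV.tgradNorm q v) := mul_le_mul_of_nonneg_right hfac hn
    _ = _ := by ring
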